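/- Let $\mathbb T=\mathbb R/2\pi\mathbb Z$, $\Omega=\mathbb T^2\times(-1,1)$, $\Gamma=\mathbb T^2\times\{\pm1\}$ with outward unit normal $\nu=(0,0,\pm1)$, let $\tau_1=(1,0,0)$, $\tau_2=(0,1,0)$, $\mathbb D\mathbf u=\frac12(\nabla\mathbf u+\nabla^\top\mathbf u)$, and let all Sobolev spaces be those of real-valued functions (or vector fields) on $\Omega$. Put $$H_{\mathcal P}=\{\mathbf v\in L^2(\Omega)^3:\ \nabla\cdot\mathbf v=0 \text{ in }\Omega,\ \mathbf v\cdot\nu=0\text{ on }\Gamma\},\qquad V_{\mathcal P}=H^1(\Omega)^3\cap H_{\mathcal P}.$$ Let $\beta\ge 0$. For $\mathbf f\in L^2(\Omega)^3$ consider the Stokes problem with Navier friction conditions $$-\Delta\mathbf u+\nabla q=\mathbf f,\quad \nabla\cdot\mathbf u=0\ \text{ in }\Omega,\qquad \mathbf u\cdot\nu=0,\quad 2(\mathbb D\mathbf u\,\nu)\cdot\tau_j+\beta\,\mathbf u\cdot\tau_j=0\ (j=1,2)\ \text{ on }\Gamma. \tag{S}$$ A strong solution is a pair $(\mathbf u,q)\in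 (H^2(\Omega)^3\cap V_{\mathcal P})\times H^1(\Omega)$ that satisfies the equations almost everywhere in $\Omega$ and the boundary conditions in the sense of traces. Then the following hold. 1. There is a constant $C>0$, depending only on $\beta$ (and $\Omega$), such that for every $\mathbf f\in L^2(\Omega)^3$, which if $\beta=0$ is also assumed to be orthogonal in $L^2(\Omega)^3$ to the constant fields $(a,b,0)$, i.e. $\int_\Omega f_1=\int_\Omega f_2=0$, there is a strong solution $(\mathbf u,q)$ of (S) with $$\|\mathbf u\|_{H^2(\Omega)}+\|q\|_{H^1(\Omega)}\le C\|\mathbf f\|_{L^2(\Omega)}.$$ 2. The strong solution is unique up to constants: if $(\mathbf u_1,q_1)$ and $(\mathbf u_2,q_2)$ are strong solutions of (S) for the same $\mathbf f$, then $q_1-q_2$ is constant and $\mathbf u_1-\mathbf u_2$ is a constant field $(a,b,0)$, with $a=b=0$ if $\beta>0$. 3. Let $\widetilde\Delta\mathbf u$ be the $L^2$-orthogonal projection of $\Delta\mathbf u$ onto $H_{\mathcal P}$ (the Stokes operator). On the linear space of all $\mathbf u\in H^2(\Omega)^3\cap H_{\mathcal P}$ that satisfy $2(\mathbb D\mathbf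 u\,\nu)\cdot\tau_j+\beta\,\mathbf u\cdot\tau_j=0$ on $\Gamma$ for $j=1,2$, and if $\beta=0$ also $\int_\Omega u_1=\int_\Omega u_2=0$, the map $\mathbf u\mapsto\|\widetilde\Delta\mathbf u\|_{L^2(\Omega)}$ is a norm, and it is equivalent to the norm of $H^2(\Omega)$. -/

import Mathlib

open MeasureTheory Real
open scoped ContDiff

namespace NavierSlab

noncomputable section

/-! ### The domain `Ω = 𝕋² × (-1, 1)`, its boundary `Γ = 𝕋² × {±1}`, and `L²(Ω)` -/

/-- The torus `𝕋 = ℝ / 2πℤ`. -/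
abbrev Torus : Type := AddCircle (2 * π)

instance fact_two_pi_pos : Fact ((0 : ℝ) < 2 * π) := ⟨Real.two_pi_pos⟩

/-- The ambient group `𝕋² × ℝ`, with points `(x, y, z)`. -/
abbrev Slab : Type := Torus × Torus × ℝ

/-- `Ω = 𝕋² × (-1, 1)`. -/
def Omega : Set Slab := {p | p.2.2 ∈ Set.Ioo (-1 : ℝ) 1}

/-- Lebesgue measure on `Ω`. -/
def volOmega : Measure Slab := volume.restrict Omega

/-- The value space of vector fields, `ℝ³` with its Euclidean norm. -/
abbrev R3 : Type := EuclideanSpace ℝ (Fin 3)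

/-- Scalar `L²(Ω)`. -/
abbrev L2 : Type := Lp ℝ 2 volOmega

/-- Vector valued `L²(Ω)`, a Hilbert space with `‖u‖² = ∫_Ω |u|²`. -/
abbrev L2V : Type := Lp R3 2 volOmega

/-- `L²(𝕋²)`: functions on one of the two components of `Γ`. -/
abbrev L2T : Type := Lp ℝ 2 (volume : Measure (Torus × Torus))

/-- The component `u_i` of a vector field, for `i = 0, 1, 2` (directions `x, y, z`). -/
def comp (i : Fin 3) (u : L2V) : L2 :=
  (EuclideanSpace.proj i : R3 →L[ℝ] ℝ).compLp u

/-- The vector field with given components. -/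
def ofComp (g : Fin 3 → L2) : L2V :=
  ∑ i, (ContinuousLinearMap.toSpanSingleton ℝ (EuclideanSpace.single i (1 : ℝ) : R3)).compLp (g i)

/-! ### Smooth functions on `𝕋² × ℝ` and test functions on `Ω` -/

/-- `φ` is `C^∞` on `𝕋² × ℝ`: its lift to `ℝ³`, which is `2π`-periodic in `x` and `y`,
is `C^∞`. -/
def IsSmooth (φ : Slab → ℝ) : Prop :=
  ContDiff ℝ ∞ (fun x : ℝ × ℝ × ℝ => φ ((x.1 : Torus), (x.2.1 : Torus), x.2.2))

/-- Translation by `t` in the `i`-th coordinate direction. -/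
def shift : Fin 3 → ℝ → Slab :=
  ![fun t => ((t : Torus), 0, 0), fun t => (0, (t : Torus), 0), fun t => (0, 0, t)]

/-- The classical partial derivative `∂_i φ` at `p`. -/
def pderiv (i : Fin 3) (φ : Slab → ℝ) (p : Slab) : ℝ :=
  deriv (fun t : ℝ => φ (p + shift i t)) 0

/-- `φ ∈ C_c^∞(Ω)`. -/
def IsTest (φ : Slab → ℝ) : Prop :=
  IsSmooth φ ∧ HasCompactSupport φ ∧ tsupport φ ⊆ Omega

/-! ### Weak derivatives and Sobolev spaces -/

/-- `g ∈ L²(Ω)` is the weak derivative `∂_i f` of `f ∈ L²(Ω)` on `Ω = 𝕋² × (-1, 1)`. -/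
def HasWeakDeriv (i : Fin 3) (f g : L2) : Prop :=
  ∀ φ : Slab → ℝ, IsTest φ →
    ∫ p, f p * pderiv i φ p ∂volOmega = -∫ p, g p * φ p ∂volOmega

open Classical in
/-- The weak derivative `∂_i f` in `L²(Ω)` (with value `0` if there is none). -/
def wderiv (i : Fin 3) (f : L2) : L2 :=
  if h : ∃ g : L2, HasWeakDeriv i f g then h.choose else 0

/-- `f ∈ H¹(Ω)`. -/
def MemH1 (f : L2) : Prop := ∀ i, ∃ g : L2, HasWeakDeriv i f g

/-- `f ∈ H²(Ω)`. -/
def MemH2 (f : L2) : Prop := MemH1 f ∧ ∀ i, MemH1 (wderiv i f)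

/-- `u ∈ H¹(Ω)` for vector fields. -/
def MemH1V (u : L2V) : Prop := ∀ j, MemH1 (comp j u)

/-- `u ∈ H²(Ω)` for vector fields. -/
def MemH2V (u : L2V) : Prop := ∀ j, MemH2 (comp j u)

/-- The norm of `H¹(Ω)`. -/
def normH1 (f : L2) : ℝ := √(‖f‖ ^ 2 + ∑ i, ‖wderiv i f‖ ^ 2)

/-- The norm of `H²(Ω)` for vector fields. -/
def normH2V (u : L2V) : ℝ :=
  √(∑ j, (‖comp j u‖ ^ 2 + ∑ i, ‖wderiv i (comp j u)‖ ^ 2 +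
    ∑ i, ∑ k, ‖wderiv k (wderiv i (comp j u))‖ ^ 2))

/-! ### Differential operators -/

/-- `∇q`. -/
def grad (q : L2) : L2V := ofComp fun i => wderiv i q

/-- `∇ · u`. -/
def divergence (u : L2V) : L2 := ∑ i, wderiv i (comp i u)

/-- `Δu`, componentwise. -/
def laplacian (u : L2V) : L2V :=
  ofComp fun j => ∑ i, wderiv i (wderiv i (comp j u))

/-- The entry `(i, j)` of the strain tensor `𝔻u = (∇u + ∇ᵀu) / 2`. -/
def strain (u : L2V) (i j : Fin 3) : L2 :=
  (1 / 2 : ℝ) • (wderiv i (comp j u) + wderiv j (comp i u))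

/-! ### Traces on `Γ` -/

/-- `f ∈ H¹(Ω)` has trace `t₁` on `𝕋² × {1}` and trace `t₀` on `𝕋² × {-1}`.
The trace is the function on `Γ` in the Gauss-Green formula
`∫_Ω (∂_z f) φ + f ∂_z φ = ∫_Γ f φ ν_z` for all `φ ∈ C^∞(Ω̄)`, where `ν_z = ±1` at `z = ±1`;
this determines `t₁` and `t₀` uniquely. -/
def HasTrace (f : L2) (t₁ t₀ : L2T) : Prop :=
  MemH1 f ∧ ∀ φ : Slab → ℝ, IsSmooth φ →
    ∫ p, (wderiv 2 f p * φ p + f p * pderiv 2 φ p) ∂volOmega =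
      (∫ y, t₁ y * φ (y.1, y.2, 1)) - ∫ y, t₀ y * φ (y.1, y.2, -1)

/-- `u · ν = 0` on `Γ`, where `ν = (0, 0, ±1)` at `z = ±1`. -/
def NoPenetration (u : L2V) : Prop := HasTrace (comp 2 u) 0 0

/-- `2 (𝔻u · ν) · τ + β u · τ = 0` on `Γ`, for `τ` the unit vectors in the directions
`x` and `y`; `ν = (0, 0, 1)` at `z = 1` and `ν = (0, 0, -1)` at `z = -1`. -/
def NavierSlip (β : ℝ) (u : L2V) : Prop :=
  ∀ j : Fin 3, j ≠ 2 → ∃ d₁ d₀ a₁ a₀ : L2T,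
    HasTrace (strain u j 2) d₁ d₀ ∧ HasTrace (comp j u) a₁ a₀ ∧
    (2 : ℝ) • d₁ + β • a₁ = 0 ∧ (2 : ℝ) • (-d₀) + β • a₀ = 0

/-! ### The spaces `H_𝒫` and `V_𝒫` -/

/-- The gradients of functions in `C^∞(Ω̄)`, as elements of `L²(Ω)`. -/
def smoothGradients : Set L2V :=
  {g | ∃ φ : Slab → ℝ, IsSmooth φ ∧ ∀ᵐ p ∂volOmega, ∀ i, g p i = pderiv i φ p}

/-- `H_𝒫 = {u ∈ L²(Ω) : ∇ · u = 0, u · ν = 0 on Γ}`, with the distributional divergence and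
the normal trace: by the Green formula that defines the normal trace, `∇ · u = 0` in `Ω` and
`u · ν = 0` on `Γ` mean that `∫_Ω u · ∇φ = 0` for all `φ ∈ C^∞(Ω̄)`. -/
def HP : Submodule ℝ L2V := (Submodule.span ℝ smoothGradients)ᗮ

instance hasProj_HP : HP.HasOrthogonalProjection := by
  have hc : IsClosed (HP : Set L2V) := Submodule.isClosed_orthogonal _
  have : CompleteSpace HP := hc.completeSpace_coe
  exact Submodule.HasOrthogonalProjection.ofCompleteSpace HP

/-- `V_𝒫 = H¹(Ω) ∩ H_𝒫`. -/
def VP : Set L2V := {u | MemH1V u ∧ u ∈ HP}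

/-! ### Strong solutions and the Stokes operator -/

/-- `(u, q) ∈ (H²(Ω) ∩ V_𝒫) × H¹(Ω)` is a strong solution of the Stokes problem with
Navier friction conditions: the equations hold almost everywhere in `Ω`, the boundary
conditions in the sense of traces. -/
structure IsStrongSolution (β : ℝ) (f u : L2V) (q : L2) : Prop where
  memH2 : MemH2V u
  memVP : u ∈ VP
  memH1 : MemH1 q
  momentum : -laplacian u + grad q = f
  div_free : divergence u = 0
  no_penetration : NoPenetration u
  navier_slip : NavierSlip β u

/-- The Stokes operator `Δ̃u`: the `L²`-orthogonal projection of `Δu` onto `H_𝒫`. -/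
def stokesOp (u : L2V) : L2V := HP.starProjection (laplacian u)

/-- `∫_Ω v₁ = ∫_Ω v₂ = 0`: `v` is orthogonal to the constant fields `(a, b, 0)`. -/
def HorizontalMeanZero (v : L2V) : Prop :=
  ∀ j : Fin 3, j ≠ 2 → ∫ p, comp j v p ∂volOmega = 0

/-- The domain of the Stokes operator with Navier friction conditions: the fields in
`H²(Ω) ∩ H_𝒫` that satisfy the Navier condition on `Γ` and, if `β = 0`, are orthogonal to the
constant fields `(a, b, 0)`. -/
def stokesDomain (β : ℝ) : Set L2V :=
  {u | MemH2V u ∧ u ∈ HP ∧ NavierSlip β u ∧ (β = 0 → HorizontalMeanZero u)}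

/-- `D` is a linear subspace and `N` restricts to a norm on it. -/
structure IsNormOn (D : Set L2V) (N : L2V → ℝ) : Prop where
  zero_mem : (0 : L2V) ∈ D
  add_mem : ∀ u ∈ D, ∀ v ∈ D, u + v ∈ D
  smul_mem : ∀ (a : ℝ), ∀ u ∈ D, a • u ∈ D
  nonneg : ∀ u ∈ D, 0 ≤ N u
  eq_zero_iff : ∀ u ∈ D, (N u = 0 ↔ u = 0)
  smul : ∀ (a : ℝ), ∀ u ∈ D, N (a • u) = |a| * N u
  add_le : ∀ u ∈ D, ∀ v ∈ D, N (u + v) ≤ N u + N v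

end

end NavierSlab

open NavierSlab

/-!
Since `u_2 = 0` on `Γ`, also `∂_j u_2 = 0` there for the tangential directions `j`, so the Navier
condition is the Robin condition `∂_ν u_j + β u_j = 0` for `j = 0, 1` (`IsAdmissible`). This makes
the problem explicitly solvable and the `H²` estimate elementary.

*Many classical solutions.* For a force `cos (m x + n y + θ) P(z)` with a polynomial `P`, the
problem reduces to ordinary differential equations in `z`, which are solved by polynomials and
hyperbolic functions: a second order one for the velocity orthogonal to `(m, n)`
(`exists_transverse`), a fourth order one for the vertical velocity (`exists_longitudinal`), and a
second order one for frequency zero (`exists_horizontal`). By the Stone-Weierstrass theorem these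
forces are total in `L²(Ω)³`, up to the fields `(a, b, 0)` if `β = 0`
(`eq_const_of_inner_force_eq_zero`).

*A priori estimate for smooth solutions* (`exists_apriori`). Testing with `u` bounds `u` and `∇u`.
Testing with `-∂_a² u` for horizontal `a` preserves the boundary conditions and bounds all second
derivatives with a horizontal direction, hence also `∂_z² u_2 = -∂_z (∂_x u_0 + ∂_y u_1)`. Testing
with `∇q` leaves of `Δu` only the boundary term `β ∫_Γ q ∂_z u_2`, whose factors are already under
control after rewriting it as an integral over `Ω`; this bounds `∇q`, and the equation bounds the
remaining `∂_z² u_0`, `∂_z² u_1`.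

*Existence.* The estimate makes the set of forces of limits of classical solutions closed
(`exists_mem_closure_of_apriori`), and it is dense; strong solutions are stable under the limits
(`exists_strong_solution`).

*Uniqueness and the Stokes operator.* Green's formula shows that the Stokes operator is symmetric
between strong and classical solutions (`sum_inner_force`). If the projection of `Δw` onto `H_𝒫`
vanishes, then `w` is therefore orthogonal to the forces of all classical solutions, so it is a
constant field `(a, b, 0)`, zero if `β > 0`. This gives uniqueness and the definiteness of
`‖stokesOp u‖`. Finally `u` is the strong solution with force `-stokesOp u`, so the estimate of the
existence part bounds its `H²` norm by `‖stokesOp u‖`.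
-/

namespace NavierSlab

noncomputable section

/-! ### The algebra of smooth functions on `𝕋² × ℝ` -/

/-- The covering map `ℝ³ → 𝕋² × ℝ`. -/
def cov (x : ℝ × ℝ × ℝ) : Slab := ((x.1 : Torus), (x.2.1 : Torus), x.2.2)

/-- The coordinate directions of `ℝ³`. -/
def dir : Fin 3 → ℝ × ℝ × ℝ := ![(1, 0, 0), (0, 1, 0), (0, 0, 1)]

theorem isOpenQuotientMap_cov : IsOpenQuotientMap cov := by
  have h : IsOpenQuotientMap (fun x : ℝ => (x : Torus)) :=
    QuotientAddGroup.isOpenQuotientMap_mk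
  exact h.prodMap (h.prodMap IsOpenQuotientMap.id)

theorem cov_surjective : Function.Surjective cov := isOpenQuotientMap_cov.surjective

theorem cov_add_shift (i : Fin 3) (x : ℝ × ℝ × ℝ) (t : ℝ) :
    cov x + shift i t = cov (x + t • dir i) := by
  fin_cases i <;> simp [cov, shift, dir]

theorem isSmooth_iff {φ : Slab → ℝ} : IsSmooth φ ↔ ContDiff ℝ ∞ (φ ∘ cov) := Iff.rfl

theorem IsSmooth.hasFDerivAt {φ : Slab → ℝ} (h : IsSmooth φ) (x : ℝ × ℝ × ℝ) :
    HasFDerivAt (φ ∘ cov) (fderiv ℝ (φ ∘ cov) x) x :=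
  ((isSmooth_iff.1 h).differentiable (by simp) x).hasFDerivAt

theorem IsSmooth.hasDerivAt_line {φ : Slab → ℝ} (h : IsSmooth φ) (i : Fin 3)
    (x : ℝ × ℝ × ℝ) (s : ℝ) :
    HasDerivAt (fun t : ℝ => φ (cov (x + t • dir i)))
      (fderiv ℝ (φ ∘ cov) (x + s • dir i) (dir i)) s := by
  have h1 : HasDerivAt (fun t : ℝ => x + t • dir i) (dir i) s := by
    simpa using ((hasDerivAt_id s).smul_const (dir i)).const_add x
  exact (h.hasFDerivAt (x + s • dir i)).comp_hasDerivAt s h1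

theorem IsSmooth.pderiv_cov {φ : Slab → ℝ} (h : IsSmooth φ) (i : Fin 3) (x : ℝ × ℝ × ℝ) :
    pderiv i φ (cov x) = fderiv ℝ (φ ∘ cov) x (dir i) := by
  have := (h.hasDerivAt_line i x 0).deriv
  simpa [pderiv, cov_add_shift] using this

theorem IsSmooth.pderiv_comp_cov {φ : Slab → ℝ} (h : IsSmooth φ) (i : Fin 3) :
    pderiv i φ ∘ cov = fun x => fderiv ℝ (φ ∘ cov) x (dir i) :=
  funext fun x => h.pderiv_cov i x

theorem IsSmooth.pderiv {φ : Slab → ℝ} (h : IsSmooth φ) (i : Fin 3) :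
    IsSmooth (pderiv i φ) := by
  rw [isSmooth_iff, h.pderiv_comp_cov]
  exact ((isSmooth_iff.1 h).fderiv_right (m := ∞) (by simp)).clm_apply contDiff_const

/-- The partial derivative along a coordinate line, at every point of the line. -/
theorem IsSmooth.hasDerivAt_pderiv {φ : Slab → ℝ} (h : IsSmooth φ) (i : Fin 3)
    (x : ℝ × ℝ × ℝ) (s : ℝ) :
    HasDerivAt (fun t : ℝ => φ (cov (x + t • dir i)))
      (NavierSlab.pderiv i φ (cov (x + s • dir i))) s := by
  rw [h.pderiv_cov]; exact h.hasDerivAt_line i x s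

theorem IsSmooth.continuous {φ : Slab → ℝ} (h : IsSmooth φ) : Continuous φ :=
  isOpenQuotientMap_cov.isQuotientMap.continuous_iff.2 (isSmooth_iff.1 h).continuous

/-- The algebra `C^∞(𝕋² × ℝ)`. -/
def smoothFn : Subalgebra ℝ (Slab → ℝ) where
  carrier := {φ | IsSmooth φ}
  mul_mem' h h' := (isSmooth_iff.1 h).mul (isSmooth_iff.1 h')
  add_mem' h h' := (isSmooth_iff.1 h).add (isSmooth_iff.1 h')
  algebraMap_mem' c := isSmooth_iff.2 (contDiff_const (c := c))

/-- Smooth functions on `𝕋² × ℝ`, as a type. -/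
abbrev Smooth : Type := smoothFn

theorem Smooth.isSmooth (φ : Smooth) : IsSmooth (φ : Slab → ℝ) := φ.2

theorem Smooth.continuous (φ : Smooth) : Continuous (φ : Slab → ℝ) := φ.isSmooth.continuous

theorem Smooth.ext_cov {φ ψ : Smooth} (h : ∀ x, φ.1 (cov x) = ψ.1 (cov x)) : φ = ψ := by
  apply Subtype.ext
  funext p
  obtain ⟨x, rfl⟩ := cov_surjective p
  exact h x

theorem Smooth.ext_apply {φ ψ : Smooth} (h : ∀ p, φ.1 p = ψ.1 p) : φ = ψ :=
  Subtype.ext (funext h)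

theorem Smooth.add_apply (φ ψ : Smooth) (p : Slab) : (φ + ψ).1 p = φ.1 p + ψ.1 p := rfl

theorem Smooth.sub_apply (φ ψ : Smooth) (p : Slab) : (φ - ψ).1 p = φ.1 p - ψ.1 p := rfl

theorem Smooth.neg_apply (φ : Smooth) (p : Slab) : (-φ).1 p = -φ.1 p := rfl

theorem Smooth.mul_apply (φ ψ : Smooth) (p : Slab) : (φ * ψ).1 p = φ.1 p * ψ.1 p := rfl

theorem Smooth.smul_apply (c : ℝ) (φ : Smooth) (p : Slab) : (c • φ).1 p = c * φ.1 p := rfl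

theorem Smooth.zero_apply (p : Slab) : (0 : Smooth).1 p = 0 := rfl

theorem Smooth.neg_mul (φ ψ : Smooth) : -φ * ψ = -(φ * ψ) :=
  Smooth.ext_apply fun _ => _root_.neg_mul _ _

theorem Smooth.mul_neg (φ ψ : Smooth) : φ * -ψ = -(φ * ψ) :=
  Smooth.ext_apply fun _ => _root_.mul_neg _ _

/-- The partial derivative `∂_i` on smooth functions. -/
def D (i : Fin 3) : Smooth →ₗ[ℝ] Smooth where
  toFun φ := ⟨pderiv i φ.1, φ.isSmooth.pderiv i⟩
  map_add' φ ψ := by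
    apply Smooth.ext_cov
    intro x
    have h := (φ.isSmooth.hasDerivAt_pderiv i x 0).add (ψ.isSmooth.hasDerivAt_pderiv i x 0)
    have h' := ((φ + ψ).isSmooth.hasDerivAt_pderiv i x 0)
    simpa using h'.unique h
  map_smul' c φ := by
    apply Smooth.ext_cov
    intro x
    have h := (φ.isSmooth.hasDerivAt_pderiv i x 0).const_mul c
    have h' := ((c • φ).isSmooth.hasDerivAt_pderiv i x 0)
    simpa using h'.unique h

@[simp] theorem D_coe (i : Fin 3) (φ : Smooth) : (D i φ : Slab → ℝ) = pderiv i φ := rfl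

theorem D_mul (i : Fin 3) (φ ψ : Smooth) : D i (φ * ψ) = D i φ * ψ + φ * D i ψ := by
  apply Smooth.ext_cov
  intro x
  have h := (φ.isSmooth.hasDerivAt_pderiv i x 0).mul (ψ.isSmooth.hasDerivAt_pderiv i x 0)
  have h' := ((φ * ψ).isSmooth.hasDerivAt_pderiv i x 0)
  simpa using h'.unique h

theorem D_comm (i j : Fin 3) (φ : Smooth) : D i (D j φ) = D j (D i φ) := by
  apply Smooth.ext_cov
  intro x
  have key : ∀ i j : Fin 3, (D i (D j φ)).1 (cov x) =
      fderiv ℝ (fderiv ℝ (φ.1 ∘ cov)) x (dir i) (dir j) := by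
    intro i j
    rw [D_coe, (D j φ).isSmooth.pderiv_cov, D_coe, φ.isSmooth.pderiv_comp_cov]
    have h2 : DifferentiableAt ℝ (fderiv ℝ (φ.1 ∘ cov)) x :=
      ((isSmooth_iff.1 φ.2).fderiv_right (m := ∞) (by simp)).differentiable (by simp) x
    rw [fderiv_clm_apply h2 (differentiableAt_const _)]
    simp
  rw [key, key]
  have hs : IsSymmSndFDerivAt ℝ (φ.1 ∘ cov) x :=
    (isSmooth_iff.1 φ.2).contDiffAt.isSymmSndFDerivAt (by
      simpa using WithTop.coe_le_coe.2 (le_top : (2 : ℕ∞) ≤ ⊤))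
  exact hs _ _

/-- The smooth function `(x, y, z) ↦ h z`. -/
def ofZ (h : ℝ → ℝ) (hh : ContDiff ℝ ∞ h) : Smooth :=
  ⟨fun p => h p.2.2, by
    change ContDiff ℝ ∞ (fun x : ℝ × ℝ × ℝ => h x.2.2)
    exact hh.comp (contDiff_snd.comp contDiff_snd)⟩

@[simp] theorem ofZ_apply (h : ℝ → ℝ) (hh : ContDiff ℝ ∞ h) (p : Slab) :
    (ofZ h hh).1 p = h p.2.2 := rfl

theorem D_two_ofZ {h h' : ℝ → ℝ} (hh : ContDiff ℝ ∞ h) (hh' : ContDiff ℝ ∞ h')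
    (hd : ∀ z, HasDerivAt h (h' z) z) : D 2 (ofZ h hh) = ofZ h' hh' := by
  apply Smooth.ext_cov
  intro x
  have h1 := (ofZ h hh).isSmooth.hasDerivAt_pderiv 2 x 0
  have h2 : HasDerivAt (fun t : ℝ => (ofZ h hh).1 (cov (x + t • dir 2))) (h' x.2.2) 0 := by
    have h3 : HasDerivAt (fun t : ℝ => x.2.2 + t) 1 0 := by
      simpa using (hasDerivAt_id (0 : ℝ)).const_add x.2.2
    have := HasDerivAt.comp (0 : ℝ) (h₂ := h) (h₂' := h' (x.2.2)) (by simpa using hd x.2.2) h3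
    simpa [cov, dir, Function.comp_def] using this
  simpa [cov] using h1.unique h2

theorem D_ofZ {i : Fin 3} (hi : i ≠ 2) {h : ℝ → ℝ} (hh : ContDiff ℝ ∞ h) :
    D i (ofZ h hh) = 0 := by
  apply Smooth.ext_cov
  intro x
  have h1 := (ofZ h hh).isSmooth.hasDerivAt_pderiv i x 0
  have h2 : HasDerivAt (fun t : ℝ => (ofZ h hh).1 (cov (x + t • dir i))) 0 0 := by
    have h3 : (fun t : ℝ => (ofZ h hh).1 (cov (x + t • dir i))) = fun _ => h x.2.2 := by
      funext t
      fin_cases i <;> simp_all [cov, dir]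
    rw [h3]; exact hasDerivAt_const _ _
  simpa [cov] using h1.unique h2

/-- The Fourier mode `cos (m x + n y + θ)`, written with the characters of the circle. -/
def modeFn (m n : ℤ) (θ : ℝ) (p : Slab) : ℝ :=
  (Complex.exp (θ * Complex.I) * fourier m p.1 * fourier n p.2.1).re

theorem modeFn_cov (m n : ℤ) (θ : ℝ) (x : ℝ × ℝ × ℝ) :
    modeFn m n θ (cov x) = Real.cos (m * x.1 + n * x.2.1 + θ) := by
  have hπ : (π : ℂ) ≠ 0 := by exact_mod_cast Real.pi_ne_zero
  simp only [modeFn, cov, fourier_coe_apply]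
  rw [← Complex.exp_add, ← Complex.exp_add,
    ← Complex.exp_ofReal_mul_I_re (m * x.1 + n * x.2.1 + θ)]
  congr 2
  push_cast
  field_simp
  ring

/-- The Fourier mode `cos (m x + n y + θ)` as a smooth function. -/
def mode (m n : ℤ) (θ : ℝ) : Smooth :=
  ⟨modeFn m n θ, by
    change ContDiff ℝ ∞ (fun x : ℝ × ℝ × ℝ => modeFn m n θ (cov x))
    simp only [modeFn_cov]
    fun_prop⟩

@[simp] theorem mode_cov (m n : ℤ) (θ : ℝ) (x : ℝ × ℝ × ℝ) :
    (mode m n θ).1 (cov x) = Real.cos (m * x.1 + n * x.2.1 + θ) := modeFn_cov m n θ x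

theorem D_zero_mode (m n : ℤ) (θ : ℝ) : D 0 (mode m n θ) = (m : ℝ) • mode m n (θ + π / 2) := by
  apply Smooth.ext_cov
  intro x
  have h1 := (mode m n θ).isSmooth.hasDerivAt_pderiv 0 x 0
  have h2 : HasDerivAt (fun t : ℝ => (mode m n θ).1 (cov (x + t • dir 0)))
      (-Real.sin (m * x.1 + n * x.2.1 + θ) * m) 0 := by
    simp only [mode_cov]
    have h3 : HasDerivAt (fun t : ℝ => m * (x.1 + t) + n * x.2.1 + θ) (m : ℝ) 0 := by
      simpa using ((((hasDerivAt_id (0 : ℝ)).const_add x.1).const_mul (m : ℝ)).add_const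
        (n * x.2.1)).add_const θ
    simpa [dir] using h3.cos
  have h3 := h1.unique h2
  simp only [zero_smul, add_zero] at h3
  rw [D_coe, h3]
  simp [← add_assoc, Real.cos_add_pi_div_two, mul_comm]

theorem D_one_mode (m n : ℤ) (θ : ℝ) : D 1 (mode m n θ) = (n : ℝ) • mode m n (θ + π / 2) := by
  apply Smooth.ext_cov
  intro x
  have h1 := (mode m n θ).isSmooth.hasDerivAt_pderiv 1 x 0
  have h2 : HasDerivAt (fun t : ℝ => (mode m n θ).1 (cov (x + t • dir 1)))
      (-Real.sin (m * x.1 + n * x.2.1 + θ) * n) 0 := by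
    simp only [mode_cov]
    have h3 : HasDerivAt (fun t : ℝ => m * x.1 + n * (x.2.1 + t) + θ) (n : ℝ) 0 := by
      simpa using ((((hasDerivAt_id (0 : ℝ)).const_add x.2.1).const_mul (n : ℝ)).const_add
        (m * x.1)).add_const θ
    simpa [dir] using h3.cos
  have h3 := h1.unique h2
  simp only [zero_smul, add_zero] at h3
  rw [D_coe, h3]
  simp [← add_assoc, Real.cos_add_pi_div_two, mul_comm]

theorem D_two_mode (m n : ℤ) (θ : ℝ) : D 2 (mode m n θ) = 0 := by
  apply Smooth.ext_cov
  intro x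
  have h1 := (mode m n θ).isSmooth.hasDerivAt_pderiv 2 x 0
  have h2 : HasDerivAt (fun t : ℝ => (mode m n θ).1 (cov (x + t • dir 2))) 0 0 := by
    simp only [mode_cov]
    simpa [dir] using hasDerivAt_const (0 : ℝ) (Real.cos (m * x.1 + n * x.2.1 + θ))
  have h3 := h1.unique h2
  simpa using h3

theorem mode_add_pi (m n : ℤ) (θ : ℝ) : mode m n (θ + π / 2 + π / 2) = -mode m n θ := by
  apply Smooth.ext_cov
  intro x
  have : (m * x.1 + n * x.2.1 + (θ + π / 2 + π / 2) : ℝ) = m * x.1 + n * x.2.1 + θ + π := by ring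
  simp [this]

theorem mode_mul (m n m' n' : ℤ) (θ θ' : ℝ) :
    mode m n θ * mode m' n' θ' =
      (1 / 2 : ℝ) • (mode (m + m') (n + n') (θ + θ') + mode (m - m') (n - n') (θ - θ')) := by
  apply Smooth.ext_cov
  intro x
  have e1 : (((m + m' : ℤ) : ℝ) * x.1 + ((n + n' : ℤ) : ℝ) * x.2.1 + (θ + θ')) =
    (m * x.1 + n * x.2.1 + θ) + (m' * x.1 + n' * x.2.1 + θ') := by push_cast; ring
  have e2 : (((m - m' : ℤ) : ℝ) * x.1 + ((n - n' : ℤ) : ℝ) * x.2.1 + (θ - θ')) =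
    (m * x.1 + n * x.2.1 + θ) - (m' * x.1 + n' * x.2.1 + θ') := by push_cast; ring
  have h : (mode m n θ * mode m' n' θ').1 (cov x) =
    (mode m n θ).1 (cov x) * (mode m' n' θ').1 (cov x) := rfl
  have h' : ((1 / 2 : ℝ) • (mode (m + m') (n + n') (θ + θ') +
      mode (m - m') (n - n') (θ - θ'))).1 (cov x) =
    1 / 2 * ((mode (m + m') (n + n') (θ + θ')).1 (cov x) +
      (mode (m - m') (n - n') (θ - θ')).1 (cov x)) := rfl
  rw [h, h']
  simp only [mode_cov]
  rw [e1, e2, Real.cos_add (m * x.1 + n * x.2.1 + θ), Real.cos_sub (m * x.1 + n * x.2.1 + θ)]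
  ring

/-! ### Integration by parts for smooth functions -/

/-- Lebesgue measure on `(-1, 1)`. -/
abbrev volZ : Measure ℝ := volume.restrict (Set.Ioo (-1 : ℝ) 1)

theorem volOmega_eq :
    volOmega = (volume : Measure Torus).prod ((volume : Measure Torus).prod volZ) := by
  have h : Omega = (Set.univ : Set Torus) ×ˢ ((Set.univ : Set Torus) ×ˢ Set.Ioo (-1 : ℝ) 1) := by
    ext p; simp [Omega]
  rw [volOmega, h, Measure.volume_eq_prod, ← Measure.prod_restrict, Measure.volume_eq_prod,
    ← Measure.prod_restrict]
  simp

instance isFiniteMeasure_volOmega : IsFiniteMeasure volOmega := by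
  rw [volOmega_eq]; infer_instance

theorem measurableSet_Omega : MeasurableSet Omega :=
  measurableSet_Ioo.preimage (measurable_snd.comp measurable_snd)

theorem ae_mem_Omega : ∀ᵐ p ∂volOmega, p ∈ Omega := ae_restrict_mem measurableSet_Omega

/-- The closed slab `𝕋² × [-1, 1]`. -/
def closedOmega : Set Slab := Set.univ ×ˢ (Set.univ ×ˢ Set.Icc (-1 : ℝ) 1)

theorem isCompact_closedOmega : IsCompact closedOmega :=
  isCompact_univ.prod (isCompact_univ.prod isCompact_Icc)

theorem Omega_subset_closedOmega : Omega ⊆ closedOmega :=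
  fun _ hp => ⟨trivial, trivial, Set.Ioo_subset_Icc_self hp⟩

theorem Smooth.exists_bound (φ : Smooth) :
    ∃ C : ℝ, 0 ≤ C ∧ ∀ p ∈ closedOmega, |φ.1 p| ≤ C := by
  obtain ⟨C, hC⟩ := isCompact_closedOmega.exists_bound_of_continuousOn φ.continuous.continuousOn
  exact ⟨max C 0, le_max_right _ _, fun p hp => (hC p hp).trans (le_max_left _ _)⟩

theorem Smooth.ae_bound (φ : Smooth) : ∃ C : ℝ, 0 ≤ C ∧ ∀ᵐ p ∂volOmega, ‖φ.1 p‖ ≤ C := by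
  obtain ⟨C, h0, hC⟩ := φ.exists_bound
  exact ⟨C, h0, ae_mem_Omega.mono fun p hp => hC p (Omega_subset_closedOmega hp)⟩

theorem Smooth.memLp (φ : Smooth) (r : ENNReal) : MemLp φ.1 r volOmega := by
  obtain ⟨C, -, hC⟩ := φ.ae_bound
  exact MemLp.of_bound φ.continuous.aestronglyMeasurable C hC

theorem Smooth.integrable (φ : Smooth) : Integrable φ.1 volOmega :=
  memLp_one_iff_integrable.1 (φ.memLp 1)

/-- The integral over `Ω`. -/
def I : Smooth →ₗ[ℝ] ℝ where
  toFun φ := ∫ p, φ.1 p ∂volOmega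
  map_add' φ ψ := integral_add φ.integrable ψ.integrable
  map_smul' c φ := integral_const_mul c φ.1

theorem I_apply (φ : Smooth) : I φ = ∫ p, φ.1 p ∂volOmega := rfl

/-- The restriction of a smooth function to the torus at height `z`. -/
def slice (z : ℝ) (φ : Smooth) (y : Torus × Torus) : ℝ := φ.1 (y.1, y.2, z)

theorem continuous_slice (z : ℝ) (φ : Smooth) : Continuous (slice z φ) := by
  have := φ.continuous
  unfold slice
  fun_prop

theorem memLp_slice (z : ℝ) (φ : Smooth) (r : ENNReal) : MemLp (slice z φ) r volume :=
  (continuous_slice z φ).memLp_of_hasCompactSupport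
    (HasCompactSupport.of_compactSpace _)

theorem integrable_slice (z : ℝ) (φ : Smooth) : Integrable (slice z φ) volume :=
  memLp_one_iff_integrable.1 (memLp_slice z φ 1)

/-- The integral over the torus at height `z`; only `z = ±1`, the components of `Γ`, matter. -/
def B (z : ℝ) : Smooth →ₗ[ℝ] ℝ where
  toFun φ := ∫ y, slice z φ y
  map_add' φ ψ := integral_add (integrable_slice z φ) (integrable_slice z ψ)
  map_smul' c φ := integral_const_mul c (slice z φ)

theorem B_apply (z : ℝ) (φ : Smooth) : B z φ = ∫ y, slice z φ y := rfl

theorem B_nonneg {z : ℝ} {φ : Smooth} (h : ∀ p, 0 ≤ φ.1 p) : 0 ≤ B z φ :=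
  integral_nonneg fun _ => h _

theorem B_congr {z : ℝ} {φ ψ : Smooth} (h : slice z φ = slice z ψ) : B z φ = B z ψ := by
  rw [B_apply, B_apply, h]

/-- On the circle, the derivative of a `C¹` function has mean zero. -/
theorem integral_torus_eq_zero {f : Torus → ℝ} {f' : Torus → ℝ} (hf' : Continuous f')
    (h : ∀ x : ℝ, HasDerivAt (fun t : ℝ => f (t : Torus)) (f' (x : Torus)) x) :
    ∫ x, f' x = 0 := by
  rw [← AddCircle.intervalIntegral_preimage (2 * π) 0 f']
  rw [intervalIntegral.integral_eq_sub_of_hasDerivAt (fun x _ => h x)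
    ((hf'.comp (AddCircle.continuous_mk' _)).intervalIntegrable _ _)]
  simp only [zero_add]
  rw [AddCircle.coe_period]
  simp

theorem Smooth.hasDerivAt_x (φ : Smooth) (y : Torus) (z x : ℝ) :
    HasDerivAt (fun t : ℝ => φ.1 ((t : Torus), y, z)) ((D 0 φ).1 ((x : Torus), y, z)) x := by
  induction y using QuotientAddGroup.induction_on with
  | H y => simpa [cov, dir] using φ.isSmooth.hasDerivAt_pderiv 0 (0, y, z) x

theorem Smooth.hasDerivAt_y (φ : Smooth) (x : Torus) (z y : ℝ) :
    HasDerivAt (fun t : ℝ => φ.1 (x, (t : Torus), z)) ((D 1 φ).1 (x, (y : Torus), z)) y := by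
  induction x using QuotientAddGroup.induction_on with
  | H x => simpa [cov, dir] using φ.isSmooth.hasDerivAt_pderiv 1 (x, 0, z) y

theorem Smooth.hasDerivAt_z (φ : Smooth) (x y : Torus) (z : ℝ) :
    HasDerivAt (fun t : ℝ => φ.1 (x, y, t)) ((D 2 φ).1 (x, y, z)) z := by
  induction x using QuotientAddGroup.induction_on with
  | H x =>
    induction y using QuotientAddGroup.induction_on with
    | H y => simpa [cov, dir] using φ.isSmooth.hasDerivAt_pderiv 2 (x, y, 0) z

theorem I_D_zero (φ : Smooth) : I (D 0 φ) = 0 := by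
  have hi := (D 0 φ).integrable
  have hc := (D 0 φ).continuous
  rw [volOmega_eq] at hi
  rw [I_apply, volOmega_eq, integral_prod_symm _ hi]
  refine integral_eq_zero_of_ae (Filter.Eventually.of_forall fun w => ?_)
  exact integral_torus_eq_zero (f := fun x => φ.1 (x, w)) (by fun_prop)
    fun x => φ.hasDerivAt_x w.1 w.2 x

theorem I_D_one (φ : Smooth) : I (D 1 φ) = 0 := by
  have hi := (D 1 φ).integrable
  have hc := (D 1 φ).continuous
  rw [volOmega_eq] at hi
  rw [I_apply, volOmega_eq, integral_prod _ hi]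
  refine integral_eq_zero_of_ae ?_
  filter_upwards [hi.prod_right_ae] with x hx
  rw [integral_prod_symm _ hx]
  refine integral_eq_zero_of_ae (Filter.Eventually.of_forall fun w => ?_)
  exact integral_torus_eq_zero (f := fun y => φ.1 (x, y, w)) (by fun_prop)
    fun y => φ.hasDerivAt_y x w y

theorem I_D_two (φ : Smooth) : I (D 2 φ) = B 1 φ - B (-1) φ := by
  have hi := (D 2 φ).integrable
  have hc := (D 2 φ).continuous
  rw [volOmega_eq] at hi
  rw [I_apply, volOmega_eq, integral_prod _ hi]
  have h1 : ∀ x y : Torus, ∫ z, (D 2 φ).1 (x, y, z) ∂volZ = φ.1 (x, y, 1) - φ.1 (x, y, -1) := by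
    intro x y
    rw [← integral_Ioc_eq_integral_Ioo, ← intervalIntegral.integral_of_le (by norm_num)]
    exact intervalIntegral.integral_eq_sub_of_hasDerivAt (fun z _ => φ.hasDerivAt_z x y z)
      ((by fun_prop : Continuous fun z => (D 2 φ).1 (x, y, z)).intervalIntegrable _ _)
  have hs : Integrable (fun a => slice 1 φ a - slice (-1) φ a)
      ((volume : Measure Torus).prod (volume : Measure Torus)) :=
    (integrable_slice 1 φ).sub (integrable_slice (-1) φ)
  rw [B_apply, B_apply, ← integral_sub (integrable_slice _ _) (integrable_slice _ _),
    Measure.volume_eq_prod, integral_prod _ hs]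
  refine integral_congr_ae ?_
  filter_upwards [hi.prod_right_ae] with x hx
  rw [integral_prod _ hx]
  exact integral_congr_ae (Filter.Eventually.of_forall fun y => h1 x y)

theorem I_D_horizontal {i : Fin 3} (hi : i ≠ 2) (φ : Smooth) : I (D i φ) = 0 := by
  fin_cases i
  · exact I_D_zero φ
  · exact I_D_one φ
  · exact absurd rfl hi

theorem I_D_mul_horizontal {i : Fin 3} (hi : i ≠ 2) (φ ψ : Smooth) :
    I (D i φ * ψ) = -I (φ * D i ψ) := by
  have h := I_D_horizontal hi (φ * ψ)
  rw [D_mul, map_add] at h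
  linarith

theorem I_D_mul_two (φ ψ : Smooth) :
    I (D 2 φ * ψ) = B 1 (φ * ψ) - B (-1) (φ * ψ) - I (φ * D 2 ψ) := by
  have h := I_D_two (φ * ψ)
  rw [D_mul, map_add] at h
  linarith

/-- The coordinate function `z`. -/
def coordZ : Smooth := ofZ (fun z => z) contDiff_id

theorem D_two_coordZ : D 2 coordZ = 1 := by
  have h := D_two_ofZ (h := fun z => z) (h' := fun _ => 1) contDiff_id contDiff_const
    (fun z => hasDerivAt_id z)
  exact h

theorem slice_mul (z : ℝ) (φ ψ : Smooth) : slice z (φ * ψ) = slice z φ * slice z ψ := rfl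

theorem slice_add (z : ℝ) (φ ψ : Smooth) : slice z (φ + ψ) = slice z φ + slice z ψ := rfl

theorem slice_neg (z : ℝ) (φ : Smooth) : slice z (-φ) = -slice z φ := rfl

theorem slice_smul (z c : ℝ) (φ : Smooth) : slice z (c • φ) = c • slice z φ := rfl

theorem slice_zero (z : ℝ) : slice z 0 = 0 := rfl

/-- The sum of the two boundary integrals as an integral over `Ω`. -/
theorem B_add_B (φ : Smooth) : B 1 φ + B (-1) φ = I φ + I (coordZ * D 2 φ) := by
  have h := I_D_two (coordZ * φ)
  rw [D_mul, D_two_coordZ, map_add, one_mul] at h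
  have h1 : B 1 (coordZ * φ) = B 1 φ := B_congr (by
    funext y; simp [slice, coordZ])
  have h2 : B (-1) (coordZ * φ) = -B (-1) φ := by
    rw [← map_neg]
    exact B_congr (by funext y; simp [slice, coordZ])
  rw [h1, h2] at h
  linarith

/-- Integration by parts on the components of `Γ`. -/
theorem B_D_horizontal {i : Fin 3} (hi : i ≠ 2) (φ : Smooth) :
    B 1 (D i φ) = 0 ∧ B (-1) (D i φ) = 0 := by
  have h1 := I_D_two (D i φ)
  rw [D_comm, I_D_horizontal hi] at h1
  have h2 := B_add_B (D i φ)
  have h3 : coordZ * D 2 (D i φ) = D i (coordZ * D 2 φ) := by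
    rw [D_mul, D_comm]
    have : D i coordZ = 0 := D_ofZ hi contDiff_id
    simp [this]
  rw [h3, I_D_horizontal hi, I_D_horizontal hi] at h2
  constructor <;> linarith

/-! ### Smooth functions as elements of `L²` -/

/-- A smooth function as an element of `L²(Ω)`. -/
def toL2 : Smooth →ₗ[ℝ] L2 where
  toFun φ := (φ.memLp 2).toLp φ.1
  map_add' φ ψ := MemLp.toLp_add (φ.memLp 2) (ψ.memLp 2)
  map_smul' c φ := MemLp.toLp_const_smul c (φ.memLp 2)

theorem coeFn_toL2 (φ : Smooth) : toL2 φ =ᵐ[volOmega] φ.1 := (φ.memLp 2).coeFn_toLp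

theorem inner_toL2_right (f : L2) (φ : Smooth) :
    inner ℝ f (toL2 φ) = ∫ p, f p * φ.1 p ∂volOmega := by
  rw [L2.inner_def]
  refine integral_congr_ae ?_
  filter_upwards [coeFn_toL2 φ] with p hp
  rw [hp]; simp [mul_comm]

theorem inner_toL2 (φ ψ : Smooth) : inner ℝ (toL2 φ) (toL2 ψ) = I (φ * ψ) := by
  rw [inner_toL2_right]
  refine integral_congr_ae ?_
  filter_upwards [coeFn_toL2 φ] with p hp
  rw [hp]; rfl

theorem norm_toL2_sq (φ : Smooth) : ‖toL2 φ‖ ^ 2 = I (φ * φ) := by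
  rw [← inner_toL2, real_inner_self_eq_norm_sq]

theorem abs_I_mul_le (φ ψ : Smooth) : |I (φ * ψ)| ≤ ‖toL2 φ‖ * ‖toL2 ψ‖ := by
  rw [← inner_toL2]; exact abs_real_inner_le_norm _ _

/-- The restriction of a smooth function to the torus at height `z`, as an element of `L²`. -/
def toL2T (z : ℝ) : Smooth →ₗ[ℝ] L2T where
  toFun φ := (memLp_slice z φ 2).toLp (slice z φ)
  map_add' φ ψ := MemLp.toLp_add (memLp_slice z φ 2) (memLp_slice z ψ 2)
  map_smul' c φ := MemLp.toLp_const_smul c (memLp_slice z φ 2)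

theorem coeFn_toL2T (z : ℝ) (φ : Smooth) : toL2T z φ =ᵐ[volume] slice z φ :=
  (memLp_slice z φ 2).coeFn_toLp

theorem inner_toL2T_right (z : ℝ) (f : L2T) (φ : Smooth) :
    inner ℝ f (toL2T z φ) = ∫ y, f y * φ.1 (y.1, y.2, z) := by
  rw [L2.inner_def]
  refine integral_congr_ae ?_
  filter_upwards [coeFn_toL2T z φ] with p hp
  rw [hp]; simp [mul_comm, slice]

theorem inner_toL2T (z : ℝ) (φ ψ : Smooth) :
    inner ℝ (toL2T z φ) (toL2T z ψ) = B z (φ * ψ) := by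
  rw [inner_toL2T_right]
  refine integral_congr_ae ?_
  filter_upwards [coeFn_toL2T z φ] with p hp
  rw [hp]; rfl

theorem norm_toL2T_sq (z : ℝ) (φ : Smooth) : ‖toL2T z φ‖ ^ 2 = B z (φ * φ) := by
  rw [← inner_toL2T, real_inner_self_eq_norm_sq]

theorem norm_coordZ_mul_le (φ : Smooth) : ‖toL2 (coordZ * φ)‖ ≤ ‖toL2 φ‖ := by
  refine Lp.norm_le_norm_of_ae_le ?_
  filter_upwards [coeFn_toL2 (coordZ * φ), coeFn_toL2 φ, ae_mem_Omega] with p h1 h2 h3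
  rw [h1, h2]
  have h4 : |p.2.2| ≤ 1 := abs_le.2 ⟨h3.1.le, h3.2.le⟩
  calc ‖(coordZ * φ).1 p‖ = |p.2.2| * ‖φ.1 p‖ := by
        change ‖p.2.2 * φ.1 p‖ = _
        rw [norm_mul]; rfl
    _ ≤ 1 * ‖φ.1 p‖ := by gcongr
    _ = ‖φ.1 p‖ := one_mul _

theorem abs_I_coordZ_mul_mul_le (φ ψ : Smooth) :
    |I (coordZ * (φ * ψ))| ≤ ‖toL2 φ‖ * ‖toL2 ψ‖ := by
  rw [← mul_assoc]
  refine (abs_I_mul_le _ _).trans ?_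
  gcongr
  exact norm_coordZ_mul_le φ

/-- The squared `L²` norm of the boundary values, as integrals over `Ω`. -/
theorem B_sq_add_B_sq (φ : Smooth) :
    B 1 (φ * φ) + B (-1) (φ * φ) = ‖toL2 φ‖ ^ 2 + 2 * I (coordZ * (φ * D 2 φ)) := by
  rw [B_add_B, norm_toL2_sq, D_mul]
  have : coordZ * (D 2 φ * φ + φ * D 2 φ) = (2 : ℝ) • (coordZ * (φ * D 2 φ)) := by
    rw [two_smul]; ring
  rw [this, map_smul, smul_eq_mul]

/-- The trace inequality. -/
theorem B_sq_add_B_sq_le (φ : Smooth) :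
    B 1 (φ * φ) + B (-1) (φ * φ) ≤ 2 * ‖toL2 φ‖ ^ 2 + ‖toL2 (D 2 φ)‖ ^ 2 := by
  rw [B_sq_add_B_sq]
  have := (le_abs_self _).trans (abs_I_coordZ_mul_mul_le φ (D 2 φ))
  nlinarith [sq_nonneg (‖toL2 φ‖ - ‖toL2 (D 2 φ)‖)]

/-- A Poincaré inequality with boundary terms in place of a mean. -/
theorem norm_sq_le_B (φ : Smooth) :
    ‖toL2 φ‖ ^ 2 ≤ 2 * (B 1 (φ * φ) + B (-1) (φ * φ)) + 4 * ‖toL2 (D 2 φ)‖ ^ 2 := by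
  have h := B_sq_add_B_sq φ
  have := (neg_abs_le _).trans' (neg_le_neg (abs_I_coordZ_mul_mul_le φ (D 2 φ)))
  nlinarith [sq_nonneg (‖toL2 φ‖ - 2 * ‖toL2 (D 2 φ)‖)]

/-! ### The Poincaré inequality -/

/-- The total squared oscillation `∬ |F x - F x'|² dμ dμ`, which is twice the variance
up to normalisation. -/
def oscSq {X : Type*} [MeasurableSpace X] (μ : Measure X) (F : X → ℝ) : ENNReal :=
  ∫⁻ x, ∫⁻ x', ENNReal.ofReal ((F x - F x') ^ 2) ∂μ ∂μ

theorem oscSq_le_of_ae_le {X : Type*} [MeasurableSpace X] (μ : Measure X) {F : X → ℝ}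
    {c : ENNReal} (h : ∀ᵐ x ∂μ, ∀ᵐ x' ∂μ, ENNReal.ofReal ((F x - F x') ^ 2) ≤ c) :
    oscSq μ F ≤ c * μ Set.univ * μ Set.univ := by
  calc oscSq μ F ≤ ∫⁻ _, ∫⁻ _, c ∂μ ∂μ :=
        lintegral_mono_ae (h.mono fun x hx => lintegral_mono_ae hx)
    _ = c * μ Set.univ * μ Set.univ := by simp

/-- Squared oscillations tensorize. -/
theorem oscSq_prod_le {X Y : Type*} [MeasurableSpace X] [MeasurableSpace Y]
    (μ : Measure X) (ν : Measure Y) [IsFiniteMeasure μ] [IsFiniteMeasure ν]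
    {F : X × Y → ℝ} (hF : Measurable F) :
    oscSq (μ.prod ν) F ≤
      2 * ν Set.univ * ∫⁻ y, oscSq μ (fun x => F (x, y)) ∂ν +
      2 * μ Set.univ * ∫⁻ x, oscSq ν (fun y => F (x, y)) ∂μ := by
  have hpt : ∀ p p' : X × Y, ENNReal.ofReal ((F p - F p') ^ 2) ≤
      2 * ENNReal.ofReal ((F p - F (p'.1, p.2)) ^ 2) +
      2 * ENNReal.ofReal ((F (p'.1, p.2) - F p') ^ 2) := by
    intro p p'
    rw [← ENNReal.ofReal_ofNat 2, ← ENNReal.ofReal_mul (by norm_num),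
      ← ENNReal.ofReal_mul (by norm_num), ← ENNReal.ofReal_add (by positivity) (by positivity)]
    apply ENNReal.ofReal_le_ofReal
    nlinarith [sq_nonneg ((F p - F (p'.1, p.2)) - (F (p'.1, p.2) - F p'))]
  have m1 : Measurable fun z : (X × Y) × (X × Y) =>
      2 * ENNReal.ofReal ((F z.1 - F (z.2.1, z.1.2)) ^ 2) := by fun_prop
  have h1 : ∫⁻ p, ∫⁻ p', 2 * ENNReal.ofReal ((F p - F (p'.1, p.2)) ^ 2) ∂μ.prod ν ∂μ.prod ν =
      2 * ν Set.univ * ∫⁻ y, oscSq μ (fun x => F (x, y)) ∂ν := by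
    have e1 : ∀ p : X × Y, ∫⁻ p', 2 * ENNReal.ofReal ((F p - F (p'.1, p.2)) ^ 2) ∂μ.prod ν =
        (2 * ν Set.univ) * ∫⁻ x', ENNReal.ofReal ((F p - F (x', p.2)) ^ 2) ∂μ := by
      intro p
      rw [lintegral_prod _ (by fun_prop)]
      simp only [lintegral_const]
      rw [lintegral_mul_const _ (by fun_prop), lintegral_const_mul _ (by fun_prop)]
      ring
    simp only [e1]
    have hm : Measurable fun z : X × Y => ∫⁻ x', ENNReal.ofReal ((F z - F (x', z.2)) ^ 2) ∂μ :=
      Measurable.lintegral_prod_right' (f := fun w : (X × Y) × X =>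
        ENNReal.ofReal ((F w.1 - F (w.2, w.1.2)) ^ 2)) (by fun_prop)
    rw [lintegral_const_mul _ hm, lintegral_prod_symm _ hm.aemeasurable]
    rfl
  have h2 : ∫⁻ p, ∫⁻ p', 2 * ENNReal.ofReal ((F (p'.1, p.2) - F p') ^ 2) ∂μ.prod ν ∂μ.prod ν =
      2 * μ Set.univ * ∫⁻ x, oscSq ν (fun y => F (x, y)) ∂μ := by
    have hm : Measurable fun w : Y × X =>
        ∫⁻ y', 2 * ENNReal.ofReal ((F (w.2, w.1) - F (w.2, y')) ^ 2) ∂ν :=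
      Measurable.lintegral_prod_right' (f := fun w : (Y × X) × Y =>
        2 * ENNReal.ofReal ((F (w.1.2, w.1.1) - F (w.1.2, w.2)) ^ 2)) (by fun_prop)
    have e1 : ∀ p : X × Y, ∫⁻ p', 2 * ENNReal.ofReal ((F (p'.1, p.2) - F p') ^ 2) ∂μ.prod ν =
        ∫⁻ x', ∫⁻ y', 2 * ENNReal.ofReal ((F (x', p.2) - F (x', y')) ^ 2) ∂ν ∂μ := by
      intro p
      rw [lintegral_prod _ (by fun_prop)]
    simp only [e1]
    have hm2 : Measurable fun y : Y =>
        ∫⁻ x', ∫⁻ y', 2 * ENNReal.ofReal ((F (x', y) - F (x', y')) ^ 2) ∂ν ∂μ :=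
      hm.lintegral_prod_right'
    have hm3 : Measurable fun p : X × Y =>
        ∫⁻ x', ∫⁻ y', 2 * ENNReal.ofReal ((F (x', p.2) - F (x', y')) ^ 2) ∂ν ∂μ :=
      hm2.comp measurable_snd
    rw [lintegral_prod _ hm3.aemeasurable]
    simp only [lintegral_const]
    rw [lintegral_lintegral_swap hm.aemeasurable]
    have e2 : ∀ x : X, ∫⁻ y, ∫⁻ y', 2 * ENNReal.ofReal ((F (x, y) - F (x, y')) ^ 2) ∂ν ∂ν =
        2 * oscSq ν (fun y => F (x, y)) := by
      intro x
      rw [oscSq, ← lintegral_const_mul]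
      · refine lintegral_congr fun y => ?_
        rw [lintegral_const_mul _ (by fun_prop)]
      · exact Measurable.lintegral_prod_right' (f := fun w : Y × Y =>
          ENNReal.ofReal ((F (x, w.1) - F (x, w.2)) ^ 2)) (by fun_prop)
    simp only [e2]
    rw [lintegral_const_mul]
    · ring
    · exact Measurable.lintegral_prod_right' (f := fun w : X × Y =>
        ∫⁻ y', ENNReal.ofReal ((F (w.1, w.2) - F (w.1, y')) ^ 2) ∂ν)
          (Measurable.lintegral_prod_right' (f := fun w : (X × Y) × Y =>
          ENNReal.ofReal ((F (w.1.1, w.1.2) - F (w.1.1, w.2)) ^ 2)) (by fun_prop))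
  calc oscSq (μ.prod ν) F ≤ ∫⁻ p, ∫⁻ p', (2 * ENNReal.ofReal ((F p - F (p'.1, p.2)) ^ 2) +
        2 * ENNReal.ofReal ((F (p'.1, p.2) - F p') ^ 2)) ∂μ.prod ν ∂μ.prod ν :=
        lintegral_mono fun p => lintegral_mono fun p' => hpt p p'
    _ = _ := by
        rw [← h1, ← h2, ← lintegral_add_left]
        · refine lintegral_congr fun p => ?_
          rw [lintegral_add_left (by fun_prop)]
        · exact m1.lintegral_prod_right'

theorem sq_intervalIntegral_le {a b : ℝ} (hab : a ≤ b) {h : ℝ → ℝ} (hc : Continuous h) :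
    (∫ t in a..b, h t) ^ 2 ≤ (b - a) * ∫ t in a..b, h t ^ 2 := by
  rcases hab.eq_or_lt with rfl | hlt
  · simp
  set J := ∫ t in a..b, h t
  have hpos : 0 < b - a := sub_pos.2 hlt
  have h0 : 0 ≤ ∫ t in a..b, ((b - a) * h t - J) ^ 2 :=
    intervalIntegral.integral_nonneg hab fun t _ => sq_nonneg _
  have h1 : ∫ t in a..b, ((b - a) * h t - J) ^ 2 =
      (b - a) ^ 2 * (∫ t in a..b, h t ^ 2) - 2 * (b - a) * J * J + J ^ 2 * (b - a) := by
    have e : ∀ t, ((b - a) * h t - J) ^ 2 =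
        (b - a) ^ 2 * h t ^ 2 - 2 * (b - a) * J * h t + J ^ 2 := fun t => by ring
    simp only [e]
    rw [intervalIntegral.integral_add, intervalIntegral.integral_sub,
      intervalIntegral.integral_const_mul, intervalIntegral.integral_const_mul]
    · simp [J]; ring
    all_goals exact Continuous.intervalIntegrable (by fun_prop) _ _
  rw [h1] at h0
  have : 0 ≤ (b - a) * ((b - a) * (∫ t in a..b, h t ^ 2) - J ^ 2) := by nlinarith
  nlinarith [nonneg_of_mul_nonneg_right this hpos]

/-- The fundamental theorem of calculus with the Cauchy-Schwarz inequality. -/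
theorem sq_sub_le_of_hasDerivAt {a b : ℝ} {g g' : ℝ → ℝ} (hc : Continuous g')
    (hd : ∀ x, HasDerivAt g (g' x) x) {s t : ℝ} (hs : s ∈ Set.Icc a b) (ht : t ∈ Set.Icc a b) :
    (g s - g t) ^ 2 ≤ (b - a) * ∫ x in a..b, g' x ^ 2 := by
  wlog hst : t ≤ s generalizing s t
  · have := this ht hs (le_of_not_ge hst)
    nlinarith
  have hab : a ≤ b := hs.1.trans hs.2
  have hi : ∀ u v, IntervalIntegrable (fun x => g' x ^ 2) volume u v := fun u v =>
    Continuous.intervalIntegrable (by fun_prop) _ _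
  rw [← intervalIntegral.integral_eq_sub_of_hasDerivAt (fun x _ => hd x)
    (hc.intervalIntegrable t s)]
  have h1 := sq_intervalIntegral_le hst hc
  have h2 : ∫ x in t..s, g' x ^ 2 ≤ ∫ x in a..b, g' x ^ 2 :=
    intervalIntegral.integral_mono_interval ht.1 hst hs.2
      (Filter.Eventually.of_forall fun x => sq_nonneg _) (hi a b)
  have h3 : 0 ≤ ∫ x in t..s, g' x ^ 2 :=
    intervalIntegral.integral_nonneg hst fun x _ => sq_nonneg _
  have h4 : s - t ≤ b - a := by linarith [hs.2, ht.1]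
  calc _ ≤ _ := h1
    _ ≤ (b - a) * ∫ x in a..b, g' x ^ 2 := by
      apply mul_le_mul h4 h2 h3 (by linarith)

/-- The one-dimensional Poincaré inequality on `(-1, 1)`. -/
theorem oscSq_volZ_le {g g' : ℝ → ℝ} (hc : Continuous g') (hd : ∀ x, HasDerivAt g (g' x) x) :
    oscSq volZ g ≤ 8 * ∫⁻ z, ENNReal.ofReal (g' z ^ 2) ∂volZ := by
  have hint : Integrable (fun x => g' x ^ 2) volZ :=
    ((by fun_prop : Continuous fun x => g' x ^ 2).integrableOn_Icc (a := -1) (b := 1)).mono_set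
      Set.Ioo_subset_Icc_self
  have key : oscSq volZ g ≤ (2 * ∫⁻ z, ENNReal.ofReal (g' z ^ 2) ∂volZ) * volZ Set.univ *
      volZ Set.univ := by
    apply oscSq_le_of_ae_le
    filter_upwards [ae_restrict_mem measurableSet_Ioo] with s hs
    filter_upwards [ae_restrict_mem measurableSet_Ioo] with t ht
    rw [← ofReal_integral_eq_lintegral_ofReal hint
      (Filter.Eventually.of_forall fun x => sq_nonneg _), ← ENNReal.ofReal_ofNat 2,
      ← ENNReal.ofReal_mul (by norm_num)]
    apply ENNReal.ofReal_le_ofReal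
    have := sq_sub_le_of_hasDerivAt hc hd (Set.Ioo_subset_Icc_self hs)
      (Set.Ioo_subset_Icc_self ht)
    rw [intervalIntegral.integral_of_le (by norm_num), integral_Ioc_eq_integral_Ioo] at this
    linarith
  refine key.trans (le_of_eq ?_)
  have : volZ Set.univ = 2 := by simp [volZ]; norm_num
  rw [this]
  ring

/-- The one-dimensional Poincaré inequality on the circle. -/
theorem oscSq_torus_le {g g' : Torus → ℝ} (hc : Continuous g')
    (hd : ∀ x : ℝ, HasDerivAt (fun t : ℝ => g (t : Torus)) (g' (x : Torus)) x) :
    oscSq volume g ≤ ENNReal.ofReal (2 * π) ^ 3 * ∫⁻ x, ENNReal.ofReal (g' x ^ 2) := by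
  have hint : Integrable (fun x => g' x ^ 2) (volume : Measure Torus) :=
    (Continuous.memLp_of_hasCompactSupport (p := 1) (by fun_prop)
      (HasCompactSupport.of_compactSpace _)).integrable le_rfl
  have key : oscSq volume g ≤ (ENNReal.ofReal (2 * π) * ∫⁻ x, ENNReal.ofReal (g' x ^ 2)) *
      (volume : Measure Torus) Set.univ * (volume : Measure Torus) Set.univ := by
    apply oscSq_le_of_ae_le
    refine Filter.Eventually.of_forall fun s => Filter.Eventually.of_forall fun t => ?_
    rw [← ofReal_integral_eq_lintegral_ofReal hint
      (Filter.Eventually.of_forall fun x => sq_nonneg _),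
      ← ENNReal.ofReal_mul (by positivity)]
    apply ENNReal.ofReal_le_ofReal
    obtain ⟨s', hs', rfl⟩ := AddCircle.eq_coe_Ico s
    obtain ⟨t', ht', rfl⟩ := AddCircle.eq_coe_Ico t
    have := sq_sub_le_of_hasDerivAt (g' := fun x : ℝ => g' (x : Torus))
      (hc.comp (AddCircle.continuous_mk' _)) hd (Set.Ico_subset_Icc_self hs')
      (Set.Ico_subset_Icc_self ht')
    have e := AddCircle.intervalIntegral_preimage (2 * π) 0 fun x => g' x ^ 2
    simp only [zero_add] at e
    rw [e] at this
    simpa using this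
  refine key.trans (le_of_eq ?_)
  rw [AddCircle.measure_univ]
  ring

/-- The Poincaré inequality for oscillations, one coordinate at a time. -/
theorem exists_oscSq_le : ∃ C : ENNReal, C ≠ ⊤ ∧ ∀ φ : Smooth,
    oscSq volOmega φ.1 ≤ C * ∑ i, ∫⁻ p, ENNReal.ofReal ((D i φ).1 p ^ 2) ∂volOmega := by
  set τ : Measure Torus := volume
  set P : ENNReal := ENNReal.ofReal (2 * π) ^ 3
  have hP : P ≠ ⊤ := ENNReal.pow_ne_top ENNReal.ofReal_ne_top
  have hT : ∀ i : Fin 3, ∀ φ : Smooth, Measurable fun p => ENNReal.ofReal ((D i φ).1 p ^ 2) := by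
    intro i φ
    have := (D i φ).continuous.measurable
    fun_prop
  set a1 := 2 * (τ.prod volZ) Set.univ
  set a2 := 2 * τ Set.univ
  set a3 := 2 * volZ Set.univ
  have ha1 : a1 ≠ ⊤ := ENNReal.mul_ne_top (by simp) (measure_ne_top _ _)
  have ha2 : a2 ≠ ⊤ := ENNReal.mul_ne_top (by simp) (measure_ne_top _ _)
  have ha3 : a3 ≠ ⊤ := ENNReal.mul_ne_top (by simp) (measure_ne_top _ _)
  refine ⟨a1 * P + a2 * a3 * P + a2 * a2 * 8, by finiteness, fun φ => ?_⟩
  have hc := φ.continuous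
  have hc' : ∀ i, Continuous (D i φ).1 := fun i => (D i φ).continuous
  have h1 : ∫⁻ w, oscSq τ (fun x => φ.1 (x, w)) ∂τ.prod volZ ≤
      P * ∫⁻ p, ENNReal.ofReal ((D 0 φ).1 p ^ 2) ∂volOmega := by
    rw [volOmega_eq, lintegral_prod_symm _ (hT 0 φ).aemeasurable, ← lintegral_const_mul]
    · refine lintegral_mono fun w => oscSq_torus_le (by have := hc' 0; fun_prop)
        fun x => φ.hasDerivAt_x w.1 w.2 x
    · exact (hT 0 φ).lintegral_prod_left'
  have h2 : ∀ x, oscSq (τ.prod volZ) (fun w => φ.1 (x, w)) ≤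
      a3 * (P * ∫⁻ y, ∫⁻ z, ENNReal.ofReal ((D 1 φ).1 (x, y, z) ^ 2) ∂volZ ∂τ) +
      a2 * (8 * ∫⁻ y, ∫⁻ z, ENNReal.ofReal ((D 2 φ).1 (x, y, z) ^ 2) ∂volZ ∂τ) := by
    intro x
    have hm : ∀ i, Measurable fun w : Torus × ℝ => ENNReal.ofReal ((D i φ).1 (x, w.1, w.2) ^ 2) :=
      fun i => (hT i φ).comp (g := fun p => ENNReal.ofReal ((D i φ).1 p ^ 2)) (by fun_prop)
    refine (oscSq_prod_le τ volZ (F := fun w => φ.1 (x, w))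
      (by fun_prop : Continuous fun w => φ.1 (x, w)).measurable).trans ?_
    gcongr
    · rw [lintegral_lintegral_swap (hm 1).aemeasurable, ← lintegral_const_mul]
      · refine lintegral_mono fun z => oscSq_torus_le (by have := hc' 1; fun_prop)
          fun y => φ.hasDerivAt_y x z y
      · exact (hm 1).lintegral_prod_left'
    · rw [← lintegral_const_mul]
      · refine lintegral_mono fun y => oscSq_volZ_le (by have := hc' 2; fun_prop)
          fun z => φ.hasDerivAt_z x y z
      · exact (hm 2).lintegral_prod_right'
  have hf : ∀ i, ∫⁻ x, ∫⁻ y, ∫⁻ z, ENNReal.ofReal ((D i φ).1 (x, y, z) ^ 2) ∂volZ ∂τ ∂τ =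
      ∫⁻ p, ENNReal.ofReal ((D i φ).1 p ^ 2) ∂volOmega := by
    intro i
    rw [volOmega_eq, lintegral_prod _ (hT i φ).aemeasurable]
    refine lintegral_congr fun x => ?_
    rw [lintegral_prod]
    exact ((hT i φ).comp (by fun_prop : Measurable fun w : Torus × ℝ => (x, w))).aemeasurable
  have h3 : ∫⁻ x, oscSq (τ.prod volZ) (fun w => φ.1 (x, w)) ∂τ ≤
      a3 * (P * ∫⁻ p, ENNReal.ofReal ((D 1 φ).1 p ^ 2) ∂volOmega) +
      a2 * (8 * ∫⁻ p, ENNReal.ofReal ((D 2 φ).1 p ^ 2) ∂volOmega) := by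
    refine (lintegral_mono h2).trans (le_of_eq ?_)
    have hm : ∀ i, Measurable fun x =>
        ∫⁻ y, ∫⁻ z, ENNReal.ofReal ((D i φ).1 (x, y, z) ^ 2) ∂volZ ∂τ := by
      intro i
      refine Measurable.lintegral_prod_right' (f := fun w : Torus × Torus =>
        ∫⁻ z, ENNReal.ofReal ((D i φ).1 (w.1, w.2, z) ^ 2) ∂volZ) ?_
      exact Measurable.lintegral_prod_right' (f := fun w : (Torus × Torus) × ℝ =>
        ENNReal.ofReal ((D i φ).1 (w.1.1, w.1.2, w.2) ^ 2))
        ((hT i φ).comp (by fun_prop : Measurable fun w : (Torus × Torus) × ℝ =>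
          ((w.1.1, w.1.2, w.2) : Slab)))
    rw [lintegral_add_left (((hm 1).const_mul _).const_mul _),
      lintegral_const_mul _ ((hm 1).const_mul _), lintegral_const_mul _ (hm 1),
      lintegral_const_mul _ ((hm 2).const_mul _), lintegral_const_mul _ (hm 2), hf, hf]
  have h4 := oscSq_prod_le τ (τ.prod volZ) (F := φ.1) hc.measurable
  rw [← volOmega_eq] at h4
  refine h4.trans ?_
  rw [Fin.sum_univ_three]
  set A0 := ∫⁻ p, ENNReal.ofReal ((D 0 φ).1 p ^ 2) ∂volOmega
  set A1 := ∫⁻ p, ENNReal.ofReal ((D 1 φ).1 p ^ 2) ∂volOmega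
  set A2 := ∫⁻ p, ENNReal.ofReal ((D 2 φ).1 p ^ 2) ∂volOmega
  calc _ ≤ a1 * (P * A0) + a2 * (a3 * (P * A1) + a2 * (8 * A2)) := by gcongr
    _ = (a1 * P) * A0 + (a2 * a3 * P) * A1 + (a2 * a2 * 8) * A2 := by ring
    _ ≤ (a1 * P + a2 * a3 * P + a2 * a2 * 8) * A0 + (a1 * P + a2 * a3 * P + a2 * a2 * 8) * A1 +
        (a1 * P + a2 * a3 * P + a2 * a2 * 8) * A2 := by
      gcongr
      · rw [add_assoc]; exact le_self_add
      · rw [add_comm (a1 * P), add_assoc]; exact le_self_add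
      · exact le_add_self
    _ = _ := by ring

theorem volOmega_univ_pos : 0 < volOmega.real Set.univ := by
  rw [volOmega_eq, Measure.real, ← Set.univ_prod_univ, Measure.prod_prod, ← Set.univ_prod_univ,
    Measure.prod_prod, AddCircle.measure_univ]
  have : volZ Set.univ = 2 := by simp [volZ]; norm_num
  rw [this]
  simp only [ENNReal.toReal_mul]
  have := Real.pi_pos
  rw [ENNReal.toReal_ofReal (by positivity)]
  norm_num
  positivity

/-- The Poincaré inequality for smooth functions with mean zero on `Ω`. -/
theorem exists_poincare : ∃ C : ℝ, 0 < C ∧ ∀ φ : Smooth, I φ = 0 →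
    ‖toL2 φ‖ ^ 2 ≤ C * ∑ i, ‖toL2 (D i φ)‖ ^ 2 := by
  obtain ⟨C, hC, h⟩ := exists_oscSq_le
  set m := volOmega.real Set.univ
  have hm : 0 < m := volOmega_univ_pos
  refine ⟨C.toReal / m + 1, by positivity, fun φ hφ => ?_⟩
  have hsq : ∀ ψ : Smooth, Integrable (fun p => ψ.1 p ^ 2) volOmega := fun ψ =>
    (ψ.memLp 2).integrable_sq
  have hn : ∀ ψ : Smooth, ‖toL2 ψ‖ ^ 2 = ∫ p, ψ.1 p ^ 2 ∂volOmega := by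
    intro ψ
    rw [norm_toL2_sq, I_apply]
    refine integral_congr_ae (Filter.Eventually.of_forall fun p => ?_)
    change ψ.1 p * ψ.1 p = _
    ring
  have e1 : ∀ p, ∫⁻ p', ENNReal.ofReal ((φ.1 p - φ.1 p') ^ 2) ∂volOmega =
      ENNReal.ofReal (m * φ.1 p ^ 2 + ‖toL2 φ‖ ^ 2) := by
    intro p
    have e : ∀ p', (φ.1 p - φ.1 p') ^ 2 = φ.1 p ^ 2 - 2 * φ.1 p * φ.1 p' + φ.1 p' ^ 2 :=
      fun p' => by ring
    have i1 : Integrable (fun p' => φ.1 p ^ 2 - 2 * φ.1 p * φ.1 p') volOmega :=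
      (integrable_const _).sub (φ.integrable.const_mul _)
    rw [← ofReal_integral_eq_lintegral_ofReal]
    · congr 1
      simp only [e]
      rw [integral_add i1 (hsq φ), integral_sub (integrable_const _) (φ.integrable.const_mul _),
        integral_const_mul, ← I_apply, hφ, hn]
      simp [m]
    · simp only [e]
      exact i1.add (hsq φ)
    · exact Filter.Eventually.of_forall fun _ => sq_nonneg _
  have e2 : oscSq volOmega φ.1 = ENNReal.ofReal (2 * m * ‖toL2 φ‖ ^ 2) := by
    rw [oscSq]
    simp only [e1]
    rw [← ofReal_integral_eq_lintegral_ofReal]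
    · congr 1
      rw [integral_add ((hsq φ).const_mul _) (integrable_const _), integral_const_mul, ← hn]
      simp only [integral_const, smul_eq_mul]
      change m * _ + m * _ = _
      ring
    · exact ((hsq φ).const_mul _).add (integrable_const _)
    · exact Filter.Eventually.of_forall fun _ => by positivity
  have e3 : ∀ i, ∫⁻ p, ENNReal.ofReal ((D i φ).1 p ^ 2) ∂volOmega =
      ENNReal.ofReal (‖toL2 (D i φ)‖ ^ 2) := by
    intro i
    rw [hn, ofReal_integral_eq_lintegral_ofReal (hsq _)
      (Filter.Eventually.of_forall fun _ => sq_nonneg _)]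
  have h' := h φ
  simp only [e2, e3] at h'
  rw [← ENNReal.ofReal_sum_of_nonneg (fun _ _ => sq_nonneg _), ← ENNReal.ofReal_toReal hC,
    ← ENNReal.ofReal_mul ENNReal.toReal_nonneg,
    ENNReal.ofReal_le_ofReal_iff (by positivity)] at h'
  set G := ∑ i, ‖toL2 (D i φ)‖ ^ 2
  have hG : 0 ≤ G := Finset.sum_nonneg fun _ _ => sq_nonneg _
  have h5 : m * ‖toL2 φ‖ ^ 2 ≤ C.toReal * G := by nlinarith [sq_nonneg ‖toL2 φ‖]
  calc ‖toL2 φ‖ ^ 2 ≤ C.toReal * G / m := by rw [le_div_iff₀ hm]; linarith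
    _ = C.toReal / m * G := by ring
    _ ≤ (C.toReal / m + 1) * G := by nlinarith

/-! ### Density of trigonometric polynomials with polynomial coefficients -/

/-- A polynomial in the vertical variable. -/
def polyZ (P : Polynomial ℝ) : Smooth :=
  ofZ (fun z => P.eval z) (by simpa using P.contDiff_aeval (𝕜 := ℝ) ∞)

@[simp] theorem polyZ_apply (P : Polynomial ℝ) (p : Slab) : (polyZ P).1 p = P.eval p.2.2 := rfl

theorem D_two_polyZ (P : Polynomial ℝ) : D 2 (polyZ P) = polyZ P.derivative :=
  D_two_ofZ _ _ fun z => P.hasDerivAt z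

theorem polyZ_mul (P Q : Polynomial ℝ) : polyZ P * polyZ Q = polyZ (P * Q) := by
  apply Subtype.ext
  funext p
  change P.eval p.2.2 * Q.eval p.2.2 = (P * Q).eval p.2.2
  simp

theorem polyZ_one : polyZ 1 = 1 := by
  apply Subtype.ext
  funext p
  change (1 : Polynomial ℝ).eval p.2.2 = 1
  simp

theorem mode_zero : mode 0 0 0 = 1 := by
  apply Smooth.ext_cov
  intro x
  rw [mode_cov]
  change _ = (1 : ℝ)
  simp

/-- The linear span of the functions `cos (m x + n y + θ) P(z)`. -/
def modeSpan : Submodule ℝ Smooth :=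
  Submodule.span ℝ {φ | ∃ (m n : ℤ) (θ : ℝ) (P : Polynomial ℝ), φ = mode m n θ * polyZ P}

theorem mode_mul_polyZ_mem (m n : ℤ) (θ : ℝ) (P : Polynomial ℝ) :
    mode m n θ * polyZ P ∈ modeSpan := Submodule.subset_span ⟨m, n, θ, P, rfl⟩

theorem one_mem_modeSpan : (1 : Smooth) ∈ modeSpan := by
  have := mode_mul_polyZ_mem 0 0 0 1
  rwa [mode_zero, polyZ_one, one_mul] at this

theorem mul_mem_modeSpan (φ ψ : Smooth) (hφ : φ ∈ modeSpan) (hψ : ψ ∈ modeSpan) :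
    φ * ψ ∈ modeSpan := by
  refine Submodule.span_induction₂ (p := fun φ ψ _ _ => φ * ψ ∈ modeSpan) ?_ ?_ ?_ ?_ ?_ ?_ ?_
    hφ hψ
  · rintro _ _ ⟨m, n, θ, P, rfl⟩ ⟨m', n', θ', P', rfl⟩
    rw [mul_mul_mul_comm, polyZ_mul, mode_mul, smul_mul_assoc, add_mul]
    exact Submodule.smul_mem _ _
      (Submodule.add_mem _ (mode_mul_polyZ_mem _ _ _ _) (mode_mul_polyZ_mem _ _ _ _))
  · intro y _; rw [zero_mul]; exact Submodule.zero_mem _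
  · intro y _; rw [mul_zero]; exact Submodule.zero_mem _
  · intro x y z _ _ _ h1 h2; rw [add_mul]; exact Submodule.add_mem _ h1 h2
  · intro x y z _ _ _ h1 h2; rw [mul_add]; exact Submodule.add_mem _ h1 h2
  · intro r x y _ _ h; rw [smul_mul_assoc]; exact Submodule.smul_mem _ _ h
  · intro r x y _ _ h; rw [mul_smul_comm]; exact Submodule.smul_mem _ _ h

/-- Smooth functions as continuous functions. -/
def toContinuousMap : Smooth →ₐ[ℝ] C(Slab, ℝ) where
  toFun φ := ⟨φ.1, φ.continuous⟩
  map_one' := rfl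
  map_mul' _ _ := rfl
  map_zero' := rfl
  map_add' _ _ := rfl
  commutes' _ := rfl

/-- `modeSpan` as an algebra of continuous functions. -/
def modeAlgebra : Subalgebra ℝ C(Slab, ℝ) :=
  (modeSpan.toSubalgebra one_mem_modeSpan mul_mem_modeSpan).map toContinuousMap

theorem fourier_one_injective : Function.Injective (fun x : Torus => fourier 1 x) := by
  intro x y h
  have h' : AddCircle.toCircle x = AddCircle.toCircle y := by
    apply Subtype.ext
    simpa [fourier_apply] using h
  exact AddCircle.injective_toCircle (by positivity) h'

theorem modeFn_ne_of_fourier_ne {w w' : ℂ} (h : w ≠ w') :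
    ∃ θ : ℝ, (Complex.exp (θ * Complex.I) * w).re ≠ (Complex.exp (θ * Complex.I) * w').re := by
  by_contra! hc
  apply h
  apply Complex.ext
  · simpa using hc 0
  · have h1 := hc (-(π / 2))
    have h2 : Complex.exp (((-(π / 2) : ℝ) : ℂ) * Complex.I) = -Complex.I := by
      push_cast
      rw [neg_mul, Complex.exp_neg, Complex.exp_pi_div_two_mul_I, Complex.inv_I]
    rw [h2] at h1
    simpa using h1

theorem modeAlgebra_separatesPoints : modeAlgebra.SeparatesPoints := by
  intro p p' hp
  have key : ∀ φ ∈ modeSpan, φ.1 p ≠ φ.1 p' →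
      ∃ f ∈ (fun f : C(Slab, ℝ) => (f : Slab → ℝ)) '' (modeAlgebra : Set C(Slab, ℝ)),
        f p ≠ f p' := by
    intro φ hφ h
    exact ⟨φ.1, ⟨toContinuousMap φ, ⟨φ, hφ, rfl⟩, rfl⟩, h⟩
  have hmode : ∀ m n θ, mode m n θ ∈ modeSpan := by
    intro m n θ
    have := mode_mul_polyZ_mem m n θ 1
    rwa [polyZ_one, mul_one] at this
  by_cases h1 : p.1 = p'.1
  · by_cases h2 : p.2.1 = p'.2.1
    · have h3 : p.2.2 ≠ p'.2.2 := fun h3 => hp (Prod.ext h1 (Prod.ext h2 h3))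
      refine key (polyZ Polynomial.X) ?_ (by simpa using h3)
      have := mode_mul_polyZ_mem 0 0 0 Polynomial.X
      rwa [mode_zero, one_mul] at this
    · obtain ⟨θ, hθ⟩ := modeFn_ne_of_fourier_ne (fun h => h2 (fourier_one_injective h))
      refine key (mode 0 1 θ) (hmode _ _ _) ?_
      simpa [mode, modeFn] using hθ
  · obtain ⟨θ, hθ⟩ := modeFn_ne_of_fourier_ne (fun h => h1 (fourier_one_injective h))
    refine key (mode 1 0 θ) (hmode _ _ _) ?_
    simpa [mode, modeFn] using hθ

/-- Density by the Stone-Weierstrass theorem on `𝕋² × [-1, 1]`. -/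
theorem exists_modeSpan_near (g : L2) {ε : ℝ} (hε : 0 < ε) :
    ∃ φ ∈ modeSpan, ‖g - toL2 φ‖ ≤ ε := by
  obtain ⟨b, hb, hbm⟩ := (Lp.memLp g).exists_boundedContinuous_eLpNorm_sub_le
    (ε := ENNReal.ofReal (ε / 2)) (by norm_num) (by simpa using hε)
  set c : ℝ := measureUnivNNReal volOmega ^ (2 : ENNReal).toReal⁻¹
  have hc : 0 ≤ c := by positivity
  obtain ⟨_, ⟨φ, hφ, rfl⟩, h⟩ :=
    ContinuousMap.exists_mem_subalgebra_near_continuous_of_isCompact_of_separatesPoints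
      modeAlgebra_separatesPoints b.toContinuousMap isCompact_closedOmega
      (ε := ε / 2 / (c + 1)) (by positivity)
  refine ⟨φ, hφ, ?_⟩
  have h1 : ‖g - hbm.toLp b‖ ≤ ε / 2 := by
    have e : g - hbm.toLp b = ((Lp.memLp g).sub hbm).toLp _ := by
      rw [MemLp.toLp_sub (Lp.memLp g) hbm, Lp.toLp_coeFn]
    rw [e, Lp.norm_toLp]
    exact ENNReal.toReal_le_of_le_ofReal (by positivity) hb
  have h2 : ‖hbm.toLp b - toL2 φ‖ ≤ c * (ε / 2 / (c + 1)) := by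
    refine Lp.norm_le_of_ae_bound (by positivity) ?_
    filter_upwards [Lp.coeFn_sub (hbm.toLp b) (toL2 φ), hbm.coeFn_toLp, coeFn_toL2 φ,
      ae_mem_Omega] with p e1 e2 e3 hp
    rw [e1, Pi.sub_apply, e2, e3, norm_sub_rev]
    exact (h p (Omega_subset_closedOmega hp)).le
  have h3 : c * (ε / 2 / (c + 1)) ≤ ε / 2 := by
    rw [mul_div_assoc', div_le_iff₀ (by positivity)]
    nlinarith
  calc ‖g - toL2 φ‖ = ‖(g - hbm.toLp b) + (hbm.toLp b - toL2 φ)‖ := by rw [sub_add_sub_cancel]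
    _ ≤ _ := norm_add_le _ _
    _ ≤ ε := by linarith

/-- The functions `cos (m x + n y + θ) P(z)` are total in `L²(Ω)`. -/
theorem eq_zero_of_inner_mode_eq_zero {g : L2}
    (h : ∀ (m n : ℤ) (θ : ℝ) (P : Polynomial ℝ), inner ℝ g (toL2 (mode m n θ * polyZ P)) = 0) :
    g = 0 := by
  have h' : ∀ φ ∈ modeSpan, inner ℝ g (toL2 φ) = 0 := by
    intro φ hφ
    induction hφ using Submodule.span_induction with
    | mem x hx => obtain ⟨m, n, θ, P, rfl⟩ := hx; exact h m n θ P
    | zero => simp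
    | add x y _ _ hx hy => rw [map_add, inner_add_right, hx, hy, add_zero]
    | smul a x _ hx => rw [map_smul, inner_smul_right, hx, mul_zero]
  rw [← norm_le_zero_iff]
  refine le_of_forall_pos_le_add fun ε hε => ?_
  obtain ⟨φ, hφ, hn⟩ := exists_modeSpan_near g hε
  have h1 : ‖g‖ * ‖g‖ ≤ ‖g‖ * ε := by
    calc ‖g‖ * ‖g‖ = inner ℝ g (g - toL2 φ) := by
          rw [inner_sub_right, h' φ hφ, sub_zero, real_inner_self_eq_norm_mul_norm]
      _ ≤ ‖g‖ * ‖g - toL2 φ‖ := real_inner_le_norm _ _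
      _ ≤ ‖g‖ * ε := by gcongr
  by_contra! hc
  have : 0 < ‖g‖ := by linarith
  nlinarith

/-! ### Cutoff functions, uniqueness of weak derivatives and Green's formulas -/

theorem contDiff_cutoff (n : ℕ) :
    ContDiff ℝ ∞ fun z : ℝ => smoothTransition (n * (1 - z ^ 2) - 1) :=
  (Real.smoothTransition.contDiff (n := ⊤)).comp (by fun_prop)

/-- A cutoff function in `z`, supported in `{1 ≤ n (1 - z²)}` and equal to `1` on
`{2 ≤ n (1 - z²)}`. -/
def cutoff (n : ℕ) : Smooth :=
  ofZ (fun z => smoothTransition (n * (1 - z ^ 2) - 1)) (contDiff_cutoff n)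

theorem contDiff_deriv_smoothTransition : ContDiff ℝ ∞ (deriv smoothTransition) := by
  have h : ContDiff ℝ ∞ smoothTransition := Real.smoothTransition.contDiff (n := ⊤)
  exact (contDiff_infty_iff_deriv.1 h).2

theorem D_two_cutoff_apply (n : ℕ) (p : Slab) :
    (D 2 (cutoff n)).1 p =
      deriv smoothTransition (n * (1 - p.2.2 ^ 2) - 1) * (n * (-(2 * p.2.2))) := by
  have hd : ∀ z : ℝ, HasDerivAt (fun z : ℝ => smoothTransition (n * (1 - z ^ 2) - 1))
      (deriv smoothTransition (n * (1 - z ^ 2) - 1) * (n * (-(2 * z)))) z := by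
    intro z
    have h1 : HasDerivAt (fun z : ℝ => n * (1 - z ^ 2) - 1) (n * (-(2 * z))) z := by
      simpa using (((hasDerivAt_pow 2 z).const_sub 1).const_mul (n : ℝ)).sub_const 1
    have h2 : HasDerivAt smoothTransition (deriv smoothTransition (n * (1 - z ^ 2) - 1))
        (n * (1 - z ^ 2) - 1) :=
      ((Real.smoothTransition.contDiff (n := 1)).differentiable (by simp) _).hasDerivAt
    exact h2.comp z h1
  have hs : ContDiff ℝ ∞ fun z : ℝ =>
      deriv smoothTransition (n * (1 - z ^ 2) - 1) * (n * (-(2 * z))) :=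
    (contDiff_deriv_smoothTransition.comp (by fun_prop)).mul (by fun_prop)
  rw [cutoff, D_two_ofZ (contDiff_cutoff n) hs hd]
  rfl

theorem deriv_smoothTransition_eq_zero {t : ℝ} (ht : t ∉ Set.Icc (0 : ℝ) 1) :
    deriv smoothTransition t = 0 := by
  rw [Set.mem_Icc, not_and_or, not_le, not_le] at ht
  rcases ht with ht | ht
  · have : smoothTransition =ᶠ[nhds t] fun _ => 0 := by
      filter_upwards [Iio_mem_nhds ht] with s hs
      exact smoothTransition.zero_of_nonpos (le_of_lt hs)
    rw [this.deriv_eq, deriv_const]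
  · have : smoothTransition =ᶠ[nhds t] fun _ => 1 := by
      filter_upwards [Ioi_mem_nhds ht] with s hs
      exact smoothTransition.one_of_one_le (le_of_lt hs)
    rw [this.deriv_eq, deriv_const]

theorem exists_deriv_smoothTransition_le :
    ∃ M : ℝ, 0 ≤ M ∧ ∀ t, |deriv smoothTransition t| ≤ M := by
  obtain ⟨M, hM⟩ := isCompact_Icc.exists_bound_of_continuousOn (s := Set.Icc (0 : ℝ) 1)
    contDiff_deriv_smoothTransition.continuous.continuousOn
  refine ⟨max M 0, le_max_right _ _, fun t => ?_⟩
  by_cases ht : t ∈ Set.Icc (0 : ℝ) 1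
  · exact (hM t ht).trans (le_max_left _ _)
  · rw [deriv_smoothTransition_eq_zero ht, abs_zero]; exact le_max_right _ _

theorem isTest_mul_cutoff (φ : Smooth) (n : ℕ) : IsTest (φ * cutoff n).1 := by
  set K : Set Slab := {p | (1 : ℝ) ≤ n * (1 - p.2.2 ^ 2)}
  have hK : IsClosed K := isClosed_le continuous_const (by fun_prop)
  have hKO : K ⊆ Omega := by
    intro p hp
    have hp' : (1 : ℝ) ≤ n * (1 - p.2.2 ^ 2) := hp
    have hn : (0 : ℝ) ≤ n := n.cast_nonneg
    have : 0 < 1 - p.2.2 ^ 2 := by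
      by_contra! hc
      nlinarith
    exact ⟨by nlinarith, by nlinarith⟩
  have hKc : IsCompact K := isCompact_closedOmega.of_isClosed_subset hK
    (hKO.trans Omega_subset_closedOmega)
  have hs : Function.support (φ * cutoff n).1 ⊆ K := by
    intro p hp
    by_contra hc
    have hc' : n * (1 - p.2.2 ^ 2) < (1 : ℝ) := not_le.1 hc
    apply hp
    change φ.1 p * smoothTransition (n * (1 - p.2.2 ^ 2) - 1) = 0
    rw [smoothTransition.zero_of_nonpos (by linarith), mul_zero]
  have ht : tsupport (φ * cutoff n).1 ⊆ K := closure_minimal hs hK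
  exact ⟨(φ * cutoff n).2, hKc.of_isClosed_subset (isClosed_tsupport _) ht, ht.trans hKO⟩

theorem cutoff_argument_tendsto {z : ℝ} (hz : z ∈ Set.Ioo (-1 : ℝ) 1) :
    ∀ᶠ n : ℕ in Filter.atTop, (1 : ℝ) < n * (1 - z ^ 2) - 1 := by
  have h : 0 < 1 - z ^ 2 := by nlinarith [hz.1, hz.2]
  have h1 := (tendsto_natCast_atTop_atTop (R := ℝ)).atTop_mul_const h
  filter_upwards [h1.eventually_gt_atTop 2] with n hn
  linarith

theorem integrable_mul (f : L2) (φ : Smooth) : Integrable (fun p => f p * φ.1 p) volOmega :=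
  (Lp.memLp f).integrable_mul (φ.memLp 2)

theorem tendsto_inner_mul_cutoff (f : L2) (φ : Smooth) :
    Filter.Tendsto (fun n => inner ℝ f (toL2 (φ * cutoff n))) Filter.atTop
      (nhds (inner ℝ f (toL2 φ))) := by
  simp only [inner_toL2_right]
  refine tendsto_integral_of_dominated_convergence (fun p => ‖f p * φ.1 p‖)
    (fun n => (integrable_mul f _).aestronglyMeasurable) (integrable_mul f φ).norm ?_ ?_
  · refine fun n => Filter.Eventually.of_forall fun p => ?_
    change ‖f p * (φ.1 p * smoothTransition _)‖ ≤ _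
    rw [← mul_assoc, norm_mul _ (smoothTransition _),
      Real.norm_of_nonneg (smoothTransition.nonneg _)]
    exact mul_le_of_le_one_right (norm_nonneg _) (smoothTransition.le_one _)
  · filter_upwards [ae_mem_Omega] with p hp
    refine tendsto_const_nhds.congr' ?_
    filter_upwards [cutoff_argument_tendsto hp] with n hn
    change f p * φ.1 p = f p * (φ.1 p * smoothTransition (n * (1 - p.2.2 ^ 2) - 1))
    rw [smoothTransition.one_of_one_le hn.le, mul_one]

/-- `φ` vanishes on `Γ`. -/
def VanishesOnBoundary (φ : Smooth) : Prop := slice 1 φ = 0 ∧ slice (-1) φ = 0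

/-- A smooth function that vanishes on `Γ` is bounded by a multiple of the distance to `Γ`. -/
theorem VanishesOnBoundary.exists_bound {φ : Smooth} (h : VanishesOnBoundary φ) :
    ∃ L : ℝ, 0 ≤ L ∧ ∀ p ∈ Omega, |φ.1 p| ≤ L * (1 - p.2.2 ^ 2) := by
  obtain ⟨L, hL0, hL⟩ := (D 2 φ).exists_bound
  refine ⟨L, hL0, fun p hp => ?_⟩
  obtain ⟨x, y, z⟩ := p
  have hz : z ∈ Set.Ioo (-1 : ℝ) 1 := hp
  have mvt : ∀ w ∈ Set.Icc (-1 : ℝ) 1, |φ.1 (x, y, z) - φ.1 (x, y, w)| ≤ L * |z - w| := by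
    intro w hw
    exact (convex_Icc (-1 : ℝ) 1).norm_image_sub_le_of_norm_hasDerivWithin_le
      (f := fun t => φ.1 (x, y, t)) (fun t _ => (φ.hasDerivAt_z x y t).hasDerivWithinAt)
      (fun t ht => hL _ ⟨trivial, trivial, ht⟩) hw (Set.Ioo_subset_Icc_self hz)
  have h1 : φ.1 (x, y, 1) = 0 := congrFun h.1 (x, y)
  have h0 : φ.1 (x, y, -1) = 0 := congrFun h.2 (x, y)
  have m1 := mvt 1 (by norm_num)
  have m0 := mvt (-1) (by norm_num)
  rw [h1, sub_zero, abs_of_neg (a := z - 1) (by linarith [hz.2])] at m1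
  rw [h0, sub_zero, abs_of_pos (a := z - -1) (by linarith [hz.1])] at m0
  rcases le_total 0 z with hz0 | hz0
  · refine m1.trans (mul_le_mul_of_nonneg_left ?_ hL0)
    nlinarith [hz.2]
  · refine m0.trans (mul_le_mul_of_nonneg_left ?_ hL0)
    nlinarith [hz.1]

/-- The derivative of the cutoff is `O(n)` on a layer of width `O(1/n)`, where a function that
vanishes on `Γ` is `O(1/n)`. -/
theorem VanishesOnBoundary.tendsto_inner {φ : Smooth} (h : VanishesOnBoundary φ) (f : L2) :
    Filter.Tendsto (fun n => inner ℝ f (toL2 (φ * D 2 (cutoff n)))) Filter.atTop (nhds 0) := by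
  obtain ⟨L, hL0, hL⟩ := h.exists_bound
  obtain ⟨M, hM0, hM⟩ := exists_deriv_smoothTransition_le
  simp only [inner_toL2_right]
  rw [← integral_zero Slab ℝ (μ := volOmega)]
  have hf : Integrable (fun p => f p) volOmega := (Lp.memLp f).integrable (by norm_num)
  refine tendsto_integral_of_dominated_convergence (fun p => ‖f p‖ * (4 * M * L))
    (fun n => (integrable_mul f _).aestronglyMeasurable) (hf.norm.mul_const _) ?_ ?_
  · intro n
    filter_upwards [ae_mem_Omega] with p hp
    rw [norm_mul]
    gcongr
    change ‖φ.1 p * (D 2 (cutoff n)).1 p‖ ≤ _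
    rw [D_two_cutoff_apply]
    by_cases ht : (n * (1 - p.2.2 ^ 2) - 1 : ℝ) ∈ Set.Icc (0 : ℝ) 1
    · have h2 : (n : ℝ) * (1 - p.2.2 ^ 2) ≤ 2 := by linarith [ht.2]
      have hz : |p.2.2| ≤ 1 := abs_le.2 ⟨hp.1.le, hp.2.le⟩
      have hd : 0 ≤ 1 - p.2.2 ^ 2 := by nlinarith [hp.1, hp.2]
      rw [norm_mul, norm_mul, Real.norm_eq_abs, Real.norm_eq_abs, Real.norm_eq_abs, abs_mul,
        abs_neg, abs_mul, abs_two, Nat.abs_cast]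
      calc |φ.1 p| * (|deriv smoothTransition (n * (1 - p.2.2 ^ 2) - 1)| * (n * (2 * |p.2.2|)))
          ≤ (L * (1 - p.2.2 ^ 2)) * (M * (n * (2 * 1))) := by
            gcongr
            · exact hL p hp
            · exact hM _
        _ = 2 * M * L * (n * (1 - p.2.2 ^ 2)) := by ring
        _ ≤ 2 * M * L * 2 := by gcongr
        _ = 4 * M * L := by ring
    · rw [deriv_smoothTransition_eq_zero ht]
      simp only [zero_mul, mul_zero, norm_zero]
      positivity
  · filter_upwards [ae_mem_Omega] with p hp
    refine tendsto_const_nhds.congr' ?_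
    filter_upwards [cutoff_argument_tendsto hp] with n hn
    change 0 = f p * (φ.1 p * (D 2 (cutoff n)).1 p)
    rw [D_two_cutoff_apply, deriv_smoothTransition_eq_zero fun hc => absurd hc.2 (not_le.2 hn)]
    simp

theorem eq_zero_of_inner_test_eq_zero {g : L2}
    (h : ∀ φ : Smooth, IsTest φ.1 → inner ℝ g (toL2 φ) = 0) : g = 0 := by
  refine eq_zero_of_inner_mode_eq_zero fun m n θ P => ?_
  have h1 := tendsto_inner_mul_cutoff g (mode m n θ * polyZ P)
  refine tendsto_nhds_unique h1 ?_
  simp only [h _ (isTest_mul_cutoff _ _)]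
  exact tendsto_const_nhds

theorem hasWeakDeriv_iff {i : Fin 3} {f g : L2} : HasWeakDeriv i f g ↔
    ∀ φ : Smooth, IsTest φ.1 → inner ℝ f (toL2 (D i φ)) = -inner ℝ g (toL2 φ) := by
  simp only [inner_toL2_right]
  exact ⟨fun h φ hφ => h φ.1 hφ, fun h φ hφ => h ⟨φ, hφ.1⟩ hφ⟩

theorem HasWeakDeriv.unique {i : Fin 3} {f g g' : L2} (h : HasWeakDeriv i f g)
    (h' : HasWeakDeriv i f g') : g = g' := by
  rw [← sub_eq_zero]
  refine eq_zero_of_inner_test_eq_zero fun φ hφ => ?_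
  have e := hasWeakDeriv_iff.1 h φ hφ
  have e' := hasWeakDeriv_iff.1 h' φ hφ
  rw [inner_sub_left]
  linarith

theorem HasWeakDeriv.wderiv_eq {i : Fin 3} {f g : L2} (h : HasWeakDeriv i f g) :
    wderiv i f = g := by
  have hex : ∃ g : L2, HasWeakDeriv i f g := ⟨g, h⟩
  rw [wderiv, dif_pos hex]
  exact hex.choose_spec.unique h

theorem MemH1.hasWeakDeriv {f : L2} (h : MemH1 f) (i : Fin 3) :
    HasWeakDeriv i f (wderiv i f) := by
  obtain ⟨g, hg⟩ := h i
  rwa [hg.wderiv_eq]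

/-- Green's formula in a horizontal direction: no boundary terms. -/
theorem HasWeakDeriv.inner_D_horizontal {i : Fin 3} (hi : i ≠ 2) {f g : L2}
    (h : HasWeakDeriv i f g) (φ : Smooth) :
    inner ℝ f (toL2 (D i φ)) = -inner ℝ g (toL2 φ) := by
  have h1 := tendsto_inner_mul_cutoff f (D i φ)
  have h2 := (tendsto_inner_mul_cutoff g φ).neg
  refine tendsto_nhds_unique h1 (h2.congr fun n => ?_)
  rw [← hasWeakDeriv_iff.1 h _ (isTest_mul_cutoff φ n), D_mul]
  have : D i (cutoff n) = 0 := D_ofZ hi _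
  rw [this, mul_zero, add_zero]

/-- Green's formula for functions without trace condition against smooth functions that vanish
on `Γ`. -/
theorem HasWeakDeriv.inner_D_of_vanishes {i : Fin 3} {f g : L2}
    (h : HasWeakDeriv i f g) {φ : Smooth} (hφ : VanishesOnBoundary φ) :
    inner ℝ f (toL2 (D i φ)) = -inner ℝ g (toL2 φ) := by
  by_cases hi : i = 2
  · subst hi
    have h1 := (tendsto_inner_mul_cutoff f (D 2 φ)).add (hφ.tendsto_inner f)
    have h2 := (tendsto_inner_mul_cutoff g φ).neg
    rw [add_zero] at h1
    refine tendsto_nhds_unique h1 (h2.congr fun n => ?_)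
    rw [← hasWeakDeriv_iff.1 h _ (isTest_mul_cutoff φ n), D_mul, map_add, inner_add_right]
  · exact h.inner_D_horizontal hi φ

/-! ### The ordinary differential equations of a Fourier mode -/

open Polynomial in
theorem exists_derivative_eq (P : ℝ[X]) : ∃ R : ℝ[X], derivative R = P := by
  induction P using Polynomial.induction_on' with
  | add p q hp hq =>
    obtain ⟨R, rfl⟩ := hp
    obtain ⟨S, rfl⟩ := hq
    exact ⟨R + S, derivative_add⟩
  | monomial n a =>
    refine ⟨monomial (n + 1) (a / (n + 1)), ?_⟩
    rw [derivative_monomial]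
    have : (n + 1 : ℝ) ≠ 0 := by positivity
    simp [this]

open Polynomial in
/-- `P'' - κ² P = Q` is solvable in polynomials: by induction on the degree, with
`P = -Q / κ²` up to lower order terms. -/
theorem exists_derivative_sub_eq {κ : ℝ} (hκ : κ ≠ 0) (Q : ℝ[X]) :
    ∃ P : ℝ[X], derivative (derivative P) - C (κ ^ 2) * P = Q := by
  have key : ∀ (n : ℕ) (Q : ℝ[X]), derivative^[2 * n] Q = 0 →
      ∃ P : ℝ[X], derivative (derivative P) - C (κ ^ 2) * P = Q := by
    intro n
    induction n with
    | zero => exact fun Q hQ => ⟨0, by simpa using hQ.symm⟩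
    | succ n ih =>
      intro Q hQ
      obtain ⟨P, hP⟩ := ih (derivative (derivative Q)) (by
        rw [mul_add, Function.iterate_add_apply] at hQ
        simpa using hQ)
      refine ⟨C (κ ^ 2)⁻¹ * (P - Q), ?_⟩
      have h1 : C (κ ^ 2)⁻¹ * C (κ ^ 2) = (1 : ℝ[X]) := by
        rw [← C_mul, inv_mul_cancel₀ (pow_ne_zero 2 hκ), C_1]
      have h2 : derivative (derivative (C (κ ^ 2)⁻¹ * (P - Q))) =
          C (κ ^ 2)⁻¹ * (derivative (derivative P) - derivative (derivative Q)) := by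
        simp
      rw [h2, ← hP]
      linear_combination (P - (P - Q)) * h1
  exact key Q.natDegree.succ Q (iterate_derivative_eq_zero (by omega))

/-- The functions `P(z) + (a + b z) cosh κz + (c + d z) sinh κz`, a family closed under
derivatives. -/
def expPoly (κ : ℝ) (P : Polynomial ℝ) (a b c d z : ℝ) : ℝ :=
  P.eval z + (a + b * z) * cosh (κ * z) + (c + d * z) * sinh (κ * z)

theorem contDiff_expPoly (κ : ℝ) (P : Polynomial ℝ) (a b c d : ℝ) :
    ContDiff ℝ ∞ (expPoly κ P a b c d) := by
  have h : ContDiff ℝ ∞ fun z => P.eval z := by simpa using P.contDiff_aeval (𝕜 := ℝ) ∞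
  unfold expPoly
  fun_prop

theorem hasDerivAt_expPoly (κ : ℝ) (P : Polynomial ℝ) (a b c d z : ℝ) :
    HasDerivAt (expPoly κ P a b c d)
      (expPoly κ P.derivative (b + κ * c) (κ * d) (d + κ * a) (κ * b) z) z := by
  have hl : ∀ a b : ℝ, HasDerivAt (fun z : ℝ => a + b * z) b z := fun a b => by
    simpa using ((hasDerivAt_id z).const_mul b).const_add a
  have hk : HasDerivAt (fun z : ℝ => κ * z) κ z := by simpa using (hasDerivAt_id z).const_mul κ
  have h := ((P.hasDerivAt z).add ((hl a b).mul hk.cosh)).add ((hl c d).mul hk.sinh)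
  refine h.congr_deriv ?_
  simp only [expPoly]
  ring

/-- The function `expPoly` as a function on the slab. -/
def expPolyZ (κ : ℝ) (P : Polynomial ℝ) (a b c d : ℝ) : Smooth :=
  ofZ (expPoly κ P a b c d) (contDiff_expPoly κ P a b c d)

theorem D_two_expPolyZ (κ : ℝ) (P : Polynomial ℝ) (a b c d : ℝ) :
    D 2 (expPolyZ κ P a b c d) =
      expPolyZ κ P.derivative (b + κ * c) (κ * d) (d + κ * a) (κ * b) :=
  D_two_ofZ _ _ (hasDerivAt_expPoly κ P a b c d)

/-- Cramer's rule. -/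
theorem exists_solution_two {a b c d : ℝ} (h : a * d - b * c ≠ 0) (e f : ℝ) :
    ∃ x y : ℝ, a * x + b * y = e ∧ c * x + d * y = f := by
  refine ⟨(e * d - b * f) / (a * d - b * c), (a * f - e * c) / (a * d - b * c), ?_, ?_⟩
  · rw [mul_div_assoc', mul_div_assoc', ← add_div, div_eq_iff h]; ring
  · rw [mul_div_assoc', mul_div_assoc', ← add_div, div_eq_iff h]; ring

open Polynomial in
/-- The Robin problem `-w'' + κ² w = F`, `±w' + β w = 0` at `z = ±1`. -/
theorem exists_robin {β κ : ℝ} (hβ : 0 ≤ β) (hκ : 0 < κ) (F : ℝ[X]) :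
    ∃ w : Smooth, D 0 w = 0 ∧ D 1 w = 0 ∧ -D 2 (D 2 w) + κ ^ 2 • w = polyZ F ∧
      slice 1 (D 2 w) + β • slice 1 w = 0 ∧ -slice (-1) (D 2 w) + β • slice (-1) w = 0 := by
  obtain ⟨P, hP⟩ := exists_derivative_sub_eq hκ.ne' (-F)
  have hs : 0 < sinh κ := sinh_pos_iff.2 hκ
  have hc : 0 < cosh κ := cosh_pos κ
  set e1 := (P.derivative.eval 1 + β * P.eval 1)
  set e0 := (-P.derivative.eval (-1) + β * P.eval (-1))
  set a := -(e1 + e0) / 2 / (κ * sinh κ + β * cosh κ)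
  set c := -(e1 - e0) / 2 / (κ * cosh κ + β * sinh κ)
  have ha' : a * (κ * sinh κ + β * cosh κ) = -(e1 + e0) / 2 :=
    div_mul_cancel₀ _ (by positivity)
  have hc' : c * (κ * cosh κ + β * sinh κ) = -(e1 - e0) / 2 :=
    div_mul_cancel₀ _ (by positivity)
  refine ⟨expPolyZ κ P a 0 c 0, D_ofZ (by decide) _, D_ofZ (by decide) _, ?_, ?_, ?_⟩
  · rw [D_two_expPolyZ, D_two_expPolyZ]
    apply Subtype.ext
    funext p
    have hp := congrArg (Polynomial.eval p.2.2) hP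
    simp only [eval_sub, eval_mul, eval_C, eval_neg] at hp
    change -expPoly _ _ _ _ _ _ p.2.2 + κ ^ 2 * expPoly _ _ _ _ _ _ p.2.2 = F.eval p.2.2
    simp only [expPoly]
    linear_combination -hp
  · rw [D_two_expPolyZ]
    funext y
    change expPoly _ _ _ _ _ _ 1 + β * expPoly _ _ _ _ _ _ 1 = 0
    simp only [expPoly, mul_one]
    simp only [e1, e0] at ha' hc'
    linear_combination ha' + hc'
  · rw [D_two_expPolyZ]
    funext y
    change -expPoly _ _ _ _ _ _ (-1) + β * expPoly _ _ _ _ _ _ (-1) = 0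
    simp only [expPoly, mul_neg, mul_one, cosh_neg, sinh_neg]
    simp only [e1, e0] at ha' hc'
    linear_combination ha' - hc'

/-- The antiderivative of a polynomial of mean zero on `Ω` has equal end values. -/
theorem eval_one_eq_of_I_eq_zero {R : Polynomial ℝ} (h : I (polyZ R.derivative) = 0) :
    R.eval 1 = R.eval (-1) := by
  have h1 := I_D_two (polyZ R)
  rw [D_two_polyZ, h, B_apply, B_apply] at h1
  simp only [slice, polyZ_apply, integral_const, smul_eq_mul, ← mul_sub] at h1
  have h2 : (volume : Measure (Torus × Torus)).real Set.univ ≠ 0 := by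
    have := Real.pi_pos
    rw [Measure.real, Measure.volume_eq_prod, ← Set.univ_prod_univ, Measure.prod_prod,
      AddCircle.measure_univ, ENNReal.toReal_mul, ENNReal.toReal_ofReal (by positivity)]
    positivity
  have := (mul_eq_zero.1 h1.symm).resolve_left h2
  linarith

open Polynomial in
/-- The Robin problem with `κ = 0`, where for `β = 0` the datum has to have mean zero. -/
theorem exists_robin_zero {β : ℝ} (hβ : 0 ≤ β) (F : ℝ[X])
    (hF : β = 0 → I (polyZ F) = 0) :
    ∃ w : Smooth, D 0 w = 0 ∧ D 1 w = 0 ∧ -D 2 (D 2 w) = polyZ F ∧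
      slice 1 (D 2 w) + β • slice 1 w = 0 ∧ -slice (-1) (D 2 w) + β • slice (-1) w = 0 := by
  obtain ⟨R, hR⟩ := exists_derivative_eq F
  obtain ⟨Q, hQ⟩ := exists_derivative_eq R
  have hR0 : β = 0 → R.eval 1 = R.eval (-1) := fun h =>
    eval_one_eq_of_I_eq_zero (by rw [hR]; exact hF h)
  have hA : ∃ A : ℝ, 2 * β * A = R.eval 1 - R.eval (-1) + β * (Q.eval 1 + Q.eval (-1)) := by
    rcases hβ.eq_or_lt with h | h
    · refine ⟨0, ?_⟩
      rw [hR0 h.symm, ← h]; ring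
    · refine ⟨(R.eval 1 - R.eval (-1) + β * (Q.eval 1 + Q.eval (-1))) / (2 * β), ?_⟩
      field_simp
  obtain ⟨A, hA⟩ := hA
  set E := (R.eval 1 + R.eval (-1) + β * (Q.eval 1 - Q.eval (-1))) / (2 + 2 * β)
  have hE : E * (2 + 2 * β) = R.eval 1 + R.eval (-1) + β * (Q.eval 1 - Q.eval (-1)) :=
    div_mul_cancel₀ _ (by positivity)
  have hw : D 2 (polyZ (-Q + C A + C E * X)) = polyZ (-R + C E) := by
    rw [D_two_polyZ]; simp [hQ]
  refine ⟨polyZ (-Q + C A + C E * X), D_ofZ (by decide) _, D_ofZ (by decide) _, ?_, ?_, ?_⟩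
  · rw [hw, D_two_polyZ]
    apply Subtype.ext
    funext p
    change -(derivative (-R + C E)).eval p.2.2 = F.eval p.2.2
    simp [hR]
  · rw [hw]
    funext y
    change (-R + C E).eval 1 + β * (-Q + C A + C E * X).eval 1 = 0
    simp only [eval_add, eval_neg, eval_C, eval_mul, eval_X]
    linear_combination hA / 2 + hE / 2
  · rw [hw]
    funext y
    change -(-R + C E).eval (-1) + β * (-Q + C A + C E * X).eval (-1) = 0
    simp only [eval_add, eval_neg, eval_C, eval_mul, eval_X]
    linear_combination hA / 2 - hE / 2

open Polynomial in
/-- The fourth order problem `(∂² - κ²)² b = G`, `b = 0` and `±b'' + β b' = 0` at `z = ±1`, for the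
vertical velocity. The even and the odd part decouple. -/
theorem exists_fourth_order {β κ : ℝ} (hβ : 0 ≤ β) (hκ : 0 < κ) (G : ℝ[X]) :
    ∃ b : Smooth, D 0 b = 0 ∧ D 1 b = 0 ∧
      D 2 (D 2 (D 2 (D 2 b))) - (2 * κ ^ 2) • D 2 (D 2 b) + κ ^ 4 • b = polyZ G ∧
      VanishesOnBoundary b ∧
      slice 1 (D 2 (D 2 b)) + β • slice 1 (D 2 b) = 0 ∧
      slice (-1) (D 2 (D 2 b)) - β • slice (-1) (D 2 b) = 0 := by
  obtain ⟨Q, hQ⟩ := exists_derivative_sub_eq hκ.ne' G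
  obtain ⟨P, hP⟩ := exists_derivative_sub_eq hκ.ne' Q
  have hPQ : ∀ z, P.derivative.derivative.derivative.derivative.eval z -
      2 * κ ^ 2 * P.derivative.derivative.eval z + κ ^ 4 * P.eval z = G.eval z := by
    intro z
    rw [← hQ, ← hP]
    simp only [derivative_sub, derivative_C_mul, eval_sub, eval_mul, eval_C]
    ring
  have hs : 0 < sinh κ := sinh_pos_iff.2 hκ
  have hc : 1 ≤ cosh κ := one_le_cosh κ
  have hsk : κ ≤ sinh κ := self_le_sinh_iff.2 hκ.le
  have hcs : cosh κ ^ 2 - sinh κ ^ 2 = 1 := cosh_sq_sub_sinh_sq κ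
  set s := sinh κ
  set c := cosh κ
  have hc0 : 0 < c := by linarith
  obtain ⟨A, F, hA1, hA2⟩ := exists_solution_two
    (a := c) (b := s) (c := κ ^ 2 * c + β * (κ * s))
    (d := 2 * κ * c + κ ^ 2 * s + β * (s + κ * c))
    (by
      have : c * (2 * κ * c + κ ^ 2 * s + β * (s + κ * c)) - s * (κ ^ 2 * c + β * (κ * s)) =
        2 * κ * c ^ 2 + β * (s * c + κ) := by linear_combination β * κ * hcs
      rw [this]; positivity)
    (-(P.eval 1 + P.eval (-1)) / 2)
    (-(P.derivative.derivative.eval 1 + P.derivative.derivative.eval (-1) +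
      β * (P.derivative.eval 1 - P.derivative.eval (-1))) / 2)
  obtain ⟨E, J, hE1, hE2⟩ := exists_solution_two
    (a := s) (b := c) (c := κ ^ 2 * s + β * (κ * c))
    (d := 2 * κ * s + κ ^ 2 * c + β * (c + κ * s))
    (by
      have : s * (2 * κ * s + κ ^ 2 * c + β * (c + κ * s)) - c * (κ ^ 2 * s + β * (κ * c)) =
        2 * κ * s ^ 2 + β * (s * c - κ) := by linear_combination -β * κ * hcs
      rw [this]
      have h1 : 0 ≤ s * c - κ := by nlinarith
      positivity)
    (-(P.eval 1 - P.eval (-1)) / 2)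
    (-(P.derivative.derivative.eval 1 - P.derivative.derivative.eval (-1) +
      β * (P.derivative.eval 1 + P.derivative.eval (-1))) / 2)
  refine ⟨expPolyZ κ P A J E F, D_ofZ (by decide) _, D_ofZ (by decide) _, ?_, ⟨?_, ?_⟩, ?_, ?_⟩
  · simp only [D_two_expPolyZ]
    apply Subtype.ext
    funext p
    change expPoly _ _ _ _ _ _ p.2.2 - 2 * κ ^ 2 * expPoly _ _ _ _ _ _ p.2.2 +
      κ ^ 4 * expPoly _ _ _ _ _ _ p.2.2 = G.eval p.2.2
    rw [← hPQ]
    simp only [expPoly]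
    ring
  · funext y
    change expPoly _ _ _ _ _ _ 1 = 0
    simp only [expPoly, mul_one]
    linear_combination hA1 + hE1
  · funext y
    change expPoly _ _ _ _ _ _ (-1) = 0
    simp only [expPoly, mul_neg, mul_one, cosh_neg, sinh_neg]
    linear_combination hA1 - hE1
  · simp only [D_two_expPolyZ]
    funext y
    change expPoly _ _ _ _ _ _ 1 + β * expPoly _ _ _ _ _ _ 1 = 0
    simp only [expPoly, mul_one]
    linear_combination hA2 + hE2
  · simp only [D_two_expPolyZ]
    funext y
    change expPoly _ _ _ _ _ _ (-1) - β * expPoly _ _ _ _ _ _ (-1) = 0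
    simp only [expPoly, mul_neg, mul_one, cosh_neg, sinh_neg]
    linear_combination hA2 - hE2

/-! ### Classical solutions -/

/-- The Laplacian on smooth functions. -/
def lap : Smooth →ₗ[ℝ] Smooth := ∑ i, D i ∘ₗ D i

theorem lap_apply (φ : Smooth) : lap φ = ∑ i, D i (D i φ) := by simp [lap]

theorem D_lap (i : Fin 3) (φ : Smooth) : D i (lap φ) = lap (D i φ) := by
  rw [lap_apply, lap_apply, map_sum]
  refine Finset.sum_congr rfl fun k _ => ?_
  rw [D_comm i k, D_comm i k]

/-- `u` is a smooth solenoidal field that satisfies the boundary conditions, the Navier condition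
in the form `∂_ν u_j + β u_j = 0`, to which it reduces since `∂_j u_2 = 0` on `Γ`. -/
structure IsAdmissible (β : ℝ) (u : Fin 3 → Smooth) : Prop where
  div : ∑ i, D i (u i) = 0
  vanish : VanishesOnBoundary (u 2)
  robin_top : ∀ j : Fin 3, j ≠ 2 → slice 1 (D 2 (u j)) + β • slice 1 (u j) = 0
  robin_bot : ∀ j : Fin 3, j ≠ 2 → -slice (-1) (D 2 (u j)) + β • slice (-1) (u j) = 0

/-- The right-hand side `-Δu + ∇q` of the Stokes equation. -/
def force (u : Fin 3 → Smooth) (q : Smooth) (j : Fin 3) : Smooth := -lap (u j) + D j q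

theorem VanishesOnBoundary.zero : VanishesOnBoundary 0 := ⟨rfl, rfl⟩

theorem lap_mode_mul {m n : ℤ} (θ : ℝ) {w : Smooth} (h0 : D 0 w = 0) (h1 : D 1 w = 0) :
    lap (mode m n θ * w) =
      mode m n θ * (D 2 (D 2 w) - ((m : ℝ) ^ 2 + (n : ℝ) ^ 2) • w) := by
  rw [lap_apply, Fin.sum_univ_three]
  simp only [D_mul, h0, h1, D_two_mode, D_zero_mode, D_one_mode, mul_zero, add_zero, zero_mul,
    zero_add, map_smul, mode_add_pi]
  refine Smooth.ext_apply fun p => ?_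
  simp only [Smooth.add_apply, Smooth.sub_apply, Smooth.neg_apply, Smooth.mul_apply,
    Smooth.smul_apply]
  ring

theorem sq_add_sq_pos {m n : ℤ} (hmn : (m, n) ≠ 0) : 0 < (m : ℝ) ^ 2 + (n : ℝ) ^ 2 := by
  have : m ≠ 0 ∨ n ≠ 0 := by
    by_contra! h; exact hmn (by simp [h.1, h.2])
  rcases this with h | h
  · have : (m : ℝ) ≠ 0 := by exact_mod_cast h
    positivity
  · have : (n : ℝ) ≠ 0 := by exact_mod_cast h
    positivity

/-- Transverse solutions: a scalar Robin problem times a mode, in the direction orthogonal to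
`(m, n)`. -/
theorem exists_transverse {β : ℝ} (hβ : 0 ≤ β) {m n : ℤ} (hmn : (m, n) ≠ 0) (θ : ℝ)
    (F : Polynomial ℝ) : ∃ u, IsAdmissible β u ∧
      force u 0 = ![(-n : ℝ) • (mode m n θ * polyZ F), (m : ℝ) • (mode m n θ * polyZ F), 0] := by
  have hk := sq_add_sq_pos hmn
  obtain ⟨w, h0, h1, he, ht, hb⟩ := exists_robin hβ (Real.sqrt_pos.2 hk) F
  rw [Real.sq_sqrt hk.le] at he
  have hl : -lap (mode m n θ * w) = mode m n θ * polyZ F := by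
    rw [lap_mode_mul θ h0 h1, ← he]; ring
  have ht' : slice 1 (D 2 (mode m n θ * w)) + β • slice 1 (mode m n θ * w) = 0 := by
    rw [D_mul, D_two_mode, zero_mul, zero_add, slice_mul, slice_mul, ← mul_smul_comm, ← mul_add,
      ht, mul_zero]
  have hb' : -slice (-1) (D 2 (mode m n θ * w)) + β • slice (-1) (mode m n θ * w) = 0 := by
    rw [D_mul, D_two_mode, zero_mul, zero_add, slice_mul, slice_mul, ← mul_smul_comm, ← mul_neg,
      ← mul_add, hb, mul_zero]
  refine ⟨![(-n : ℝ) • (mode m n θ * w), (m : ℝ) • (mode m n θ * w), 0], ⟨?_, ?_, ?_, ?_⟩, ?_⟩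
  · rw [Fin.sum_univ_three]
    simp [D_mul, h0, h1, D_zero_mode, D_one_mode, smul_smul, mul_comm]
  · exact VanishesOnBoundary.zero
  · intro j hj
    fin_cases j
    · change slice 1 (D 2 ((-n : ℝ) • _)) + β • slice 1 ((-n : ℝ) • _) = 0
      rw [map_smul, slice_smul, slice_smul, smul_comm, ← smul_add, ht', smul_zero]
    · change slice 1 (D 2 ((m : ℝ) • _)) + β • slice 1 ((m : ℝ) • _) = 0
      rw [map_smul, slice_smul, slice_smul, smul_comm, ← smul_add, ht', smul_zero]
    · exact absurd rfl hj
  · intro j hj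
    fin_cases j
    · change -slice (-1) (D 2 ((-n : ℝ) • _)) + β • slice (-1) ((-n : ℝ) • _) = 0
      rw [map_smul, slice_smul, slice_smul, smul_comm, ← smul_neg, ← smul_add, hb', smul_zero]
    · change -slice (-1) (D 2 ((m : ℝ) • _)) + β • slice (-1) ((m : ℝ) • _) = 0
      rw [map_smul, slice_smul, slice_smul, smul_comm, ← smul_neg, ← smul_add, hb', smul_zero]
    · exact absurd rfl hj
  · funext j
    fin_cases j
    · change -lap ((-n : ℝ) • _) + D 0 0 = (-n : ℝ) • _
      rw [map_smul, map_zero, add_zero, ← hl, smul_neg]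
    · change -lap ((m : ℝ) • _) + D 1 0 = (m : ℝ) • _
      rw [map_smul, map_zero, add_zero, ← hl, smul_neg]
    · change -lap 0 + D 2 0 = 0
      simp

/-- Longitudinal solutions: elimination of the horizontal velocity and of the pressure leaves a
fourth order equation for the vertical velocity. -/
theorem exists_longitudinal {β : ℝ} (hβ : 0 ≤ β) {m n : ℤ} (hmn : (m, n) ≠ 0) (θ : ℝ)
    (F G : Polynomial ℝ) : ∃ u q, IsAdmissible β u ∧
      force u q = ![(m : ℝ) • (mode m n θ * polyZ F), (n : ℝ) • (mode m n θ * polyZ F),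
        mode m n (θ + π / 2) * polyZ G] := by
  have hk := sq_add_sq_pos hmn
  set k := (m : ℝ) ^ 2 + (n : ℝ) ^ 2 with hkdef
  obtain ⟨b, h0, h1, he, hv, ht, hb⟩ := exists_fourth_order hβ (Real.sqrt_pos.2 hk)
    (Polynomial.C k * (G + F.derivative))
  have e4 : √k ^ 4 = k ^ 2 := by
    rw [show √k ^ 4 = (√k ^ 2) ^ 2 by ring, Real.sq_sqrt hk.le]
  rw [Real.sq_sqrt hk.le, e4] at he
  have he' : D 2 (D 2 (D 2 (D 2 b))) - (2 * k) • D 2 (D 2 b) + k ^ 2 • b =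
      k • (polyZ G + D 2 (polyZ F)) := by
    rw [he, D_two_polyZ]
    apply Subtype.ext
    funext p
    change (Polynomial.C k * (G + F.derivative)).eval p.2.2 =
      k * (G.eval p.2.2 + F.derivative.eval p.2.2)
    simp
  set a := (-k⁻¹) • D 2 b with ha
  have ha0 : D 0 a = 0 := by rw [ha, map_smul, D_comm, h0, map_zero, smul_zero]
  have ha1 : D 1 a = 0 := by rw [ha, map_smul, D_comm, h1, map_zero, smul_zero]
  set r := -(D 2 (D 2 a) - k • a) - polyZ F with hr
  have hr0 : D 0 r = 0 := by
    simp only [hr, map_sub, map_neg, map_smul, D_comm 0 2, ha0, map_zero, smul_zero, sub_zero,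
      neg_zero, zero_sub]
    rw [neg_eq_zero]; exact D_ofZ (by decide) _
  have hr1 : D 1 r = 0 := by
    simp only [hr, map_sub, map_neg, map_smul, D_comm 1 2, ha1, map_zero, smul_zero, sub_zero,
      neg_zero, zero_sub]
    rw [neg_eq_zero]; exact D_ofZ (by decide) _
  have hra : -(D 2 (D 2 a) - k • a) - r = polyZ F := by rw [hr]; abel
  have hrb : -(D 2 (D 2 b) - k • b) + D 2 r = polyZ G := by
    have h2 : polyZ G = k⁻¹ • (D 2 (D 2 (D 2 (D 2 b))) - (2 * k) • D 2 (D 2 b) + k ^ 2 • b) -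
        D 2 (polyZ F) := by
      rw [he', smul_smul, inv_mul_cancel₀ hk.ne', one_smul]; abel
    rw [h2, hr, ha]
    simp only [map_sub, map_neg, map_smul]
    match_scalars
    all_goals
      field_simp
      try ring
  set σ := mode m n θ
  set γ := mode m n (θ + π / 2) with hγ
  have hγ0 : D 0 γ = -(m : ℝ) • σ := by
    rw [hγ, D_zero_mode, mode_add_pi, smul_neg, neg_smul]
  have hγ1 : D 1 γ = -(n : ℝ) • σ := by
    rw [hγ, D_one_mode, mode_add_pi, smul_neg, neg_smul]
  have hσ0 : D 0 σ = (m : ℝ) • γ := D_zero_mode m n θ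
  have hσ1 : D 1 σ = (n : ℝ) • γ := D_one_mode m n θ
  have hσ2 : D 2 σ = 0 := D_two_mode m n θ
  have hγ2 : D 2 γ = 0 := D_two_mode _ _ _
  have ht' : slice 1 (D 2 (σ * a)) + β • slice 1 (σ * a) = 0 := by
    rw [D_mul, hσ2, zero_mul, zero_add, slice_mul, slice_mul, ← mul_smul_comm, ← mul_add, ha,
      map_smul, slice_smul, slice_smul, smul_comm β, ← smul_add, ht, smul_zero, mul_zero]
  have hb' : -slice (-1) (D 2 (σ * a)) + β • slice (-1) (σ * a) = 0 := by
    have hb2 : -slice (-1) (D 2 (D 2 b)) + β • slice (-1) (D 2 b) = 0 := by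
      rw [← neg_eq_zero, ← hb]; abel
    rw [D_mul, hσ2, zero_mul, zero_add, slice_mul, slice_mul, ← mul_smul_comm, ← mul_neg,
      ← mul_add, ha, map_smul, slice_smul, slice_smul, smul_comm β, ← smul_neg, ← smul_add, hb2,
      smul_zero, mul_zero]
  have hla : lap (σ * a) = σ * (D 2 (D 2 a) - k • a) := lap_mode_mul θ ha0 ha1
  have hlb : lap (γ * b) = γ * (D 2 (D 2 b) - k • b) := lap_mode_mul _ h0 h1
  refine ⟨![(m : ℝ) • (σ * a), (n : ℝ) • (σ * a), γ * b], γ * r, ⟨?_, ?_, ?_, ?_⟩, ?_⟩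
  · rw [Fin.sum_univ_three]
    change D 0 ((m : ℝ) • (σ * a)) + D 1 ((n : ℝ) • (σ * a)) + D 2 (γ * b) = 0
    have hab : k • a = -D 2 b := by
      rw [ha, smul_smul, mul_neg, mul_inv_cancel₀ hk.ne', neg_smul, one_smul]
    have : D 2 b = -(k • a) := by rw [hab, neg_neg]
    rw [map_smul, map_smul, D_mul, D_mul, D_mul, ha0, ha1, hσ0, hσ1, hγ2, this, hkdef]
    refine Smooth.ext_apply fun p => ?_
    simp only [Smooth.add_apply, Smooth.neg_apply, Smooth.mul_apply, Smooth.smul_apply,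
      Smooth.zero_apply]
    ring
  · constructor
    · change slice 1 (γ * b) = 0
      rw [slice_mul, hv.1, mul_zero]
    · change slice (-1) (γ * b) = 0
      rw [slice_mul, hv.2, mul_zero]
  · intro j hj
    fin_cases j
    · change slice 1 (D 2 ((m : ℝ) • _)) + β • slice 1 ((m : ℝ) • _) = 0
      rw [map_smul, slice_smul, slice_smul, smul_comm, ← smul_add, ht', smul_zero]
    · change slice 1 (D 2 ((n : ℝ) • _)) + β • slice 1 ((n : ℝ) • _) = 0
      rw [map_smul, slice_smul, slice_smul, smul_comm, ← smul_add, ht', smul_zero]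
    · exact absurd rfl hj
  · intro j hj
    fin_cases j
    · change -slice (-1) (D 2 ((m : ℝ) • _)) + β • slice (-1) ((m : ℝ) • _) = 0
      rw [map_smul, slice_smul, slice_smul, smul_comm, ← smul_neg, ← smul_add, hb', smul_zero]
    · change -slice (-1) (D 2 ((n : ℝ) • _)) + β • slice (-1) ((n : ℝ) • _) = 0
      rw [map_smul, slice_smul, slice_smul, smul_comm, ← smul_neg, ← smul_add, hb', smul_zero]
    · exact absurd rfl hj
  · funext j
    fin_cases j
    · change -lap ((m : ℝ) • (σ * a)) + D 0 (γ * r) = (m : ℝ) • (σ * polyZ F)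
      rw [map_smul, hla, D_mul, hγ0, hr0, ← hra]
      refine Smooth.ext_apply fun p => ?_
      simp only [Smooth.add_apply, Smooth.sub_apply, Smooth.neg_apply, Smooth.mul_apply,
        Smooth.smul_apply, Smooth.zero_apply]
      ring
    · change -lap ((n : ℝ) • (σ * a)) + D 1 (γ * r) = (n : ℝ) • (σ * polyZ F)
      rw [map_smul, hla, D_mul, hγ1, hr1, ← hra]
      refine Smooth.ext_apply fun p => ?_
      simp only [Smooth.add_apply, Smooth.sub_apply, Smooth.neg_apply, Smooth.mul_apply,
        Smooth.smul_apply, Smooth.zero_apply]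
      ring
    · change -lap (γ * b) + D 2 (γ * r) = γ * polyZ G
      rw [hlb, D_mul, hγ2, ← hrb]
      ring

/-! ### Totality of the forces of classical solutions -/

theorem I_one_pos : 0 < I 1 := by
  have : I 1 = volOmega.real Set.univ := by
    rw [I_apply]
    change ∫ _, (1 : ℝ) ∂volOmega = _
    simp
  rw [this]; exact volOmega_univ_pos

/-- A mode of nonzero frequency is a horizontal derivative. -/
theorem exists_D_eq_mode_mul {m n : ℤ} (hmn : (m, n) ≠ 0) (θ : ℝ) (P : Polynomial ℝ) :
    ∃ i : Fin 3, i ≠ 2 ∧ ∃ ψ, D i ψ = mode m n θ * polyZ P := by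
  have hθ : θ - π / 2 + π / 2 = θ := by ring
  have hz : ∀ i : Fin 3, i ≠ 2 → D i (polyZ P) = 0 := fun i hi => D_ofZ hi _
  by_cases hm : m = 0
  · have hn : (n : ℝ) ≠ 0 := by
      intro h; exact hmn (by simp [hm, Int.cast_eq_zero.1 h])
    refine ⟨1, by decide, (n : ℝ)⁻¹ • (mode m n (θ - π / 2) * polyZ P), ?_⟩
    rw [map_smul, D_mul, hz 1 (by decide), mul_zero, add_zero, D_one_mode, hθ, smul_mul_assoc,
      smul_smul, inv_mul_cancel₀ hn, one_smul]
  · have hm' : (m : ℝ) ≠ 0 := by exact_mod_cast hm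
    refine ⟨0, by decide, (m : ℝ)⁻¹ • (mode m n (θ - π / 2) * polyZ P), ?_⟩
    rw [map_smul, D_mul, hz 0 (by decide), mul_zero, add_zero, D_zero_mode, hθ, smul_mul_assoc,
      smul_smul, inv_mul_cancel₀ hm', one_smul]

theorem I_mode_mul {m n : ℤ} (hmn : (m, n) ≠ 0) (θ : ℝ) (P : Polynomial ℝ) :
    I (mode m n θ * polyZ P) = 0 := by
  obtain ⟨i, hi, ψ, hψ⟩ := exists_D_eq_mode_mul hmn θ P
  rw [← hψ, I_D_horizontal hi]

theorem mode_zero_zero (θ : ℝ) : mode 0 0 θ = Real.cos θ • (1 : Smooth) := by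
  apply Smooth.ext_cov
  intro x
  rw [mode_cov]
  change _ = Real.cos θ * 1
  simp

theorem polyZ_C (c : ℝ) : polyZ (Polynomial.C c) = c • (1 : Smooth) := by
  refine Smooth.ext_apply fun p => ?_
  change (Polynomial.C c).eval p.2.2 = c * 1
  simp

theorem polyZ_sub (P Q : Polynomial ℝ) : polyZ (P - Q) = polyZ P - polyZ Q := by
  refine Smooth.ext_apply fun p => ?_
  change (P - Q).eval p.2.2 = P.eval p.2.2 - Q.eval p.2.2
  simp

/-- Horizontal solutions that depend on `z` only. -/
theorem exists_horizontal {β : ℝ} (hβ : 0 ≤ β) {j : Fin 3} (hj : j ≠ 2) (F : Polynomial ℝ)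
    (hF : β = 0 → I (polyZ F) = 0) :
    ∃ u, IsAdmissible β u ∧ force u 0 = Pi.single j (polyZ F) := by
  obtain ⟨w, h0, h1, he, ht, hb⟩ := exists_robin_zero hβ F hF
  have hz : ∀ i, i ≠ j → (Pi.single j w : Fin 3 → Smooth) i = 0 := fun i hi =>
    Pi.single_eq_of_ne hi _
  refine ⟨Pi.single j w, ⟨?_, ?_, ?_, ?_⟩, ?_⟩
  · refine Finset.sum_eq_zero fun i _ => ?_
    by_cases hi : i = j
    · subst hi
      rw [Pi.single_eq_same]
      fin_cases i
      · exact h0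
      · exact h1
      · exact absurd rfl hj
    · rw [hz i hi, map_zero]
  · rw [hz 2 hj.symm]; exact VanishesOnBoundary.zero
  · intro i _
    by_cases hi : i = j
    · subst hi; rw [Pi.single_eq_same]; exact ht
    · rw [hz i hi, map_zero, slice_zero, smul_zero, add_zero]
  · intro i _
    by_cases hi : i = j
    · subst hi; rw [Pi.single_eq_same]; exact hb
    · rw [hz i hi, map_zero, slice_zero, smul_zero, add_zero, neg_zero]
  · funext i
    by_cases hi : i = j
    · subst hi
      rw [force, Pi.single_eq_same, Pi.single_eq_same, map_zero, add_zero, lap_apply,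
        Fin.sum_univ_three, h0, h1, map_zero, map_zero, zero_add, zero_add, he]
    · rw [force, hz i hi, Pi.single_eq_of_ne hi, map_zero, map_zero, neg_zero, add_zero]

theorem isAdmissible_zero (β : ℝ) : IsAdmissible β 0 := by
  refine ⟨by simp, VanishesOnBoundary.zero, fun j _ => ?_, fun j _ => ?_⟩ <;>
  · rw [Pi.zero_apply, map_zero, slice_zero]; simp

/-- A function that is orthogonal to all modes of nonzero frequency and to all functions of `z` of
mean zero is constant. -/
theorem eq_mean_smul_one {g : L2} (h1 : ∀ m n : ℤ, (m, n) ≠ 0 → ∀ θ P,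
      inner ℝ g (toL2 (mode m n θ * polyZ P)) = 0)
    (h2 : ∀ P, I (polyZ P) = 0 → inner ℝ g (toL2 (polyZ P)) = 0) :
    g = (inner ℝ g (toL2 1) / I 1) • toL2 1 := by
  rw [← sub_eq_zero]
  refine eq_zero_of_inner_mode_eq_zero fun m n θ P => ?_
  rw [inner_sub_left, inner_smul_left, inner_toL2, one_mul, conj_trivial]
  by_cases hmn : (m, n) = 0
  · obtain ⟨rfl, rfl⟩ := Prod.mk_eq_zero.1 hmn
    have h := h2 (P - Polynomial.C (I (polyZ P) / I 1)) (by
      rw [polyZ_sub, polyZ_C, map_sub, map_smul, smul_eq_mul,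
        div_mul_cancel₀ _ I_one_pos.ne', sub_self])
    rw [polyZ_sub, polyZ_C, map_sub, map_smul, inner_sub_right, inner_smul_right] at h
    rw [mode_zero_zero, smul_mul_assoc, one_mul, map_smul, map_smul, inner_smul_right,
      smul_eq_mul]
    linear_combination Real.cos θ * h
  · rw [h1 m n hmn, I_mode_mul hmn, mul_zero, sub_zero]

/-- A field orthogonal to the forces of all classical solutions is one of the constant fields
`(a, b, 0)`, and it vanishes if `β > 0`. -/
theorem eq_const_of_inner_force_eq_zero {β : ℝ} (hβ : 0 ≤ β) {g : Fin 3 → L2}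
    (h : ∀ u q, IsAdmissible β u → ∑ j, inner ℝ (g j) (toL2 (force u q j)) = 0) :
    ∃ a : Fin 3 → ℝ, a 2 = 0 ∧ (0 < β → a = 0) ∧ ∀ j, g j = a j • toL2 1 := by
  have hk2 : ∀ m n : ℤ, (m, n) ≠ 0 → ∀ θ P, inner ℝ (g 2) (toL2 (mode m n θ * polyZ P)) = 0 := by
    intro m n hmn θ P
    obtain ⟨u, q, hu, hf⟩ := exists_longitudinal hβ hmn (θ - π / 2) 0 P
    have h1 := h u q hu
    have h0 : polyZ 0 = 0 := by
      refine Smooth.ext_apply fun p => ?_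
      change (0 : Polynomial ℝ).eval p.2.2 = 0
      simp
    rw [hf, Fin.sum_univ_three] at h1
    simpa [h0] using h1
  have hk : ∀ m n : ℤ, (m, n) ≠ 0 → ∀ θ P j, inner ℝ (g j) (toL2 (mode m n θ * polyZ P)) = 0 := by
    intro m n hmn θ P
    obtain ⟨u, q, hu, hf⟩ := exists_longitudinal hβ hmn θ P 0
    obtain ⟨u', hu', hf'⟩ := exists_transverse hβ hmn θ P
    have h1 := h u q hu
    have h2 := h u' 0 hu'
    rw [hf, Fin.sum_univ_three] at h1
    rw [hf', Fin.sum_univ_three] at h2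
    simp only [Matrix.cons_val_zero, Matrix.cons_val_one, Matrix.cons_val, map_smul,
      inner_smul_right, map_zero, inner_zero_right, hk2 m n hmn, add_zero] at h1 h2
    set x := inner ℝ (g 0) (toL2 (mode m n θ * polyZ P))
    set y := inner ℝ (g 1) (toL2 (mode m n θ * polyZ P))
    have hk := (sq_add_sq_pos hmn).ne'
    have hx : x = 0 := by
      have : ((m : ℝ) ^ 2 + (n : ℝ) ^ 2) * x = 0 := by linear_combination m * h1 - n * h2
      exact (mul_eq_zero.1 this).resolve_left hk
    have hy : y = 0 := by
      have : ((m : ℝ) ^ 2 + (n : ℝ) ^ 2) * y = 0 := by linear_combination n * h1 + m * h2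
      exact (mul_eq_zero.1 this).resolve_left hk
    intro j
    fin_cases j
    · exact hx
    · exact hy
    · exact hk2 m n hmn θ P
  have hz2 : ∀ P, inner ℝ (g 2) (toL2 (polyZ P)) = 0 := by
    intro P
    obtain ⟨R, hR⟩ := exists_derivative_eq P
    have h1 := h 0 (polyZ R) (isAdmissible_zero β)
    have h2 : force 0 (polyZ R) = ![0, 0, polyZ P] := by
      funext j
      fin_cases j
      · change -lap 0 + D 0 (polyZ R) = 0
        rw [map_zero, neg_zero, zero_add]; exact D_ofZ (by decide) _
      · change -lap 0 + D 1 (polyZ R) = 0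
        rw [map_zero, neg_zero, zero_add]; exact D_ofZ (by decide) _
      · change -lap 0 + D 2 (polyZ R) = polyZ P
        rw [map_zero, neg_zero, zero_add, D_two_polyZ, hR]
    rw [h2, Fin.sum_univ_three] at h1
    simpa using h1
  have hzj : ∀ j, j ≠ 2 → ∀ P, (β = 0 → I (polyZ P) = 0) →
      inner ℝ (g j) (toL2 (polyZ P)) = 0 := by
    intro j hj P hP
    obtain ⟨u, hu, hf⟩ := exists_horizontal hβ hj P hP
    have h1 := h u 0 hu
    rw [hf, Finset.sum_eq_single j] at h1
    · rwa [Pi.single_eq_same] at h1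
    · intro i _ hi
      rw [Pi.single_eq_of_ne hi, map_zero, inner_zero_right]
    · simp
  have fin : ∀ (f : L2), (∀ m n : ℤ, (m, n) ≠ 0 → ∀ θ P,
      inner ℝ f (toL2 (mode m n θ * polyZ P)) = 0) →
      (∀ P, inner ℝ f (toL2 (polyZ P)) = 0) → f = 0 := by
    intro f h1 h2
    refine eq_zero_of_inner_mode_eq_zero fun m n θ P => ?_
    by_cases hmn : (m, n) = 0
    · obtain ⟨rfl, rfl⟩ := Prod.mk_eq_zero.1 hmn
      rw [mode_zero_zero, smul_mul_assoc, one_mul, map_smul, inner_smul_right, h2, mul_zero]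
    · exact h1 m n hmn θ P
  have hg2 : g 2 = 0 := fin _ (fun m n hmn θ P => hk m n hmn θ P 2) hz2
  rcases hβ.eq_or_lt with hb | hb
  · refine ⟨fun j => if j = 2 then 0 else inner ℝ (g j) (toL2 1) / I 1, by simp,
      fun hc => absurd hc (by rw [← hb]; exact lt_irrefl _), fun j => ?_⟩
    by_cases hj : j = 2
    · subst hj; simpa using hg2
    · change g j = (if j = 2 then 0 else inner ℝ (g j) (toL2 1) / I 1) • toL2 1
      rw [if_neg hj]
      exact eq_mean_smul_one (fun m n hmn θ P => hk m n hmn θ P j) fun P hP =>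
        hzj j hj P fun _ => hP
  · refine ⟨0, rfl, fun _ => rfl, fun j => ?_⟩
    rw [Pi.zero_apply, zero_smul]
    by_cases hj : j = 2
    · subst hj; exact hg2
    · exact fin _ (fun m n hmn θ P => hk m n hmn θ P j)
        (fun P => hzj j hj P fun hc => absurd hc hb.ne')

/-! ### The a priori estimate for classical solutions -/

/-- Horizontal derivatives are tangential to `Γ`. -/
theorem slice_D_eq_zero {i : Fin 3} (hi : i ≠ 2) {z : ℝ} {φ : Smooth} (h : slice z φ = 0) :
    slice z (D i φ) = 0 := by
  funext y
  obtain ⟨x, y⟩ := y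
  have h' : ∀ x y : Torus, φ.1 (x, y, z) = 0 := fun x y => congrFun h (x, y)
  fin_cases i
  · induction x using QuotientAddGroup.induction_on with
    | H x =>
      have h1 := φ.hasDerivAt_x y z x
      simp only [h'] at h1
      exact h1.unique (hasDerivAt_const x 0)
  · induction y using QuotientAddGroup.induction_on with
    | H y =>
      have h1 := φ.hasDerivAt_y x z y
      simp only [h'] at h1
      exact h1.unique (hasDerivAt_const y 0)
  · exact absurd rfl hi

theorem VanishesOnBoundary.D {i : Fin 3} (hi : i ≠ 2) {φ : Smooth} (h : VanishesOnBoundary φ) :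
    VanishesOnBoundary (D i φ) := ⟨slice_D_eq_zero hi h.1, slice_D_eq_zero hi h.2⟩

theorem VanishesOnBoundary.neg {φ : Smooth} (h : VanishesOnBoundary φ) :
    VanishesOnBoundary (-φ) := by
  constructor
  · rw [slice_neg, h.1, neg_zero]
  · rw [slice_neg, h.2, neg_zero]

theorem B_mul_eq_zero {z : ℝ} (φ : Smooth) {ψ : Smooth} (h : slice z ψ = 0) : B z (φ * ψ) = 0 := by
  rw [← map_zero (B z)]
  exact B_congr (by rw [slice_mul, h, mul_zero]; rfl)

/-- Green's formula for `∫ ∇q · v`. -/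
theorem sum_I_D_mul (q : Smooth) {v : Fin 3 → Smooth} (hv : ∑ i, D i (v i) = 0) :
    ∑ j, I (D j q * v j) = B 1 (q * v 2) - B (-1) (q * v 2) := by
  have h : I (q * ∑ i, D i (v i)) = 0 := by rw [hv, mul_zero, map_zero]
  rw [Fin.sum_univ_three, mul_add, mul_add, map_add, map_add] at h
  rw [Fin.sum_univ_three, I_D_mul_horizontal (by decide), I_D_mul_horizontal (by decide),
    I_D_mul_two]
  linarith

theorem sum_I_D_mul_eq_zero (q : Smooth) {v : Fin 3 → Smooth} (hv : ∑ i, D i (v i) = 0)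
    (h2 : VanishesOnBoundary (v 2)) : ∑ j, I (D j q * v j) = 0 := by
  rw [sum_I_D_mul q hv, B_mul_eq_zero _ h2.1, B_mul_eq_zero _ h2.2, sub_zero]

/-- Green's formula for the Laplacian. -/
theorem I_neg_lap_mul (φ ψ : Smooth) : I (-lap φ * ψ) =
    ∑ i, I (D i φ * D i ψ) - (B 1 (D 2 φ * ψ) - B (-1) (D 2 φ * ψ)) := by
  rw [lap_apply, Fin.sum_univ_three, Fin.sum_univ_three, Smooth.neg_mul, map_neg, add_mul, add_mul,
    map_add, map_add, I_D_mul_horizontal (i := 0) (by decide) (D 0 φ),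
    I_D_mul_horizontal (i := 1) (by decide) (D 1 φ), I_D_mul_two]
  ring

theorem IsAdmissible.B_top {β : ℝ} {u : Fin 3 → Smooth} (hu : IsAdmissible β u)
    {j : Fin 3} (hj : j ≠ 2) (ψ : Smooth) : B 1 (D 2 (u j) * ψ) = -(β * B 1 (u j * ψ)) := by
  rw [← neg_mul, ← smul_eq_mul (-β), ← map_smul (B 1)]
  refine B_congr ?_
  have h : slice 1 (D 2 (u j)) = (-β) • slice 1 (u j) := by
    rw [neg_smul]; exact eq_neg_of_add_eq_zero_left (hu.robin_top j hj)
  rw [slice_mul, h, smul_mul_assoc]; rfl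

theorem IsAdmissible.B_bot {β : ℝ} {u : Fin 3 → Smooth} (hu : IsAdmissible β u)
    {j : Fin 3} (hj : j ≠ 2) (ψ : Smooth) : B (-1) (D 2 (u j) * ψ) = β * B (-1) (u j * ψ) := by
  rw [← smul_eq_mul β, ← map_smul (B (-1))]
  refine B_congr ?_
  have h : slice (-1) (D 2 (u j)) = β • slice (-1) (u j) := by
    rw [← sub_eq_zero, ← neg_eq_zero, ← hu.robin_bot j hj]; abel
  rw [slice_mul, h, smul_mul_assoc]; rfl

/-- The energy identity: the momentum equation tested with a solenoidal field that is tangential on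
`Γ`. -/
theorem IsAdmissible.energy {β : ℝ} {u : Fin 3 → Smooth} (hu : IsAdmissible β u) (q : Smooth)
    {v : Fin 3 → Smooth} (hv : ∑ i, D i (v i) = 0) (h2 : VanishesOnBoundary (v 2)) :
    ∑ j, I (force u q j * v j) = ∑ j, ∑ i, I (D i (u j) * D i (v j)) +
      β * (B 1 (u 0 * v 0) + B (-1) (u 0 * v 0) + (B 1 (u 1 * v 1) + B (-1) (u 1 * v 1))) := by
  have hp := sum_I_D_mul_eq_zero q hv h2
  have e : ∀ j, I (force u q j * v j) = I (-lap (u j) * v j) + I (D j q * v j) := fun j => by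
    rw [force, add_mul, map_add]
  simp only [e, Finset.sum_add_distrib, hp, I_neg_lap_mul, add_zero]
  rw [Finset.sum_sub_distrib, Fin.sum_univ_three (fun j => B 1 _ - B (-1) _),
    hu.B_top (by decide), hu.B_top (by decide), hu.B_bot (by decide), hu.B_bot (by decide),
    B_mul_eq_zero _ h2.1, B_mul_eq_zero _ h2.2]
  ring

/-- The quadratic inequality that turns energy identities into estimates. -/
theorem le_of_sq_le_mul_sum {x : Fin 3 → ℝ} {G K N : ℝ} (hG : 0 ≤ G) (hK : 0 ≤ K)
    (hx : ∀ j, x j ^ 2 ≤ K * G) (h : G ≤ N * ∑ j, x j) : G ≤ 9 * K * N ^ 2 := by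
  rcases hG.eq_or_lt with h0 | h0
  · rw [← h0]; positivity
  rw [Fin.sum_univ_three] at h
  have h1 : G ^ 2 ≤ (N * (x 0 + x 1 + x 2)) ^ 2 := pow_le_pow_left₀ hG h 2
  have h2 : (x 0 + x 1 + x 2) ^ 2 ≤ 9 * (K * G) := by
    nlinarith [sq_nonneg (x 0 - x 1), sq_nonneg (x 1 - x 2), sq_nonneg (x 0 - x 2), hx 0, hx 1,
      hx 2]
  have h3 : G * G ≤ (9 * K * N ^ 2) * G := by
    calc G * G = G ^ 2 := (sq G).symm
      _ ≤ N ^ 2 * (x 0 + x 1 + x 2) ^ 2 := by rw [← mul_pow]; exact h1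
      _ ≤ N ^ 2 * (9 * (K * G)) := by gcongr
      _ = _ := by ring
  exact le_of_mul_le_mul_right h3 h0

theorem B_sq_nonneg (φ : Smooth) : 0 ≤ B 1 (φ * φ) + B (-1) (φ * φ) :=
  add_nonneg (B_nonneg fun p => mul_self_nonneg (φ.1 p)) (B_nonneg fun p => mul_self_nonneg (φ.1 p))

/-- Second derivatives with at least one horizontal direction, by testing with
`-∂_a² u`. -/
theorem IsAdmissible.norm_D_D_le {β : ℝ} (hβ : 0 ≤ β) {u : Fin 3 → Smooth} (hu : IsAdmissible β u)
    (q : Smooth) {N : ℝ} (hN : ∀ j, ‖toL2 (force u q j)‖ ≤ N) {a : Fin 3} (ha : a ≠ 2)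
    (i j : Fin 3) : ‖toL2 (D a (D i (u j)))‖ ≤ 3 * N := by
  have hN0 : 0 ≤ N := (norm_nonneg _).trans (hN 0)
  set G := ∑ j, ∑ i, ‖toL2 (D a (D i (u j)))‖ ^ 2 with hG
  have hle : ∀ i j, ‖toL2 (D a (D i (u j)))‖ ^ 2 ≤ G := by
    intro i j
    exact (Finset.single_le_sum (f := fun i => ‖toL2 (D a (D i (u j)))‖ ^ 2)
      (fun _ _ => sq_nonneg _) (Finset.mem_univ i)).trans
      (Finset.single_le_sum (f := fun j => ∑ i, ‖toL2 (D a (D i (u j)))‖ ^ 2)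
        (fun _ _ => Finset.sum_nonneg fun _ _ => sq_nonneg _) (Finset.mem_univ j))
  have hv : ∑ i, D i (-D a (D a (u i))) = 0 := by
    have : ∀ i, D i (-D a (D a (u i))) = -D a (D a (D i (u i))) := fun i => by
      rw [map_neg, D_comm i a, D_comm i a]
    simp only [this, Finset.sum_neg_distrib, ← map_sum, hu.div, map_zero, neg_zero]
  have he := hu.energy q (v := fun j => -D a (D a (u j))) hv ((hu.vanish.D ha).D ha).neg
  have e1 : ∀ i j, I (D i (u j) * D i (-D a (D a (u j)))) = ‖toL2 (D a (D i (u j)))‖ ^ 2 := by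
    intro i j
    rw [norm_toL2_sq, I_D_mul_horizontal ha, map_neg, D_comm i a, D_comm i a, Smooth.mul_neg,
      map_neg]
  have e2 : ∀ j, B 1 (u j * -D a (D a (u j))) + B (-1) (u j * -D a (D a (u j))) =
      B 1 (D a (u j) * D a (u j)) + B (-1) (D a (u j) * D a (u j)) := by
    intro j
    have h := B_D_horizontal ha (u j * D a (u j))
    simp only [D_mul, map_add] at h
    rw [Smooth.mul_neg, map_neg, map_neg]
    linarith [h.1, h.2]
  simp only [e1] at he
  rw [e2, e2, ← hG] at he
  have h1 : G ≤ N * ∑ j, ‖toL2 (D a (D a (u j)))‖ := by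
    have h2 : G ≤ ∑ j, I (force u q j * -D a (D a (u j))) := by
      rw [he]
      exact le_add_of_nonneg_right
        (mul_nonneg hβ (add_nonneg (B_sq_nonneg _) (B_sq_nonneg _)))
    refine h2.trans ?_
    rw [Finset.mul_sum]
    refine Finset.sum_le_sum fun j _ => ?_
    refine (le_abs_self _).trans ((abs_I_mul_le _ _).trans ?_)
    rw [map_neg, norm_neg]
    gcongr
    exact hN j
  have h3 : G ≤ 9 * 1 * N ^ 2 := le_of_sq_le_mul_sum
    (Finset.sum_nonneg fun _ _ => Finset.sum_nonneg fun _ _ => sq_nonneg _) zero_le_one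
    (fun j => by rw [one_mul]; exact hle a j) h1
  refine abs_le_of_sq_le_sq' (b := 3 * N) ?_ (by positivity) |>.2
  exact (hle i j).trans (h3.trans (by nlinarith))

/-- The energy estimate: the velocity and its first derivatives. -/
theorem exists_energy_estimate {β : ℝ} (hβ : 0 ≤ β) : ∃ C : ℝ, 0 < C ∧
    ∀ (u : Fin 3 → Smooth) (q : Smooth) (N : ℝ), IsAdmissible β u →
      (β = 0 → ∀ j, j ≠ 2 → I (u j) = 0) → (∀ j, ‖toL2 (force u q j)‖ ≤ N) →
      (∀ j, ‖toL2 (u j)‖ ≤ C * N) ∧ ∀ i j, ‖toL2 (D i (u j))‖ ≤ C * N := by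
  obtain ⟨P, hP0, hP⟩ := exists_poincare
  -- for `β > 0` the friction controls the mean; for `β = 0` the term `2 / β` is `0` and the
  -- Poincaré constant `P` does
  set K := 2 / β + 4 + P
  have hK1 : 1 ≤ K := by
    have : 0 ≤ 2 / β := by positivity
    linarith
  refine ⟨3 * K, by positivity, fun u q N hu hm hN => ?_⟩
  have hN0 : 0 ≤ N := (norm_nonneg _).trans (hN 0)
  set S := ∑ j, ∑ i, ‖toL2 (D i (u j))‖ ^ 2 with hS
  set b0 := B 1 (u 0 * u 0) + B (-1) (u 0 * u 0)
  set b1 := B 1 (u 1 * u 1) + B (-1) (u 1 * u 1)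
  have hb0 : 0 ≤ b0 := B_sq_nonneg _
  have hb1 : 0 ≤ b1 := B_sq_nonneg _
  have he := hu.energy q hu.div hu.vanish
  simp only [← norm_toL2_sq] at he
  rw [← hS] at he
  have hS0 : 0 ≤ S := Finset.sum_nonneg fun _ _ => Finset.sum_nonneg fun _ _ => sq_nonneg _
  have hsum : ∀ j, ∑ i, ‖toL2 (D i (u j))‖ ^ 2 ≤ S := fun j =>
    Finset.single_le_sum (f := fun j => ∑ i, ‖toL2 (D i (u j))‖ ^ 2)
        (fun _ _ => Finset.sum_nonneg fun _ _ => sq_nonneg _) (Finset.mem_univ j)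
  have hle : ∀ i j, ‖toL2 (D i (u j))‖ ^ 2 ≤ S := fun i j =>
    (Finset.single_le_sum (f := fun i => ‖toL2 (D i (u j))‖ ^ 2)
      (fun _ _ => sq_nonneg _) (Finset.mem_univ i)).trans (hsum j)
  set G := S + β * (b0 + b1)
  have hGS : S ≤ G := le_add_of_nonneg_right (mul_nonneg hβ (add_nonneg hb0 hb1))
  have hG0 : 0 ≤ G := hS0.trans hGS
  have hpos : ∀ j, j ≠ 2 → B 1 (u j * u j) + B (-1) (u j * u j) ≤ b0 + b1 := by
    intro j hj
    fin_cases j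
    · exact le_add_of_nonneg_right hb1
    · exact le_add_of_nonneg_left hb0
    · exact absurd rfl hj
  have hx : ∀ j, ‖toL2 (u j)‖ ^ 2 ≤ K * G := by
    intro j
    by_cases hj : j = 2
    · subst hj
      have h := norm_sq_le_B (u 2)
      rw [B_mul_eq_zero _ hu.vanish.1, B_mul_eq_zero _ hu.vanish.2] at h
      have := hle 2 2
      have h4 : 4 ≤ K := by
        have : 0 ≤ 2 / β := by positivity
        linarith
      nlinarith
    · rcases hβ.eq_or_lt with hb | hb
      · have h1 := hP (u j) (hm hb.symm j hj)
        have h2 : P * ∑ i, ‖toL2 (D i (u j))‖ ^ 2 ≤ P * G := by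
          gcongr
          exact (hsum j).trans hGS
        have h3 : P ≤ K := by
          have : 0 ≤ 2 / β := by positivity
          linarith
        nlinarith
      · have h1 := norm_sq_le_B (u j)
        have h2 := hpos j hj
        have h3 := hle 2 j
        have h4 : b0 + b1 ≤ G / β := by
          rw [le_div_iff₀ hb]
          nlinarith
        calc ‖toL2 (u j)‖ ^ 2 ≤ 2 * (G / β) + 4 * G := by linarith
          _ = (2 / β + 4) * G := by ring
          _ ≤ K * G := by
            apply mul_le_mul_of_nonneg_right _ hG0
            linarith
  have hmain : G ≤ N * ∑ j, ‖toL2 (u j)‖ := by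
    rw [← he, Finset.mul_sum]
    refine Finset.sum_le_sum fun j _ => ?_
    refine (le_abs_self _).trans ((abs_I_mul_le _ _).trans ?_)
    gcongr
    exact hN j
  have hfin := le_of_sq_le_mul_sum hG0 (by linarith) hx hmain
  constructor
  · intro j
    refine (abs_le_of_sq_le_sq' (b := 3 * K * N) ?_ (by positivity)).2
    calc ‖toL2 (u j)‖ ^ 2 ≤ K * G := hx j
      _ ≤ K * (9 * K * N ^ 2) := by gcongr
      _ = (3 * K * N) ^ 2 := by ring
  · intro i j
    refine (abs_le_of_sq_le_sq' (b := 3 * K * N) ?_ (by positivity)).2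
    calc ‖toL2 (D i (u j))‖ ^ 2 ≤ 9 * K * N ^ 2 := (hle i j).trans (hGS.trans hfin)
      _ ≤ 9 * (K * K) * N ^ 2 := by gcongr; nlinarith
      _ = (3 * K * N) ^ 2 := by ring

theorem IsAdmissible.D_two_two {β : ℝ} {u : Fin 3 → Smooth} (hu : IsAdmissible β u) :
    D 2 (u 2) = -(D 0 (u 0) + D 1 (u 1)) := by
  have := hu.div
  rw [Fin.sum_univ_three] at this
  exact eq_neg_of_add_eq_zero_right this

/-- The remaining second derivative of `u_2`, from `∇ · u = 0`. -/
theorem IsAdmissible.norm_D_two_D_two_two_le {β : ℝ} (hβ : 0 ≤ β) {u : Fin 3 → Smooth}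
    (hu : IsAdmissible β u) (q : Smooth) {N : ℝ} (hN : ∀ j, ‖toL2 (force u q j)‖ ≤ N) :
    ‖toL2 (D 2 (D 2 (u 2)))‖ ≤ 6 * N := by
  rw [hu.D_two_two, map_neg, map_add, D_comm 2 0, D_comm 2 1, map_neg, norm_neg, map_add]
  refine (norm_add_le _ _).trans ?_
  have h1 := hu.norm_D_D_le hβ q hN (a := 0) (by decide) 2 0
  have h2 := hu.norm_D_D_le hβ q hN (a := 1) (by decide) 2 1
  linarith

/-- The pressure sees the friction through a boundary term `∫_Γ q ∇_h · u`, in which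
`∇_h · u = -∂_z u_2`. -/
theorem IsAdmissible.sum_I_D_mul_lap {β : ℝ} {u : Fin 3 → Smooth} (hu : IsAdmissible β u)
    (q : Smooth) :
    ∑ j, I (D j q * lap (u j)) =
      -(β * (B 1 (q * D 2 (u 2)) + B (-1) (q * D 2 (u 2)))) := by
  have hdiv : ∑ i, D i (lap (u i)) = 0 := by
    simp only [D_lap]
    rw [← map_sum, hu.div, map_zero]
  rw [sum_I_D_mul q hdiv]
  have hl : ∀ z, slice z (u 2) = 0 → slice z (lap (u 2)) =
      -(slice z (D 0 (D 2 (u 0))) + slice z (D 1 (D 2 (u 1)))) := by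
    intro z hz
    rw [lap_apply, Fin.sum_univ_three, slice_add, slice_add,
      slice_D_eq_zero (i := 0) (by decide) (slice_D_eq_zero (by decide) hz),
      slice_D_eq_zero (i := 1) (by decide) (slice_D_eq_zero (by decide) hz), hu.D_two_two,
      map_neg, map_add, D_comm 2 0, D_comm 2 1, slice_neg, slice_add, zero_add, zero_add]
  have ht : ∀ j, j ≠ 2 → slice 1 (D j (D 2 (u j))) = -β • slice 1 (D j (u j)) := by
    intro j hj
    have h := slice_D_eq_zero hj (φ := D 2 (u j) + β • u j) (hu.robin_top j hj)
    rw [map_add, map_smul, slice_add, slice_smul] at h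
    rw [neg_smul]; exact eq_neg_of_add_eq_zero_left h
  have hb : ∀ j, j ≠ 2 → slice (-1) (D j (D 2 (u j))) = β • slice (-1) (D j (u j)) := by
    intro j hj
    have h := slice_D_eq_zero hj (φ := -D 2 (u j) + β • u j) (hu.robin_bot j hj)
    rw [map_add, map_smul, map_neg, slice_add, slice_smul, slice_neg] at h
    rw [← sub_eq_zero, ← neg_eq_zero, ← h]; abel
  have h1 : B 1 (q * lap (u 2)) = -(β * B 1 (q * D 2 (u 2))) := by
    rw [← neg_mul, ← smul_eq_mul (-β), ← map_smul (B 1)]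
    refine B_congr ?_
    rw [slice_smul, slice_mul, slice_mul, hl 1 hu.vanish.1, ht 0 (by decide), ht 1 (by decide),
      hu.D_two_two, slice_neg, slice_add, ← mul_smul_comm]
    congr 1
    rw [← smul_add, neg_smul, neg_smul, smul_neg]
  have h2 : B (-1) (q * lap (u 2)) = β * B (-1) (q * D 2 (u 2)) := by
    rw [← smul_eq_mul β, ← map_smul (B (-1))]
    refine B_congr ?_
    rw [slice_smul, slice_mul, slice_mul, hl (-1) hu.vanish.2, hb 0 (by decide), hb 1 (by decide),
      hu.D_two_two, slice_neg, slice_add, ← mul_smul_comm]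
    congr 1
    rw [← smul_add, smul_neg]
  rw [h1, h2]; ring

/-- The `H²` estimate for classical solutions. The pressure gradient is bounded by testing with
`∇q`, where the boundary term is controlled by the horizontal second derivatives; the equation
then gives `∂_z² u_0` and `∂_z² u_1`. -/
theorem exists_apriori {β : ℝ} (hβ : 0 ≤ β) : ∃ C : ℝ, 0 < C ∧
    ∀ (u : Fin 3 → Smooth) (q : Smooth) (N : ℝ), IsAdmissible β u →
      (β = 0 → ∀ j, j ≠ 2 → I (u j) = 0) → I q = 0 → (∀ j, ‖toL2 (force u q j)‖ ≤ N) →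
      (∀ j, ‖toL2 (u j)‖ ≤ C * N) ∧ (∀ i j, ‖toL2 (D i (u j))‖ ≤ C * N) ∧
      (∀ k i j, ‖toL2 (D k (D i (u j)))‖ ≤ C * N) ∧
      ‖toL2 q‖ ≤ C * N ∧ ∀ i, ‖toL2 (D i q)‖ ≤ C * N := by
  obtain ⟨P, hP0, hP⟩ := exists_poincare
  obtain ⟨A, hA0, hA⟩ := exists_energy_estimate hβ
  -- the constant in `‖∇q‖ ≤ E N`
  set E := 3 + β * (√P * A + (A + √P * 6)) with hE
  refine ⟨A + √P * E + E + 7, by positivity, fun u q N hu hm hq hN => ?_⟩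
  have hN0 : 0 ≤ N := (norm_nonneg _).trans (hN 0)
  obtain ⟨hu0, hu1⟩ := hA u q N hu hm hN
  set Q := √(∑ j, ‖toL2 (D j q)‖ ^ 2) with hQ
  have hQ2 : Q ^ 2 = ∑ j, ‖toL2 (D j q)‖ ^ 2 :=
    Real.sq_sqrt (Finset.sum_nonneg fun _ _ => sq_nonneg _)
  have hQ0 : 0 ≤ Q := Real.sqrt_nonneg _
  have hDq : ∀ j, ‖toL2 (D j q)‖ ≤ Q := fun j =>
    Real.le_sqrt_of_sq_le (Finset.single_le_sum (f := fun j => ‖toL2 (D j q)‖ ^ 2)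
      (fun _ _ => sq_nonneg _) (Finset.mem_univ j))
  have hq0 : ‖toL2 q‖ ≤ √P * Q := by
    rw [hQ, ← Real.sqrt_mul hP0.le]
    exact Real.le_sqrt_of_sq_le (hP q hq)
  have h22 := hu.norm_D_two_D_two_two_le hβ q hN
  have hQE : Q ≤ E * N := by
    have e1 : Q ^ 2 = ∑ j, I (D j q * force u q j) + ∑ j, I (D j q * lap (u j)) := by
      rw [hQ2, ← Finset.sum_add_distrib]
      refine Finset.sum_congr rfl fun j _ => ?_
      rw [norm_toL2_sq, ← map_add, ← mul_add, force]
      congr 2; abel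
    have e2 : ∑ j, I (D j q * force u q j) ≤ 3 * (Q * N) := by
      calc ∑ j, I (D j q * force u q j) ≤ ∑ _j : Fin 3, Q * N := by
            refine Finset.sum_le_sum fun j _ => ?_
            refine (le_abs_self _).trans ((abs_I_mul_le _ _).trans ?_)
            exact mul_le_mul (hDq j) (hN j) (norm_nonneg _) hQ0
        _ = 3 * (Q * N) := by simp
    have e3 : -(B 1 (q * D 2 (u 2)) + B (-1) (q * D 2 (u 2))) ≤
        (√P * Q) * (A * N) + (Q * (A * N) + (√P * Q) * (6 * N)) := by
      rw [B_add_B, D_mul, mul_add, map_add]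
      have i1 := (neg_le_abs _).trans (abs_I_mul_le q (D 2 (u 2)))
      have i2 := (neg_le_abs _).trans (abs_I_coordZ_mul_mul_le (D 2 q) (D 2 (u 2)))
      have i3 := (neg_le_abs _).trans (abs_I_coordZ_mul_mul_le q (D 2 (D 2 (u 2))))
      have j1 : ‖toL2 q‖ * ‖toL2 (D 2 (u 2))‖ ≤ (√P * Q) * (A * N) :=
        mul_le_mul hq0 (hu1 2 2) (norm_nonneg _) (by positivity)
      have j2 : ‖toL2 (D 2 q)‖ * ‖toL2 (D 2 (u 2))‖ ≤ Q * (A * N) :=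
        mul_le_mul (hDq 2) (hu1 2 2) (norm_nonneg _) hQ0
      have j3 : ‖toL2 q‖ * ‖toL2 (D 2 (D 2 (u 2)))‖ ≤ (√P * Q) * (6 * N) :=
        mul_le_mul hq0 h22 (norm_nonneg _) (by positivity)
      linarith
    rw [hu.sum_I_D_mul_lap, ← mul_neg] at e1
    have e4 : Q * Q ≤ (E * N) * Q := by
      calc Q * Q = Q ^ 2 := (sq Q).symm
        _ ≤ 3 * (Q * N) + β * ((√P * Q) * (A * N) + (Q * (A * N) + (√P * Q) * (6 * N))) := by
          rw [e1]
          exact add_le_add e2 (mul_le_mul_of_nonneg_left e3 hβ)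
        _ = (E * N) * Q := by rw [hE]; ring
    rcases hQ0.eq_or_lt with h0 | h0
    · rw [← h0]; positivity
    · exact le_of_mul_le_mul_right e4 h0
  have hAN : 0 ≤ A * N := by positivity
  have hEN : 0 ≤ E * N := by positivity
  have hPEN : 0 ≤ √P * E * N := by positivity
  have hC : (A + √P * E + E + 7) * N = A * N + √P * E * N + E * N + 7 * N := by ring
  have h2 : ∀ k i j, ‖toL2 (D k (D i (u j)))‖ ≤ E * N + 7 * N := by
    intro k i j
    by_cases hk : k = 2
    · by_cases hi : i = 2
      · subst hk hi
        by_cases hj : j = 2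
        · subst hj; linarith
        · have e : D 2 (D 2 (u j)) =
              D j q - force u q j - D 0 (D 0 (u j)) - D 1 (D 1 (u j)) := by
            rw [force, lap_apply, Fin.sum_univ_three]; abel
          rw [e, map_sub, map_sub, map_sub]
          have n1 := norm_sub_le (toL2 (D j q) - toL2 (force u q j) - toL2 (D 0 (D 0 (u j))))
            (toL2 (D 1 (D 1 (u j))))
          have n2 := norm_sub_le (toL2 (D j q) - toL2 (force u q j)) (toL2 (D 0 (D 0 (u j))))
          have n3 := norm_sub_le (toL2 (D j q)) (toL2 (force u q j))
          have m1 := hu.norm_D_D_le hβ q hN (a := 1) (by decide) 1 j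
          have m2 := hu.norm_D_D_le hβ q hN (a := 0) (by decide) 0 j
          linarith [hDq j, hN j]
      · rw [D_comm]
        have := hu.norm_D_D_le hβ q hN hi k j
        linarith
    · have := hu.norm_D_D_le hβ q hN hk i j
      linarith
  rw [hC]
  refine ⟨fun j => by linarith [hu0 j], fun i j => by linarith [hu1 i j],
    fun k i j => by linarith [h2 k i j], ?_, fun i => by linarith [hDq i]⟩
  have : √P * Q ≤ √P * (E * N) := by gcongr
  linarith

/-! ### Components of square integrable vector fields -/

/-- The component map as a continuous linear map. -/
def compL (i : Fin 3) : L2V →L[ℝ] L2 :=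
  (EuclideanSpace.proj i : R3 →L[ℝ] ℝ).compLpL 2 volOmega

theorem compL_apply (i : Fin 3) (u : L2V) : compL i u = comp i u := rfl

theorem comp_add (i : Fin 3) (u v : L2V) : comp i (u + v) = comp i u + comp i v :=
  map_add (compL i) u v

theorem comp_neg (i : Fin 3) (u : L2V) : comp i (-u) = -comp i u := map_neg (compL i) u

theorem comp_smul (i : Fin 3) (c : ℝ) (u : L2V) : comp i (c • u) = c • comp i u :=
  map_smul (compL i) c u

theorem comp_zero (i : Fin 3) : comp i (0 : L2V) = 0 := map_zero (compL i)

theorem coeFn_comp (i : Fin 3) (u : L2V) : ∀ᵐ p ∂volOmega, comp i u p = u p i :=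
  ContinuousLinearMap.coeFn_compLp _ u

theorem ext_comp {u v : L2V} (h : ∀ i, comp i u = comp i v) : u = v := by
  apply Lp.ext
  have hu := ae_all_iff.2 fun i => coeFn_comp i u
  have hv := ae_all_iff.2 fun i => coeFn_comp i v
  filter_upwards [hu, hv] with p h1 h2
  ext i
  rw [← h1, ← h2, h]

theorem comp_ofComp (i : Fin 3) (g : Fin 3 → L2) : comp i (ofComp g) = g i := by
  have h : ∀ k, comp i ((ContinuousLinearMap.toSpanSingleton ℝ
      (EuclideanSpace.single k (1 : ℝ) : R3)).compLp (g k)) = if i = k then g k else 0 := by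
    intro k
    have h1 := coeFn_comp i ((ContinuousLinearMap.toSpanSingleton ℝ
      (EuclideanSpace.single k (1 : ℝ) : R3)).compLp (g k))
    have h2 := (ContinuousLinearMap.toSpanSingleton ℝ
      (EuclideanSpace.single k (1 : ℝ) : R3)).coeFn_compLp (g k)
    by_cases hik : i = k
    · rw [if_pos hik]
      apply Lp.ext
      filter_upwards [h1, h2] with p e1 e2
      rw [e1, e2]
      simp [hik]
    · rw [if_neg hik]
      apply Lp.ext
      filter_upwards [h1, h2, Lp.coeFn_zero ℝ 2 volOmega] with p e1 e2 e3
      rw [e1, e2, e3]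
      simp [hik]
  rw [ofComp, ← compL_apply, map_sum]
  simp only [compL_apply, h]
  simp

theorem inner_eq_sum (u v : L2V) : inner ℝ u v = ∑ i, inner ℝ (comp i u) (comp i v) := by
  have hi : ∀ i, Integrable (fun p => comp i u p * comp i v p) volOmega := fun i =>
    (Lp.memLp (comp i u)).integrable_mul (Lp.memLp (comp i v))
  have e : ∀ i, inner ℝ (comp i u) (comp i v) = ∫ p, comp i u p * comp i v p ∂volOmega := by
    intro i
    rw [L2.inner_def]
    refine integral_congr_ae (Filter.Eventually.of_forall fun p => ?_)
    simp [mul_comm]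
  simp only [e]
  rw [← integral_finsetSum _ fun i _ => hi i, L2.inner_def]
  refine integral_congr_ae ?_
  filter_upwards [ae_all_iff.2 fun i => coeFn_comp i u, ae_all_iff.2 fun i => coeFn_comp i v]
    with p h1 h2
  rw [PiLp.inner_apply]
  refine Finset.sum_congr rfl fun i _ => ?_
  rw [h1, h2]
  simp [mul_comm]

theorem norm_sq_eq_sum (u : L2V) : ‖u‖ ^ 2 = ∑ i, ‖comp i u‖ ^ 2 := by
  rw [← real_inner_self_eq_norm_sq, inner_eq_sum]
  simp only [real_inner_self_eq_norm_sq]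

theorem norm_comp_le (i : Fin 3) (u : L2V) : ‖comp i u‖ ≤ ‖u‖ := by
  refine (abs_le_of_sq_le_sq' ?_ (norm_nonneg _)).2
  rw [norm_sq_eq_sum]
  exact Finset.single_le_sum (f := fun i => ‖comp i u‖ ^ 2) (fun _ _ => sq_nonneg _)
    (Finset.mem_univ i)

/-- A smooth vector field as an element of `L²(Ω)`. -/
def toL2V (v : Fin 3 → Smooth) : L2V := ofComp fun i => toL2 (v i)

theorem comp_toL2V (i : Fin 3) (v : Fin 3 → Smooth) : comp i (toL2V v) = toL2 (v i) :=
  comp_ofComp i _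

theorem inner_toL2V (u : L2V) (v : Fin 3 → Smooth) :
    inner ℝ u (toL2V v) = ∑ i, inner ℝ (comp i u) (toL2 (v i)) := by
  rw [inner_eq_sum]; simp only [comp_toL2V]

/-! ### Calculus of weak derivatives -/

theorem HasWeakDeriv.add {i : Fin 3} {f g f' g' : L2} (h : HasWeakDeriv i f g)
    (h' : HasWeakDeriv i f' g') : HasWeakDeriv i (f + f') (g + g') := by
  rw [hasWeakDeriv_iff] at *
  intro φ hφ
  rw [inner_add_left, inner_add_left, h φ hφ, h' φ hφ]; ring

theorem HasWeakDeriv.smul {i : Fin 3} {f g : L2} (c : ℝ) (h : HasWeakDeriv i f g) :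
    HasWeakDeriv i (c • f) (c • g) := by
  rw [hasWeakDeriv_iff] at *
  intro φ hφ
  rw [inner_smul_left, inner_smul_left, h φ hφ]; ring

theorem hasWeakDeriv_toL2 (i : Fin 3) (φ : Smooth) : HasWeakDeriv i (toL2 φ) (toL2 (D i φ)) := by
  rw [hasWeakDeriv_iff]
  intro ψ hψ
  rw [inner_toL2, inner_toL2]
  by_cases hi : i = 2
  · subst hi
    have hz : ∀ z : ℝ, z ∉ Set.Ioo (-1 : ℝ) 1 → slice z ψ = 0 := by
      intro z hz
      funext y
      by_contra hc
      exact hz (hψ.2.2 (subset_tsupport _ hc) : ((y.1, y.2, z) : Slab) ∈ Omega)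
    rw [I_D_mul_two, B_mul_eq_zero _ (hz 1 (by norm_num)), B_mul_eq_zero _ (hz (-1) (by norm_num))]
    ring
  · rw [I_D_mul_horizontal hi]; ring

theorem hasWeakDeriv_zero (i : Fin 3) : HasWeakDeriv i 0 0 := by
  rw [hasWeakDeriv_iff]; intro φ _; simp

theorem MemH1.add {f g : L2} (hf : MemH1 f) (hg : MemH1 g) : MemH1 (f + g) := fun i =>
  ⟨_, (hf.hasWeakDeriv i).add (hg.hasWeakDeriv i)⟩

theorem MemH1.smul {f : L2} (c : ℝ) (hf : MemH1 f) : MemH1 (c • f) := fun i =>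
  ⟨_, (hf.hasWeakDeriv i).smul c⟩

theorem memH1_zero : MemH1 0 := fun i => ⟨0, hasWeakDeriv_zero i⟩

theorem MemH1.wderiv_add {f g : L2} (hf : MemH1 f) (hg : MemH1 g) (i : Fin 3) :
    wderiv i (f + g) = wderiv i f + wderiv i g :=
  ((hf.hasWeakDeriv i).add (hg.hasWeakDeriv i)).wderiv_eq

theorem MemH1.wderiv_smul {f : L2} (hf : MemH1 f) (c : ℝ) (i : Fin 3) :
    wderiv i (c • f) = c • wderiv i f := ((hf.hasWeakDeriv i).smul c).wderiv_eq

theorem wderiv_zero (i : Fin 3) : wderiv i 0 = 0 := (hasWeakDeriv_zero i).wderiv_eq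

theorem MemH2.add {f g : L2} (hf : MemH2 f) (hg : MemH2 g) : MemH2 (f + g) :=
  ⟨hf.1.add hg.1, fun i => by rw [hf.1.wderiv_add hg.1]; exact (hf.2 i).add (hg.2 i)⟩

theorem MemH2.smul {f : L2} (c : ℝ) (hf : MemH2 f) : MemH2 (c • f) :=
  ⟨hf.1.smul c, fun i => by rw [hf.1.wderiv_smul c]; exact (hf.2 i).smul c⟩

theorem memH2_zero : MemH2 0 := ⟨memH1_zero, fun i => by rw [wderiv_zero]; exact memH1_zero⟩

theorem MemH2V.add {u v : L2V} (hu : MemH2V u) (hv : MemH2V v) : MemH2V (u + v) := fun j => by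
  rw [comp_add]; exact (hu j).add (hv j)

theorem MemH2V.smul {u : L2V} (c : ℝ) (hu : MemH2V u) : MemH2V (c • u) := fun j => by
  rw [comp_smul]; exact (hu j).smul c

theorem memH2V_zero : MemH2V 0 := fun j => by rw [comp_zero]; exact memH2_zero

theorem comp_laplacian (j : Fin 3) (u : L2V) :
    comp j (laplacian u) = ∑ i, wderiv i (wderiv i (comp j u)) := comp_ofComp j _

theorem comp_grad (j : Fin 3) (q : L2) : comp j (grad q) = wderiv j q := comp_ofComp j _

theorem MemH2V.laplacian_add {u v : L2V} (hu : MemH2V u) (hv : MemH2V v) :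
    laplacian (u + v) = laplacian u + laplacian v := by
  refine ext_comp fun j => ?_
  rw [comp_add, comp_laplacian, comp_laplacian, comp_laplacian, ← Finset.sum_add_distrib]
  refine Finset.sum_congr rfl fun i _ => ?_
  rw [comp_add, (hu j).1.wderiv_add (hv j).1, ((hu j).2 i).wderiv_add ((hv j).2 i)]

theorem MemH2V.laplacian_smul {u : L2V} (hu : MemH2V u) (c : ℝ) :
    laplacian (c • u) = c • laplacian u := by
  refine ext_comp fun j => ?_
  rw [comp_smul, comp_laplacian, comp_laplacian, Finset.smul_sum]
  refine Finset.sum_congr rfl fun i _ => ?_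
  rw [comp_smul, (hu j).1.wderiv_smul, ((hu j).2 i).wderiv_smul]

theorem MemH1.grad_add {p q : L2} (hp : MemH1 p) (hq : MemH1 q) :
    grad (p + q) = grad p + grad q := by
  refine ext_comp fun j => ?_
  rw [comp_add, comp_grad, comp_grad, comp_grad, hp.wderiv_add hq]

theorem MemH1.grad_smul {q : L2} (hq : MemH1 q) (c : ℝ) : grad (c • q) = c • grad q := by
  refine ext_comp fun j => ?_
  rw [comp_smul, comp_grad, comp_grad, hq.wderiv_smul]

theorem tsupport_D_subset (i : Fin 3) (φ : Smooth) : tsupport (D i φ).1 ⊆ tsupport φ.1 := by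
  refine closure_minimal (fun p hp => ?_) (isClosed_tsupport _)
  by_contra hc
  apply hp
  have h1 : φ.1 =ᶠ[nhds p] 0 := notMem_tsupport_iff_eventuallyEq.1 hc
  have h2 : Continuous fun t : ℝ => p + shift i t := by
    have : Continuous (shift i) := by
      fin_cases i
      · exact ((AddCircle.continuous_mk' (2 * π)).prodMk continuous_const)
      · exact continuous_const.prodMk ((AddCircle.continuous_mk' (2 * π)).prodMk continuous_const)
      · exact continuous_const.prodMk (continuous_const.prodMk continuous_id)
    fun_prop
  have h3 : p + shift i 0 = p := by
    obtain ⟨x, rfl⟩ := cov_surjective p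
    rw [cov_add_shift]; simp
  have h4 : Filter.Tendsto (fun t : ℝ => p + shift i t) (nhds 0) (nhds p) := by
    simpa [h3] using h2.tendsto 0
  have h5 : (fun t : ℝ => φ.1 (p + shift i t)) =ᶠ[nhds 0] fun _ => 0 := h4.eventually h1
  change deriv (fun t : ℝ => φ.1 (p + shift i t)) 0 = 0
  rw [h5.deriv_eq, deriv_const]

theorem isTest_D (i : Fin 3) {φ : Smooth} (h : IsTest φ.1) : IsTest (D i φ).1 :=
  ⟨(D i φ).2, h.2.1.of_isClosed_subset (isClosed_tsupport _) (tsupport_D_subset i φ),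
    (tsupport_D_subset i φ).trans h.2.2⟩

/-- Weak derivatives commute. -/
theorem MemH2.wderiv_comm {f : L2} (hf : MemH2 f) (i j : Fin 3) :
    wderiv i (wderiv j f) = wderiv j (wderiv i f) := by
  apply HasWeakDeriv.wderiv_eq
  rw [hasWeakDeriv_iff]
  intro φ hφ
  have h1 := hasWeakDeriv_iff.1 (hf.1.hasWeakDeriv j) (D i φ) (isTest_D i hφ)
  have h2 := hasWeakDeriv_iff.1 (hf.1.hasWeakDeriv i) (D j φ) (isTest_D j hφ)
  have h3 := hasWeakDeriv_iff.1 ((hf.2 i).hasWeakDeriv j) φ hφ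
  rw [D_comm] at h2
  linarith

/-! ### Traces and the space `H_𝒫` -/

theorem hasTrace_iff {f : L2} {t₁ t₀ : L2T} : HasTrace f t₁ t₀ ↔ MemH1 f ∧ ∀ φ : Smooth,
    inner ℝ (wderiv 2 f) (toL2 φ) + inner ℝ f (toL2 (D 2 φ)) =
      inner ℝ t₁ (toL2T 1 φ) - inner ℝ t₀ (toL2T (-1) φ) := by
  refine and_congr_right fun _ => ?_
  simp only [inner_toL2_right, inner_toL2T_right]
  have e : ∀ φ : Smooth, ∫ p, wderiv 2 f p * φ.1 p ∂volOmega + ∫ p, f p * (D 2 φ).1 p ∂volOmega =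
      ∫ p, (wderiv 2 f p * φ.1 p + f p * pderiv 2 φ.1 p) ∂volOmega := fun φ =>
    (integral_add (integrable_mul _ φ) (integrable_mul f (D 2 φ))).symm
  simp only [e]
  exact ⟨fun h φ => h φ.1 φ.2, fun h φ hφ => h ⟨φ, hφ⟩⟩

theorem HasTrace.add {f g : L2} {t₁ t₀ s₁ s₀ : L2T} (hf : HasTrace f t₁ t₀)
    (hg : HasTrace g s₁ s₀) : HasTrace (f + g) (t₁ + s₁) (t₀ + s₀) := by
  rw [hasTrace_iff] at *
  refine ⟨hf.1.add hg.1, fun φ => ?_⟩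
  rw [hf.1.wderiv_add hg.1]
  simp only [inner_add_left]
  linarith [hf.2 φ, hg.2 φ]

theorem HasTrace.smul {f : L2} {t₁ t₀ : L2T} (c : ℝ) (hf : HasTrace f t₁ t₀) :
    HasTrace (c • f) (c • t₁) (c • t₀) := by
  rw [hasTrace_iff] at *
  refine ⟨hf.1.smul c, fun φ => ?_⟩
  rw [hf.1.wderiv_smul c]
  simp only [inner_smul_left, conj_trivial]
  linear_combination c * hf.2 φ

theorem hasTrace_zero : HasTrace 0 0 0 := by
  rw [hasTrace_iff]
  exact ⟨memH1_zero, fun φ => by simp [wderiv_zero]⟩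

theorem MemH2V.strain_add {u v : L2V} (hu : MemH2V u) (hv : MemH2V v) (i j : Fin 3) :
    strain (u + v) i j = strain u i j + strain v i j := by
  simp only [strain, comp_add, (hu _).1.wderiv_add (hv _).1, ← smul_add]
  congr 1; abel

theorem MemH2V.strain_smul {u : L2V} (hu : MemH2V u) (c : ℝ) (i j : Fin 3) :
    strain (c • u) i j = c • strain u i j := by
  simp only [strain, comp_smul, (hu _).1.wderiv_smul, ← smul_add]
  rw [smul_comm]

theorem NavierSlip.add {β : ℝ} {u v : L2V} (hu : MemH2V u) (hv : MemH2V v)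
    (h : NavierSlip β u) (h' : NavierSlip β v) : NavierSlip β (u + v) := by
  intro j hj
  obtain ⟨d₁, d₀, a₁, a₀, h1, h2, h3, h4⟩ := h j hj
  obtain ⟨d₁', d₀', a₁', a₀', h1', h2', h3', h4'⟩ := h' j hj
  refine ⟨d₁ + d₁', d₀ + d₀', a₁ + a₁', a₀ + a₀', ?_, ?_, ?_, ?_⟩
  · rw [hu.strain_add hv]; exact h1.add h1'
  · rw [comp_add]; exact h2.add h2'
  · rw [smul_add, smul_add, add_add_add_comm, h3, h3', add_zero]
  · rw [neg_add, smul_add, smul_add, add_add_add_comm, h4, h4', add_zero]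

theorem NavierSlip.smul {β : ℝ} {u : L2V} (hu : MemH2V u) (c : ℝ) (h : NavierSlip β u) :
    NavierSlip β (c • u) := by
  intro j hj
  obtain ⟨d₁, d₀, a₁, a₀, h1, h2, h3, h4⟩ := h j hj
  refine ⟨c • d₁, c • d₀, c • a₁, c • a₀, ?_, ?_, ?_, ?_⟩
  · rw [hu.strain_smul]; exact h1.smul c
  · rw [comp_smul]; exact h2.smul c
  · rw [smul_comm 2, smul_comm β, ← smul_add, h3, smul_zero]
  · rw [← smul_neg, smul_comm 2, smul_comm β, ← smul_add, h4, smul_zero]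

theorem navierSlip_zero (β : ℝ) : NavierSlip β 0 := by
  intro j _
  have hs : strain 0 j 2 = 0 := by simp [strain, comp_zero, wderiv_zero]
  exact ⟨0, 0, 0, 0, by rw [hs]; exact hasTrace_zero, by rw [comp_zero]; exact hasTrace_zero,
    by simp, by simp⟩

theorem mem_HP_iff {u : L2V} :
    u ∈ HP ↔ ∀ φ : Smooth, ∑ i, inner ℝ (comp i u) (toL2 (D i φ)) = 0 := by
  constructor
  · intro h φ
    rw [← inner_toL2V]
    refine Submodule.inner_left_of_mem_orthogonal (Submodule.subset_span ?_) h
    refine ⟨φ.1, φ.2, ?_⟩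
    filter_upwards [ae_all_iff.2 fun i => coeFn_comp i (toL2V fun i => D i φ),
      ae_all_iff.2 fun i => coeFn_toL2 (D i φ)] with p h1 h2 i
    rw [← h1, comp_toL2V, h2]; rfl
  · intro h
    rw [HP, Submodule.mem_orthogonal]
    intro g hg
    induction hg using Submodule.span_induction with
    | mem g hg =>
      obtain ⟨φ, hφ, hg⟩ := hg
      have e : g = toL2V fun i => D i ⟨φ, hφ⟩ := by
        refine ext_comp fun i => ?_
        rw [comp_toL2V]
        apply Lp.ext
        filter_upwards [coeFn_comp i g, coeFn_toL2 (D i ⟨φ, hφ⟩), hg] with p h1 h2 h3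
        rw [h1, h2, h3]; rfl
      rw [e, real_inner_comm, inner_toL2V]
      exact h ⟨φ, hφ⟩
    | zero => simp
    | add x y _ _ hx hy => rw [inner_add_left, hx, hy, add_zero]
    | smul a x _ hx => rw [inner_smul_left, hx, mul_zero]

theorem toL2V_mem_HP {v : Fin 3 → Smooth} (hv : ∑ i, D i (v i) = 0)
    (h2 : VanishesOnBoundary (v 2)) : toL2V v ∈ HP := by
  rw [mem_HP_iff]
  intro φ
  have := sum_I_D_mul_eq_zero φ hv h2
  simpa only [comp_toL2V, inner_toL2, mul_comm] using this

/-- Testing with gradients of functions in `C_c^∞(Ω)` gives the weak divergence. -/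
theorem divergence_eq_zero_of_mem_HP {u : L2V} (h1 : MemH1V u) (h : u ∈ HP) :
    divergence u = 0 := by
  refine eq_zero_of_inner_test_eq_zero fun φ hφ => ?_
  rw [divergence, sum_inner, ← neg_eq_zero, ← mem_HP_iff.1 h φ, ← Finset.sum_neg_distrib]
  refine Finset.sum_congr rfl fun i _ => ?_
  rw [hasWeakDeriv_iff.1 ((h1 i).hasWeakDeriv i) φ hφ]

theorem noPenetration_of_mem_HP {u : L2V} (h1 : MemH1V u) (h : u ∈ HP) : NoPenetration u := by
  rw [NoPenetration, hasTrace_iff]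
  refine ⟨h1 2, fun φ => ?_⟩
  have hd : inner ℝ (divergence u) (toL2 φ) = 0 := by
    rw [divergence_eq_zero_of_mem_HP h1 h, inner_zero_left]
  have hg := mem_HP_iff.1 h φ
  rw [divergence, sum_inner, Fin.sum_univ_three] at hd
  rw [Fin.sum_univ_three, ((h1 0).hasWeakDeriv 0).inner_D_horizontal (by decide),
    ((h1 1).hasWeakDeriv 1).inner_D_horizontal (by decide)] at hg
  rw [inner_zero_left, inner_zero_left]
  linarith

theorem toL2T_congr {z : ℝ} {φ ψ : Smooth} (h : slice z φ = slice z ψ) :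
    toL2T z φ = toL2T z ψ := by
  apply Lp.ext
  filter_upwards [coeFn_toL2T z φ, coeFn_toL2T z ψ] with y h1 h2
  rw [h1, h2, h]

/-! ### Green's formula for the Stokes operator -/

/-- In the vertical direction, the boundary terms of a tangential component cancel by the Navier
conditions on both factors. -/
theorem inner_wderiv_two_two_tangential {β : ℝ} {w : L2V} (hw : MemH2V w)
    (h2 : NoPenetration w) (hs : NavierSlip β w) {v : Fin 3 → Smooth} (hv : IsAdmissible β v)
    {j : Fin 3} (hj : j ≠ 2) :
    inner ℝ (wderiv 2 (wderiv 2 (comp j w))) (toL2 (v j)) =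
      inner ℝ (comp j w) (toL2 (D 2 (D 2 (v j)))) := by
  obtain ⟨d₁, d₀, a₁, a₀, hd, ha, e1, e0⟩ := hs j hj
  have hH1 : MemH1 (wderiv j (comp 2 w)) := (hw 2).2 j
  have hH2 : MemH1 (wderiv 2 (comp j w)) := (hw j).2 2
  -- the strain tested with `v j`
  have t1 := (hasTrace_iff.1 hd).2 (v j)
  rw [strain, (hH1.add hH2).wderiv_smul, hH1.wderiv_add hH2, (hw 2).wderiv_comm] at t1
  simp only [inner_smul_left, inner_add_left, conj_trivial] at t1
  -- the part `∂_j w_2` of the strain does not contribute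
  have t2 := (hasTrace_iff.1 h2).2 (D j (v j))
  rw [inner_zero_left, inner_zero_left, D_comm 2 j] at t2
  have t3 := (((hw 2).2 2).hasWeakDeriv j).inner_D_horizontal hj (v j)
  have t4 := ((hw 2).1.hasWeakDeriv j).inner_D_horizontal hj (D 2 (v j))
  have t5 := (hasTrace_iff.1 ha).2 (D 2 (v j))
  have r1 : toL2T 1 (D 2 (v j)) = -(β • toL2T 1 (v j)) := by
    rw [← map_smul, ← map_neg]
    refine toL2T_congr ?_
    change _ = -(β • slice 1 (v j))
    exact eq_neg_of_add_eq_zero_left (hv.robin_top j hj)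
  have r0 : toL2T (-1) (D 2 (v j)) = β • toL2T (-1) (v j) := by
    rw [← map_smul]
    refine toL2T_congr ?_
    change _ = β • slice (-1) (v j)
    rw [← sub_eq_zero, ← neg_eq_zero, ← hv.robin_bot j hj]; abel
  rw [r1, r0, inner_neg_right, inner_smul_right, inner_smul_right] at t5
  have s1 : 2 * inner ℝ d₁ (toL2T 1 (v j)) + β * inner ℝ a₁ (toL2T 1 (v j)) = 0 := by
    have := congrArg (fun t => inner ℝ t (toL2T 1 (v j))) e1
    simpa [inner_add_left, inner_smul_left] using this
  have s0 : -(2 * inner ℝ d₀ (toL2T (-1) (v j))) + β * inner ℝ a₀ (toL2T (-1) (v j)) = 0 := by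
    have := congrArg (fun t => inner ℝ t (toL2T (-1) (v j))) e0
    simpa [inner_add_left, inner_smul_left] using this
  linarith

/-- The Stokes operator is symmetric: on one side a field in `H²`, on the other a classical
solution. -/
theorem sum_inner_force {β : ℝ} {w : L2V} (hw : MemH2V w) (hP : w ∈ HP)
    (hs : NavierSlip β w) {v : Fin 3 → Smooth} (hv : IsAdmissible β v) (q : Smooth) :
    ∑ j, inner ℝ (comp j w) (toL2 (force v q j)) = -inner ℝ (laplacian w) (toL2V v) := by
  have h2 : NoPenetration w := noPenetration_of_mem_HP (fun j => (hw j).1) hP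
  have key : ∀ i j, inner ℝ (wderiv i (wderiv i (comp j w))) (toL2 (v j)) =
      inner ℝ (comp j w) (toL2 (D i (D i (v j)))) := by
    intro i j
    by_cases hi : i = 2
    · subst hi
      by_cases hj : j = 2
      · subst hj
        have t1 := (((hw 2).2 2).hasWeakDeriv 2).inner_D_of_vanishes hv.vanish
        have t2 := (hasTrace_iff.1 h2).2 (D 2 (v 2))
        rw [inner_zero_left, inner_zero_left] at t2
        linarith
      · exact inner_wderiv_two_two_tangential hw h2 hs hv hj
    · have t1 := (((hw j).2 i).hasWeakDeriv i).inner_D_horizontal hi (v j)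
      have t2 := ((hw j).1.hasWeakDeriv i).inner_D_horizontal hi (D i (v j))
      linarith
  have hq := mem_HP_iff.1 hP q
  have e : ∀ j, inner ℝ (comp j w) (toL2 (force v q j)) =
      -inner ℝ (comp j (laplacian w)) (toL2 (v j)) + inner ℝ (comp j w) (toL2 (D j q)) := by
    intro j
    rw [force, map_add, inner_add_right, map_neg, inner_neg_right, lap_apply, map_sum, inner_sum,
      comp_laplacian, sum_inner]
    simp only [key]
  simp only [e]
  rw [Finset.sum_add_distrib, hq, add_zero, Finset.sum_neg_distrib, inner_toL2V]

/-- The gradient of a function in `H¹(Ω)` is orthogonal to smooth solenoidal fields that are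
tangential on `Γ`. -/
theorem MemH1.inner_grad_eq_zero {q : L2} (hq : MemH1 q) {v : Fin 3 → Smooth}
    (hv : ∑ i, D i (v i) = 0) (h2 : VanishesOnBoundary (v 2)) :
    inner ℝ (grad q) (toL2V v) = 0 := by
  have e : ∀ i, inner ℝ (comp i (grad q)) (toL2 (v i)) = -inner ℝ q (toL2 (D i (v i))) := by
    intro i
    rw [comp_grad]
    by_cases hi : i = 2
    · subst hi; rw [(hq.hasWeakDeriv 2).inner_D_of_vanishes h2, neg_neg]
    · rw [(hq.hasWeakDeriv i).inner_D_horizontal hi, neg_neg]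
  rw [inner_toL2V]
  simp only [e]
  rw [Finset.sum_neg_distrib, ← inner_sum, ← map_sum, hv, map_zero, inner_zero_right, neg_zero]

/-! ### Existence of strong solutions -/

theorem VanishesOnBoundary.add {φ ψ : Smooth} (h : VanishesOnBoundary φ)
    (h' : VanishesOnBoundary ψ) : VanishesOnBoundary (φ + ψ) := by
  constructor
  · rw [slice_add, h.1, h'.1, add_zero]
  · rw [slice_add, h.2, h'.2, add_zero]

theorem VanishesOnBoundary.smul {φ : Smooth} (c : ℝ) (h : VanishesOnBoundary φ) :
    VanishesOnBoundary (c • φ) := by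
  constructor
  · rw [slice_smul, h.1, smul_zero]
  · rw [slice_smul, h.2, smul_zero]

theorem IsAdmissible.add {β : ℝ} {u v : Fin 3 → Smooth} (hu : IsAdmissible β u)
    (hv : IsAdmissible β v) :
    IsAdmissible β (u + v) := by
  refine ⟨?_, hu.vanish.add hv.vanish, fun j hj => ?_, fun j hj => ?_⟩
  · simp only [Pi.add_apply, map_add, Finset.sum_add_distrib, hu.div, hv.div, add_zero]
  · rw [Pi.add_apply, map_add, slice_add, slice_add, smul_add, add_add_add_comm,
      hu.robin_top j hj, hv.robin_top j hj, add_zero]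
  · rw [Pi.add_apply, map_add, slice_add, slice_add, smul_add, neg_add, add_add_add_comm,
      hu.robin_bot j hj, hv.robin_bot j hj, add_zero]

theorem IsAdmissible.smul {β : ℝ} {u : Fin 3 → Smooth} (c : ℝ) (hu : IsAdmissible β u) :
    IsAdmissible β (c • u) := by
  refine ⟨?_, hu.vanish.smul c, fun j hj => ?_, fun j hj => ?_⟩
  · simp only [Pi.smul_apply, map_smul, ← Finset.smul_sum, hu.div, smul_zero]
  · rw [Pi.smul_apply, map_smul, slice_smul, slice_smul, smul_comm β, ← smul_add,
      hu.robin_top j hj, smul_zero]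
  · rw [Pi.smul_apply, map_smul, slice_smul, slice_smul, smul_comm β, ← smul_neg, ← smul_add,
      hu.robin_bot j hj, smul_zero]

theorem D_one_eq_zero (i : Fin 3) : D i 1 = 0 := by
  by_cases hi : i = 2
  · subst hi
    have := D_two_polyZ 1
    rw [polyZ_one] at this
    rw [this]
    refine Smooth.ext_apply fun p => ?_
    change (Polynomial.derivative (1 : Polynomial ℝ)).eval p.2.2 = 0
    simp
  · exact D_ofZ hi (contDiff_const (c := (1 : ℝ)))

/-- For `β = 0` the constant horizontal fields satisfy the boundary conditions. -/
theorem isAdmissible_const {j : Fin 3} (hj : j ≠ 2) :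
    IsAdmissible 0 (Pi.single j (1 : Smooth)) := by
  have hD : ∀ i k : Fin 3, D i ((Pi.single j (1 : Smooth) : Fin 3 → Smooth) k) = 0 := by
    intro i k
    by_cases hk : k = j
    · subst hk
      rw [Pi.single_eq_same]
      exact D_one_eq_zero i
    · rw [Pi.single_eq_of_ne hk, map_zero]
  refine ⟨Finset.sum_eq_zero fun i _ => hD i i, ?_, fun i _ => ?_, fun i _ => ?_⟩
  · rw [Pi.single_eq_of_ne hj.symm]; exact VanishesOnBoundary.zero
  · rw [hD, zero_smul, add_zero]; rfl
  · rw [hD, zero_smul, add_zero, neg_eq_zero]; rfl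

/-- The classical solutions `(u, q)` normalised by `∫ q = 0` and, if `β = 0`, by
`∫ u_0 = ∫ u_1 = 0`. -/
def classicalSol (β : ℝ) : Submodule ℝ ((Fin 3 → Smooth) × Smooth) where
  carrier := {x | IsAdmissible β x.1 ∧ (β = 0 → ∀ j, j ≠ 2 → I (x.1 j) = 0) ∧ I x.2 = 0}
  zero_mem' := ⟨isAdmissible_zero β, fun _ _ _ => map_zero I, map_zero I⟩
  add_mem' := by
    rintro x y ⟨h1, h2, h3⟩ ⟨h1', h2', h3'⟩
    refine ⟨h1.add h1', fun hb j hj => ?_, ?_⟩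
    · rw [Prod.fst_add, Pi.add_apply, map_add, h2 hb j hj, h2' hb j hj, add_zero]
    · rw [Prod.snd_add, map_add, h3, h3', add_zero]
  smul_mem' := by
    rintro c x ⟨h1, h2, h3⟩
    refine ⟨h1.smul c, fun hb j hj => ?_, ?_⟩
    · rw [Prod.smul_fst, Pi.smul_apply, map_smul, h2 hb j hj, smul_zero]
    · rw [Prod.smul_snd, map_smul, h3, smul_zero]

/-- The space of candidates for `(u, ∇u, ∇²u, q, ∇q)` together with the traces of `u` on the two
components of `Γ`. -/
abbrev Jet : Type :=
  (Fin 3 → L2) × (Fin 3 → Fin 3 → L2) × (Fin 3 → Fin 3 → Fin 3 → L2) × L2 × (Fin 3 → L2) ×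
    (Fin 3 → L2T) × (Fin 3 → L2T)

/-- The velocity, the pressure, their derivatives and their traces. -/
def jet : ((Fin 3 → Smooth) × Smooth) →ₗ[ℝ] Jet where
  toFun x := (fun j => toL2 (x.1 j), fun i j => toL2 (D i (x.1 j)),
    fun k i j => toL2 (D k (D i (x.1 j))), toL2 x.2, fun i => toL2 (D i x.2),
    fun j => toL2T 1 (x.1 j), fun j => toL2T (-1) (x.1 j))
  map_add' x y := by
    simp only [Prod.fst_add, Prod.snd_add, Pi.add_apply, map_add]; rfl
  map_smul' c x := by
    simp only [Prod.smul_fst, Prod.smul_snd, Pi.smul_apply, map_smul]; rfl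

/-- The map `ofComp` as a linear map. -/
def ofCompL : (Fin 3 → L2) →ₗ[ℝ] L2V where
  toFun := ofComp
  map_add' g h := ext_comp fun i => by simp only [comp_add, comp_ofComp, Pi.add_apply]
  map_smul' c g := ext_comp fun i => by
    simp only [comp_smul, comp_ofComp, Pi.smul_apply, RingHom.id_apply]

theorem continuous_ofComp : Continuous ofComp := by
  have : ofComp = fun g => ∑ i, (ContinuousLinearMap.toSpanSingleton ℝ
      (EuclideanSpace.single i (1 : ℝ) : R3)).compLpL 2 volOmega (g i) := rfl
  rw [this]
  fun_prop

/-- The expression `-Δu + ∇q` on jets. -/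
def stokesL : Jet →ₗ[ℝ] L2V where
  toFun x := ofComp fun j => -∑ i, x.2.2.1 i i j + x.2.2.2.2.1 j
  map_add' x y := by
    have := ofCompL.map_add (fun j => -∑ i, x.2.2.1 i i j + x.2.2.2.2.1 j)
      (fun j => -∑ i, y.2.2.1 i i j + y.2.2.2.2.1 j)
    refine Eq.trans ?_ this
    change ofComp _ = ofComp _
    congr 1
    funext j
    simp only [Prod.snd_add, Prod.fst_add, Pi.add_apply, Finset.sum_add_distrib]
    abel
  map_smul' c x := by
    have := ofCompL.map_smul c (fun j => -∑ i, x.2.2.1 i i j + x.2.2.2.2.1 j)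
    refine Eq.trans ?_ this
    change ofComp _ = ofComp _
    congr 1
    funext j
    simp only [Prod.smul_snd, Prod.smul_fst, Pi.smul_apply, ← Finset.smul_sum, smul_add, smul_neg]

theorem comp_stokesL (x : Jet) (j : Fin 3) :
    comp j (stokesL x) = -∑ i, x.2.2.1 i i j + x.2.2.2.2.1 j := comp_ofComp j _

theorem continuous_stokesL : Continuous stokesL :=
  continuous_ofComp.comp (by fun_prop)

theorem stokesL_jet (x : (Fin 3 → Smooth) × Smooth) :
    stokesL (jet x) = toL2V (force x.1 x.2) := by
  refine ext_comp fun j => ?_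
  rw [comp_stokesL, comp_toL2V, force, map_add, map_neg, lap_apply, map_sum]
  rfl

/-- An a priori estimate on a subspace extends to its closure and makes the image of the closure
closed. -/
theorem exists_mem_closure_of_apriori {E F : Type*} [NormedAddCommGroup E] [NormedSpace ℝ E]
    [CompleteSpace E] [NormedAddCommGroup F] [NormedSpace ℝ F] (M : Submodule ℝ E)
    (T : E →ₗ[ℝ] F) (hT : Continuous T) {C : ℝ} (h : ∀ x ∈ M, ‖x‖ ≤ C * ‖T x‖) {y : F}
    (hy : y ∈ closure (T '' M)) : ∃ x ∈ closure (M : Set E), T x = y ∧ ‖x‖ ≤ C * ‖y‖ := by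
  obtain ⟨w, hw, hlim⟩ := mem_closure_iff_seq_limit.1 hy
  choose x hxM hx using hw
  have hc : CauchySeq x := by
    have hcw : CauchySeq w := hlim.cauchySeq
    rw [Metric.cauchySeq_iff] at hcw ⊢
    intro ε hε
    obtain ⟨N, hN⟩ := hcw (ε / (|C| + 1)) (by positivity)
    refine ⟨N, fun m hm n hn => ?_⟩
    have h1 := h (x m - x n) (M.sub_mem (hxM m) (hxM n))
    rw [map_sub, hx, hx] at h1
    have h2 := hN m hm n hn
    rw [dist_eq_norm] at h2 ⊢
    rw [lt_div_iff₀ (by positivity)] at h2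
    nlinarith [le_abs_self C, norm_nonneg (w m - w n)]
  obtain ⟨x₀, hx₀⟩ := cauchySeq_tendsto_of_complete hc
  refine ⟨x₀, mem_closure_of_tendsto hx₀ (Filter.Eventually.of_forall hxM), ?_, ?_⟩
  · have h1 : Filter.Tendsto (fun n => T (x n)) Filter.atTop (nhds (T x₀)) :=
      (hT.tendsto x₀).comp hx₀
    simp only [hx] at h1
    exact tendsto_nhds_unique h1 hlim
  · refine le_of_tendsto_of_tendsto hx₀.norm (hlim.norm.const_mul C)
      (Filter.Eventually.of_forall fun n => ?_)
    have := h _ (hxM n)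
    rwa [hx] at this

theorem norm_toL2T_le (φ : Smooth) {z : ℝ} (hz : z = 1 ∨ z = -1) {c : ℝ}
    (h0 : ‖toL2 φ‖ ≤ c) (h1 : ‖toL2 (D 2 φ)‖ ≤ c) : ‖toL2T z φ‖ ≤ 2 * c := by
  have hc : 0 ≤ c := (norm_nonneg _).trans h0
  refine (abs_le_of_sq_le_sq' ?_ (by positivity)).2
  have hB := B_sq_add_B_sq_le φ
  have hp : ∀ z, 0 ≤ B z (φ * φ) := fun z => B_nonneg fun p => mul_self_nonneg (φ.1 p)
  have hle : B z (φ * φ) ≤ B 1 (φ * φ) + B (-1) (φ * φ) := by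
    rcases hz with rfl | rfl
    · exact le_add_of_nonneg_right (hp _)
    · exact le_add_of_nonneg_left (hp _)
  rw [norm_toL2T_sq]
  have := pow_le_pow_left₀ (norm_nonneg _) h0 2
  have := pow_le_pow_left₀ (norm_nonneg _) h1 2
  nlinarith

/-- The a priori estimate for the jets of normalised classical solutions. -/
theorem exists_norm_jet_le {β : ℝ} (hβ : 0 ≤ β) : ∃ C : ℝ, 0 < C ∧
    ∀ x ∈ (classicalSol β).map jet, ‖x‖ ≤ C * ‖stokesL x‖ := by
  obtain ⟨C, hC, h⟩ := exists_apriori hβ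
  refine ⟨2 * C, by positivity, ?_⟩
  rintro _ ⟨x, ⟨h1, h2, h3⟩, rfl⟩
  obtain ⟨a, b, c, d, e⟩ := h x.1 x.2 ‖stokesL (jet x)‖ h1 h2 h3 fun j => by
    rw [← comp_toL2V j (force x.1 x.2), ← stokesL_jet]
    exact norm_comp_le _ _
  set N := ‖stokesL (jet x)‖
  have hN : 0 ≤ N := norm_nonneg _
  have hCN : C * N ≤ 2 * C * N := by nlinarith [mul_nonneg hC.le hN]
  have h0 : 0 ≤ 2 * C * N := by positivity
  refine norm_prod_le_iff.2 ⟨?_, norm_prod_le_iff.2 ⟨?_, norm_prod_le_iff.2 ⟨?_,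
    norm_prod_le_iff.2 ⟨?_, norm_prod_le_iff.2 ⟨?_, norm_prod_le_iff.2 ⟨?_, ?_⟩⟩⟩⟩⟩⟩
  · exact (pi_norm_le_iff_of_nonneg h0).2 fun j => (a j).trans hCN
  · exact (pi_norm_le_iff_of_nonneg h0).2 fun i => (pi_norm_le_iff_of_nonneg h0).2 fun j =>
      (b i j).trans hCN
  · exact (pi_norm_le_iff_of_nonneg h0).2 fun k => (pi_norm_le_iff_of_nonneg h0).2 fun i =>
      (pi_norm_le_iff_of_nonneg h0).2 fun j => (c k i j).trans hCN
  · exact d.trans hCN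
  · exact (pi_norm_le_iff_of_nonneg h0).2 fun i => (e i).trans hCN
  · refine (pi_norm_le_iff_of_nonneg h0).2 fun j => ?_
    rw [mul_assoc]
    exact norm_toL2T_le _ (Or.inl rfl) (a j) (b 2 j)
  · refine (pi_norm_le_iff_of_nonneg h0).2 fun j => ?_
    rw [mul_assoc]
    exact norm_toL2T_le _ (Or.inr rfl) (a j) (b 2 j)

theorem horizontalMeanZero_iff {v : L2V} :
    HorizontalMeanZero v ↔ ∀ j : Fin 3, j ≠ 2 → inner ℝ (comp j v) (toL2 1) = 0 := by
  simp only [inner_toL2_right]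
  have : ∀ j, ∫ p, comp j v p * (1 : Smooth).1 p ∂volOmega = ∫ p, comp j v p ∂volOmega :=
    fun j => integral_congr_ae (Filter.Eventually.of_forall fun p => mul_one _)
  simp only [this]
  rfl

/-- Every classical solution can be normalised without changing its force. -/
theorem exists_normalised {β : ℝ} {u : Fin 3 → Smooth} (hu : IsAdmissible β u) (q : Smooth) :
    ∃ x ∈ classicalSol β, force x.1 x.2 = force u q := by
  have hI := I_one_pos.ne'
  have hl : ∀ c : ℝ, lap (c • (1 : Smooth)) = 0 := fun c => by
    rw [map_smul, lap_apply]; simp [D_one_eq_zero]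
  have hq : I (q - (I q / I 1) • 1) = 0 := by
    rw [map_sub, map_smul, smul_eq_mul, div_mul_cancel₀ _ hI, sub_self]
  have hDq : ∀ j, D j (q - (I q / I 1) • 1) = D j q := fun j => by
    rw [map_sub, map_smul, D_one_eq_zero, smul_zero, sub_zero]
  by_cases hb : β = 0
  · subst hb
    set c : Fin 3 → ℝ := fun j => -(I (u j) / I 1)
    refine ⟨(u + (c 0 • (Pi.single 0 (1 : Smooth) : Fin 3 → Smooth) +
        c 1 • (Pi.single 1 (1 : Smooth) : Fin 3 → Smooth)),
      q - (I q / I 1) • 1), ⟨hu.add (((isAdmissible_const (j := 0) (by decide)).smul _).add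
        ((isAdmissible_const (j := 1) (by decide)).smul _)), fun _ j hj => ?_, hq⟩, ?_⟩
    · have hj' : ∀ j, I (u j + c j • (1 : Smooth)) = 0 := fun j => by
        rw [map_add, map_smul, smul_eq_mul, neg_mul, div_mul_cancel₀ _ hI, add_neg_cancel]
      fin_cases j
      · simpa using hj' 0
      · simpa using hj' 1
      · exact absurd rfl hj
    · funext j
      simp only [force, hDq]
      congr 2
      simp only [Pi.add_apply, Pi.smul_apply, map_add]
      fin_cases j <;> simp [hl]
  · refine ⟨(u, q - (I q / I 1) • 1), ⟨hu, fun h => absurd h hb, hq⟩, ?_⟩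
    funext j
    simp only [force, hDq]

/-- Forces of classical solutions are dense, for `β = 0` among the fields of horizontal mean
zero. -/
theorem mem_closure_force {β : ℝ} (hβ : 0 ≤ β) {f : L2V} (hf : β = 0 → HorizontalMeanZero f) :
    f ∈ closure (stokesL '' ((classicalSol β).map jet : Submodule ℝ Jet)) := by
  set R : Submodule ℝ L2V := ((classicalSol β).map jet).map stokesL
  have hR : stokesL '' ((classicalSol β).map jet : Submodule ℝ Jet) = (R : Set L2V) := rfl
  rw [hR, ← Submodule.topologicalClosure_coe, ← Submodule.orthogonal_orthogonal_eq_closure]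
  rw [SetLike.mem_coe, Submodule.mem_orthogonal]
  intro g hg
  obtain ⟨a, ha2, ha, hag⟩ := eq_const_of_inner_force_eq_zero hβ (g := fun j => comp j g) (by
    intro u q hu
    obtain ⟨x, hx, hxf⟩ := exists_normalised hu q
    rw [← hxf, ← inner_toL2V, ← stokesL_jet]
    exact Submodule.inner_left_of_mem_orthogonal
      (Submodule.mem_map_of_mem (Submodule.mem_map_of_mem hx)) hg)
  rw [inner_eq_sum]
  refine Finset.sum_eq_zero fun j _ => ?_
  rw [hag j, inner_smul_left]
  by_cases hj : j = 2
  · subst hj; rw [ha2]; simp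
  · rcases hβ.eq_or_lt with hb | hb
    · rw [real_inner_comm, horizontalMeanZero_iff.1 (hf hb.symm) j hj, mul_zero]
    · rw [ha hb]; simp

theorem eq_of_mem_closure {M : Set Jet} {f g : Jet → ℝ} (hf : Continuous f) (hg : Continuous g)
    (h : ∀ x ∈ M, f x = g x) {x : Jet} (hx : x ∈ closure M) : f x = g x :=
  Set.EqOn.closure h hf hg hx

/-- Existence with the estimate. The solution is a limit of jets of classical solutions, and weak
derivatives, the space `H_𝒫` and traces are all characterised by identities that are continuous in
the jet. Besides the estimate, `u` inherits the normalisation, and `∇q ⟂ H_𝒫`. -/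
theorem exists_strong_solution {β : ℝ} (hβ : 0 ≤ β) : ∃ C : ℝ, 0 < C ∧
    ∀ f : L2V, (β = 0 → HorizontalMeanZero f) → ∃ (u : L2V) (q : L2),
      IsStrongSolution β f u q ∧ (β = 0 → HorizontalMeanZero u) ∧ grad q ∈ HPᗮ ∧
      normH2V u + normH1 q ≤ C * ‖f‖ := by
  obtain ⟨C, hC, h⟩ := exists_norm_jet_le hβ
  refine ⟨9 * C, by positivity, fun f hf => ?_⟩
  obtain ⟨x, hx, hxf, hxn⟩ := exists_mem_closure_of_apriori _ stokesL continuous_stokesL h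
    (mem_closure_force hβ hf)
  obtain ⟨a, da, dda, q, dq, t₁, t₀⟩ := x
  have w1 : ∀ i j, HasWeakDeriv i (a j) (da i j) := by
    intro i j
    rw [hasWeakDeriv_iff]
    intro φ hφ
    refine eq_of_mem_closure (f := fun x : Jet => inner ℝ (x.1 j) (toL2 (D i φ)))
      (g := fun x => -inner ℝ (x.2.1 i j) (toL2 φ)) (by fun_prop) (by fun_prop) ?_ hx
    rintro _ ⟨y, _, rfl⟩
    exact hasWeakDeriv_iff.1 (hasWeakDeriv_toL2 i (y.1 j)) φ hφ
  have w2 : ∀ k i j, HasWeakDeriv k (da i j) (dda k i j) := by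
    intro k i j
    rw [hasWeakDeriv_iff]
    intro φ hφ
    refine eq_of_mem_closure (f := fun x : Jet => inner ℝ (x.2.1 i j) (toL2 (D k φ)))
      (g := fun x => -inner ℝ (x.2.2.1 k i j) (toL2 φ)) (by fun_prop) (by fun_prop) ?_ hx
    rintro _ ⟨y, _, rfl⟩
    exact hasWeakDeriv_iff.1 (hasWeakDeriv_toL2 k (D i (y.1 j))) φ hφ
  have w3 : ∀ i, HasWeakDeriv i q (dq i) := by
    intro i
    rw [hasWeakDeriv_iff]
    intro φ hφ
    refine eq_of_mem_closure (f := fun x : Jet => inner ℝ x.2.2.2.1 (toL2 (D i φ)))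
      (g := fun x => -inner ℝ (x.2.2.2.2.1 i) (toL2 φ)) (by fun_prop) (by fun_prop) ?_ hx
    rintro _ ⟨y, _, rfl⟩
    exact hasWeakDeriv_iff.1 (hasWeakDeriv_toL2 i y.2) φ hφ
  have c1 : ∀ j, comp j (ofComp a) = a j := fun j => comp_ofComp j a
  have d1 : ∀ i j, wderiv i (a j) = da i j := fun i j => (w1 i j).wderiv_eq
  have d2 : ∀ k i j, wderiv k (da i j) = dda k i j := fun k i j => (w2 k i j).wderiv_eq
  have d3 : ∀ i, wderiv i q = dq i := fun i => (w3 i).wderiv_eq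
  have hq1 : MemH1 q := fun i => ⟨_, w3 i⟩
  have hH2 : MemH2V (ofComp a) := fun j => by
    rw [c1]
    exact ⟨fun i => ⟨_, w1 i j⟩, fun i => by rw [d1]; exact fun k => ⟨_, w2 k i j⟩⟩
  have hHP : ofComp a ∈ HP := by
    rw [mem_HP_iff]
    intro φ
    simp only [c1]
    refine eq_of_mem_closure (f := fun x : Jet => ∑ i, inner ℝ (x.1 i) (toL2 (D i φ)))
      (g := fun _ => 0) (by fun_prop) (by fun_prop) ?_ hx
    rintro _ ⟨y, hy, rfl⟩
    have := mem_HP_iff.1 (toL2V_mem_HP hy.1.div hy.1.vanish) φ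
    simp only [comp_toL2V] at this
    exact this
  have hgrad : grad q ∈ HPᗮ := by
    rw [Submodule.mem_orthogonal]
    intro v hv
    rw [inner_eq_sum]
    simp only [comp_grad, d3]
    refine eq_of_mem_closure (f := fun x : Jet => ∑ i, inner ℝ (comp i v) (x.2.2.2.2.1 i))
      (g := fun _ => 0) (by fun_prop) (by fun_prop) ?_ hx
    rintro _ ⟨y, _, rfl⟩
    exact mem_HP_iff.1 hv y.2
  have hmean : β = 0 → HorizontalMeanZero (ofComp a) := by
    intro hb
    rw [horizontalMeanZero_iff]
    intro j hj
    rw [c1]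
    refine eq_of_mem_closure (f := fun x : Jet => inner ℝ (x.1 j) (toL2 1))
      (g := fun _ => 0) (by fun_prop) (by fun_prop) ?_ hx
    rintro _ ⟨y, hy, rfl⟩
    change inner ℝ (toL2 (y.1 j)) (toL2 1) = 0
    rw [inner_toL2, mul_one]
    exact hy.2.1 hb j hj
  have htr : ∀ j, HasTrace (a j) (t₁ j) (t₀ j) := by
    intro j
    rw [hasTrace_iff]
    refine ⟨fun i => ⟨_, w1 i j⟩, fun φ => ?_⟩
    rw [d1]
    refine eq_of_mem_closure
      (f := fun x : Jet => inner ℝ (x.2.1 2 j) (toL2 φ) + inner ℝ (x.1 j) (toL2 (D 2 φ)))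
      (g := fun x => inner ℝ (x.2.2.2.2.2.1 j) (toL2T 1 φ) -
        inner ℝ (x.2.2.2.2.2.2 j) (toL2T (-1) φ)) (by fun_prop) (by fun_prop) ?_ hx
    rintro _ ⟨y, _, rfl⟩
    change inner ℝ (toL2 (D 2 (y.1 j))) (toL2 φ) + inner ℝ (toL2 (y.1 j)) (toL2 (D 2 φ)) =
      inner ℝ (toL2T 1 (y.1 j)) (toL2T 1 φ) - inner ℝ (toL2T (-1) (y.1 j)) (toL2T (-1) φ)
    rw [inner_toL2, inner_toL2, inner_toL2T, inner_toL2T, I_D_mul_two]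
    ring
  have hst : ∀ j, j ≠ 2 → HasTrace (strain (ofComp a) j 2) ((-(β / 2)) • t₁ j)
      ((β / 2) • t₀ j) := by
    intro j hj
    have es : strain (ofComp a) j 2 = (1 / 2 : ℝ) • (da j 2 + da 2 j) := by
      rw [strain, c1, c1, d1, d1]
    have hw : ∀ k, HasWeakDeriv k ((1 / 2 : ℝ) • (da j 2 + da 2 j))
        ((1 / 2 : ℝ) • (dda k j 2 + dda k 2 j)) := fun k => ((w2 k j 2).add (w2 k 2 j)).smul _
    rw [es, hasTrace_iff]
    refine ⟨fun k => ⟨_, hw k⟩, fun φ => ?_⟩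
    rw [(hw 2).wderiv_eq]
    refine eq_of_mem_closure
      (f := fun x : Jet => inner ℝ ((1 / 2 : ℝ) • (x.2.2.1 2 j 2 + x.2.2.1 2 2 j)) (toL2 φ) +
        inner ℝ ((1 / 2 : ℝ) • (x.2.1 j 2 + x.2.1 2 j)) (toL2 (D 2 φ)))
      (g := fun x => inner ℝ ((-(β / 2)) • x.2.2.2.2.2.1 j) (toL2T 1 φ) -
        inner ℝ ((β / 2) • x.2.2.2.2.2.2 j) (toL2T (-1) φ)) (by fun_prop) (by fun_prop) ?_ hx
    rintro _ ⟨y, hy, rfl⟩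
    have hn : IsAdmissible β y.1 := hy.1
    change inner ℝ ((1 / 2 : ℝ) • (toL2 (D 2 (D j (y.1 2))) + toL2 (D 2 (D 2 (y.1 j)))))
        (toL2 φ) + inner ℝ ((1 / 2 : ℝ) • (toL2 (D j (y.1 2)) + toL2 (D 2 (y.1 j))))
        (toL2 (D 2 φ)) = inner ℝ ((-(β / 2)) • toL2T 1 (y.1 j)) (toL2T 1 φ) -
        inner ℝ ((β / 2) • toL2T (-1) (y.1 j)) (toL2T (-1) φ)
    simp only [inner_smul_left, inner_add_left, inner_toL2, inner_toL2T, I_D_mul_two,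
      conj_trivial, hn.B_top hj, hn.B_bot hj]
    have v1 : B 1 (D j (y.1 2) * φ) = 0 := by
      rw [mul_comm]; exact B_mul_eq_zero _ (hn.vanish.D hj).1
    have v0 : B (-1) (D j (y.1 2) * φ) = 0 := by
      rw [mul_comm]; exact B_mul_eq_zero _ (hn.vanish.D hj).2
    rw [v1, v0]
    ring
  have hlap : -laplacian (ofComp a) + grad q = f := by
    rw [← hxf]
    refine ext_comp fun j => ?_
    rw [comp_stokesL, comp_add, comp_neg, comp_laplacian, comp_grad, c1, d3]
    simp only [d1, d2]
  refine ⟨ofComp a, q, ⟨hH2, ⟨fun j => (hH2 j).1, hHP⟩, hq1, hlap,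
    divergence_eq_zero_of_mem_HP (fun j => (hH2 j).1) hHP,
    noPenetration_of_mem_HP (fun j => (hH2 j).1) hHP, fun j hj => ?_⟩, hmean, hgrad, ?_⟩
  · refine ⟨_, _, t₁ j, t₀ j, hst j hj, by rw [c1]; exact htr j, ?_, ?_⟩
    · rw [smul_smul, ← add_smul]
      have : 2 * -(β / 2) + β = 0 := by ring
      rw [this, zero_smul]
    · rw [← neg_smul, smul_smul, ← add_smul]
      have : 2 * -(β / 2) + β = 0 := by ring
      rw [this, zero_smul]
  · set X : Jet := (a, da, dda, q, dq, t₁, t₀)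
    set n := ‖X‖
    have hn : 0 ≤ n := norm_nonneg _
    have p2 : ‖X.2‖ ≤ n := norm_snd_le X
    have p3 : ‖X.2.2‖ ≤ n := (norm_snd_le X.2).trans p2
    have p4 : ‖X.2.2.2‖ ≤ n := (norm_snd_le X.2.2).trans p3
    have p5 : ‖X.2.2.2.2‖ ≤ n := (norm_snd_le X.2.2.2).trans p4
    have q1 : ∀ j, ‖a j‖ ≤ n := fun j => (norm_le_pi_norm a j).trans (norm_fst_le X)
    have q2 : ∀ i j, ‖da i j‖ ≤ n := fun i j => (norm_le_pi_norm (da i) j).trans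
      ((norm_le_pi_norm da i).trans ((norm_fst_le X.2).trans p2))
    have q3 : ∀ k i j, ‖dda k i j‖ ≤ n := fun k i j => (norm_le_pi_norm (dda k i) j).trans
      ((norm_le_pi_norm (dda k) i).trans ((norm_le_pi_norm dda k).trans
        ((norm_fst_le X.2.2).trans p3)))
    have q4 : ‖q‖ ≤ n := (norm_fst_le X.2.2.2).trans p4
    have q5 : ∀ i, ‖dq i‖ ≤ n := fun i => (norm_le_pi_norm dq i).trans
      ((norm_fst_le X.2.2.2.2).trans p5)
    have hN2 : normH2V (ofComp a) ≤ 7 * n := by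
      refine Real.sqrt_le_iff.2 ⟨by positivity, ?_⟩
      simp only [c1, d1, d2]
      calc _ ≤ ∑ _j : Fin 3, (n ^ 2 + ∑ _i : Fin 3, n ^ 2 + ∑ _i : Fin 3, ∑ _k : Fin 3, n ^ 2) := by
            gcongr
            · exact q1 _
            · exact q2 _ _
            · exact q3 _ _ _
        _ ≤ (7 * n) ^ 2 := by
            simp only [Finset.sum_const, Finset.card_univ, Fintype.card_fin, nsmul_eq_mul]
            push_cast
            nlinarith [sq_nonneg n]
    have hN1 : normH1 q ≤ 2 * n := by
      refine Real.sqrt_le_iff.2 ⟨by positivity, ?_⟩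
      simp only [d3]
      calc _ ≤ n ^ 2 + ∑ _i : Fin 3, n ^ 2 := by
            gcongr
            exact q5 _
        _ ≤ (2 * n) ^ 2 := by
            simp only [Finset.sum_const, Finset.card_univ, Fintype.card_fin, nsmul_eq_mul]
            push_cast
            nlinarith [sq_nonneg n]
    calc normH2V (ofComp a) + normH1 q ≤ 7 * n + 2 * n := add_le_add hN2 hN1
      _ = 9 * n := by ring
      _ ≤ 9 * (C * ‖f‖) := by gcongr
      _ = 9 * C * ‖f‖ := by ring

/-! ### Uniqueness -/

theorem inner_polyZ_eq_zero_of_wderiv_eq_zero {q : L2} (hq : HasWeakDeriv 2 q 0)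
    {P : Polynomial ℝ} (hP : I (polyZ P) = 0) : inner ℝ q (toL2 (polyZ P)) = 0 := by
  obtain ⟨R, rfl⟩ := exists_derivative_eq P
  have h1 := eval_one_eq_of_I_eq_zero hP
  -- an antiderivative that vanishes on both components of `Γ`
  have hv : VanishesOnBoundary (polyZ (R - Polynomial.C (R.eval 1))) := by
    constructor
    · funext y
      change (R - Polynomial.C (R.eval 1)).eval 1 = 0
      simp
    · funext y
      change (R - Polynomial.C (R.eval 1)).eval (-1) = 0
      simp [h1]
  have h2 := hq.inner_D_of_vanishes hv
  rwa [D_two_polyZ, Polynomial.derivative_sub, Polynomial.derivative_C, sub_zero, inner_zero_left,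
    neg_zero] at h2

theorem inner_mode_eq_zero_of_wderiv_eq_zero {q : L2} (hq : ∀ i, HasWeakDeriv i q 0)
    {m n : ℤ} (hmn : (m, n) ≠ 0) (θ : ℝ) (P : Polynomial ℝ) :
    inner ℝ q (toL2 (mode m n θ * polyZ P)) = 0 := by
  obtain ⟨i, hi, ψ, hψ⟩ := exists_D_eq_mode_mul hmn θ P
  rw [← hψ, (hq i).inner_D_horizontal hi, inner_zero_left, neg_zero]

/-- A function with vanishing gradient is constant. -/
theorem eq_smul_one_of_wderiv_eq_zero {q : L2} (hq : ∀ i, HasWeakDeriv i q 0) :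
    ∃ c : ℝ, q = c • toL2 1 :=
  ⟨_, eq_mean_smul_one (fun _ _ hmn => inner_mode_eq_zero_of_wderiv_eq_zero hq hmn)
    fun _ => inner_polyZ_eq_zero_of_wderiv_eq_zero (hq 2)⟩

theorem wderiv_smul_one (i : Fin 3) (c : ℝ) : wderiv i (c • toL2 1) = 0 := by
  have := (hasWeakDeriv_toL2 i 1).smul c
  rw [this.wderiv_eq, D_one_eq_zero, map_zero, smul_zero]

/-- The kernel of the Stokes operator consists of constant horizontal fields: by symmetry, an
element of the kernel is orthogonal to the forces of all classical solutions. -/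
theorem eq_const_of_inner_laplacian_eq_zero {β : ℝ} (hβ : 0 ≤ β) {w : L2V} (hw : MemH2V w)
    (hP : w ∈ HP) (hs : NavierSlip β w)
    (h : ∀ v, IsAdmissible β v → inner ℝ (laplacian w) (toL2V v) = 0) :
    ∃ a : Fin 3 → ℝ, a 2 = 0 ∧ (0 < β → a = 0) ∧ ∀ j, comp j w = a j • toL2 1 :=
  eq_const_of_inner_force_eq_zero hβ fun v q hv => by
    rw [sum_inner_force hw hP hs hv, h v hv, neg_zero]

theorem coeFn_sub_of_eq_smul_one {f g : L2} {c : ℝ} (h : f + (-1 : ℝ) • g = c • toL2 1) :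
    ∀ᵐ p ∂volOmega, f p - g p = c := by
  have h' : f - g = c • toL2 1 := by rw [← h, neg_one_smul, sub_eq_add_neg]
  filter_upwards [Lp.coeFn_sub f g, Lp.coeFn_smul c (toL2 1), coeFn_toL2 1] with p h1 h2 h3
  rw [← Pi.sub_apply, ← h1, h', h2, Pi.smul_apply, h3]
  exact mul_one c

/-- Uniqueness up to constants: `Δw = ∇r` for the differences `w` of the velocities and `r` of the
pressures, so `w` is in the kernel of the Stokes operator, and then `∇r = 0`. -/
theorem strongSolution_unique {β : ℝ} (hβ : 0 ≤ β) {f u₁ u₂ : L2V} {q₁ q₂ : L2}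
    (h₁ : IsStrongSolution β f u₁ q₁) (h₂ : IsStrongSolution β f u₂ q₂) :
    (∃ c : ℝ, ∀ᵐ p ∂volOmega, q₁ p - q₂ p = c) ∧
      (∃ a : R3, a 2 = 0 ∧ (0 < β → a = 0) ∧ ∀ᵐ p ∂volOmega, u₁ p - u₂ p = a) := by
  set w : L2V := u₁ + (-1 : ℝ) • u₂ with hw_def
  set r : L2 := q₁ + (-1 : ℝ) • q₂ with hr_def
  have hw : MemH2V w := h₁.memH2.add (h₂.memH2.smul _)
  have hP : w ∈ HP := HP.add_mem h₁.memVP.2 (HP.smul_mem _ h₂.memVP.2)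
  have hs : NavierSlip β w := h₁.navier_slip.add h₁.memH2 (h₂.memH2.smul _)
    (h₂.navier_slip.smul h₂.memH2 _)
  have hr : MemH1 r := h₁.memH1.add (h₂.memH1.smul _)
  have hlap : laplacian w = grad r := by
    rw [hw_def, hr_def, h₁.memH2.laplacian_add (h₂.memH2.smul _), h₂.memH2.laplacian_smul,
      h₁.memH1.grad_add (h₂.memH1.smul _), h₂.memH1.grad_smul]
    have := h₁.momentum.trans h₂.momentum.symm
    rw [neg_one_smul, neg_one_smul, ← sub_eq_zero]
    rw [← sub_eq_zero] at this
    rw [← neg_eq_zero, ← this]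
    abel
  obtain ⟨a, ha2, ha, haw⟩ := eq_const_of_inner_laplacian_eq_zero hβ hw hP hs fun v hv => by
    rw [hlap]; exact hr.inner_grad_eq_zero hv.div hv.vanish
  have hr0 : ∀ i, wderiv i r = 0 := by
    intro i
    rw [← comp_grad, ← hlap, comp_laplacian]
    simp only [haw, wderiv_smul_one, wderiv_zero, Finset.sum_const_zero]
  obtain ⟨c, hc⟩ := eq_smul_one_of_wderiv_eq_zero fun i => hr0 i ▸ hr.hasWeakDeriv i
  refine ⟨⟨c, coeFn_sub_of_eq_smul_one hc⟩, WithLp.toLp 2 a, ha2, fun hb => ?_, ?_⟩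
  · rw [ha hb]; rfl
  · have hj : ∀ j, ∀ᵐ p ∂volOmega, comp j u₁ p - comp j u₂ p = a j := fun j =>
      coeFn_sub_of_eq_smul_one (by rw [← haw j, hw_def, comp_add, comp_smul])
    filter_upwards [ae_all_iff.2 hj, ae_all_iff.2 fun i => coeFn_comp i u₁,
      ae_all_iff.2 fun i => coeFn_comp i u₂] with p e1 e2 e3
    ext j
    rw [PiLp.sub_apply, ← e2, ← e3, e1]

/-! ### The norm given by the Stokes operator -/

theorem HorizontalMeanZero.add {u v : L2V} (hu : HorizontalMeanZero u)
    (hv : HorizontalMeanZero v) : HorizontalMeanZero (u + v) := by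
  rw [horizontalMeanZero_iff] at *
  intro j hj
  rw [comp_add, inner_add_left, hu j hj, hv j hj, add_zero]

theorem HorizontalMeanZero.smul {u : L2V} (c : ℝ) (hu : HorizontalMeanZero u) :
    HorizontalMeanZero (c • u) := by
  rw [horizontalMeanZero_iff] at *
  intro j hj
  rw [comp_smul, inner_smul_left, hu j hj, mul_zero]

theorem stokesDomain_add {β : ℝ} {u v : L2V} (hu : u ∈ stokesDomain β)
    (hv : v ∈ stokesDomain β) : u + v ∈ stokesDomain β :=
  ⟨hu.1.add hv.1, HP.add_mem hu.2.1 hv.2.1, hu.2.2.1.add hu.1 hv.1 hv.2.2.1,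
    fun hb => (hu.2.2.2 hb).add (hv.2.2.2 hb)⟩

theorem stokesDomain_smul {β : ℝ} (c : ℝ) {u : L2V} (hu : u ∈ stokesDomain β) :
    c • u ∈ stokesDomain β :=
  ⟨hu.1.smul c, HP.smul_mem c hu.2.1, hu.2.2.1.smul hu.1 c, fun hb => (hu.2.2.2 hb).smul c⟩

theorem MemH2V.stokesOp_add {u v : L2V} (hu : MemH2V u) (hv : MemH2V v) :
    stokesOp (u + v) = stokesOp u + stokesOp v := by
  rw [stokesOp, hu.laplacian_add hv, map_add]; rfl

theorem MemH2V.stokesOp_smul {u : L2V} (hu : MemH2V u) (c : ℝ) :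
    stokesOp (c • u) = c • stokesOp u := by
  rw [stokesOp, hu.laplacian_smul, map_smul]; rfl

theorem inner_stokesOp (u : L2V) {v : L2V} (hv : v ∈ HP) :
    inner ℝ (stokesOp u) v = inner ℝ (laplacian u) v := by
  rw [stokesOp, Submodule.inner_starProjection_left_eq_right,
    Submodule.starProjection_eq_self_iff.2 hv]

theorem eq_zero_of_stokesOp_eq_zero {β : ℝ} (hβ : 0 ≤ β) {u : L2V} (hu : u ∈ stokesDomain β)
    (h : stokesOp u = 0) : u = 0 := by
  obtain ⟨a, ha2, ha, hau⟩ := eq_const_of_inner_laplacian_eq_zero hβ hu.1 hu.2.1 hu.2.2.1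
    fun v hv => by rw [← inner_stokesOp u (toL2V_mem_HP hv.div hv.vanish), h, inner_zero_left]
  refine ext_comp fun j => ?_
  rw [hau j, comp_zero]
  by_cases hj : j = 2
  · subst hj; rw [ha2, zero_smul]
  · rcases hβ.eq_or_lt with hb | hb
    · have := horizontalMeanZero_iff.1 (hu.2.2.2 hb.symm) j hj
      rw [hau j, inner_smul_left, inner_toL2, mul_one] at this
      rw [show a j = 0 from (mul_eq_zero.1 this).resolve_right I_one_pos.ne', zero_smul]
    · rw [ha hb, Pi.zero_apply, zero_smul]

theorem isNormOn_stokesOp {β : ℝ} (hβ : 0 ≤ β) :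
    IsNormOn (stokesDomain β) fun u => ‖stokesOp u‖ where
  zero_mem := ⟨memH2V_zero, HP.zero_mem, navierSlip_zero β, fun _ =>
    horizontalMeanZero_iff.2 fun j _ => by rw [comp_zero, inner_zero_left]⟩
  add_mem _ hu _ hv := stokesDomain_add hu hv
  smul_mem c _ hu := stokesDomain_smul c hu
  nonneg _ _ := norm_nonneg _
  eq_zero_iff u hu := by
    refine ⟨fun h => eq_zero_of_stokesOp_eq_zero hβ hu (norm_eq_zero.1 h), ?_⟩
    rintro rfl
    have := memH2V_zero.stokesOp_smul 0
    rw [zero_smul, zero_smul] at this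
    simp only [this, norm_zero]
  smul c u hu := by
    simp only [hu.1.stokesOp_smul, norm_smul, Real.norm_eq_abs]
  add_le u hu v hv := by
    simp only [hu.1.stokesOp_add hv.1]
    exact norm_add_le _ _

theorem norm_laplacian_le (u : L2V) : ‖laplacian u‖ ≤ 2 * normH2V u := by
  have hs : ∀ j, ‖comp j (laplacian u)‖ ^ 2 ≤
      3 * ∑ i, ∑ k, ‖wderiv k (wderiv i (comp j u))‖ ^ 2 := by
    intro j
    rw [comp_laplacian]
    have h1 : ‖∑ i, wderiv i (wderiv i (comp j u))‖ ^ 2 ≤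
        (∑ i, ‖wderiv i (wderiv i (comp j u))‖) ^ 2 :=
      pow_le_pow_left₀ (norm_nonneg _) (norm_sum_le _ _) 2
    have h2 := sq_sum_le_card_mul_sum_sq (s := Finset.univ)
      (f := fun i : Fin 3 => ‖wderiv i (wderiv i (comp j u))‖)
    rw [Finset.card_univ, Fintype.card_fin] at h2
    refine h1.trans (h2.trans (mul_le_mul_of_nonneg_left (Finset.sum_le_sum fun i _ => ?_)
      (by norm_num)))
    exact Finset.single_le_sum (f := fun k => ‖wderiv k (wderiv i (comp j u))‖ ^ 2)
      (fun _ _ => sq_nonneg _) (Finset.mem_univ i)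
  have hle : ‖laplacian u‖ ^ 2 ≤ 2 ^ 2 * ∑ j, (‖comp j u‖ ^ 2 + ∑ i, ‖wderiv i (comp j u)‖ ^ 2 +
      ∑ i, ∑ k, ‖wderiv k (wderiv i (comp j u))‖ ^ 2) := by
    rw [norm_sq_eq_sum, Finset.mul_sum]
    refine Finset.sum_le_sum fun j _ => (hs j).trans ?_
    have h0 : 0 ≤ ∑ i, ‖wderiv i (comp j u)‖ ^ 2 := Finset.sum_nonneg fun _ _ => sq_nonneg _
    have h1 : 0 ≤ ∑ i, ∑ k, ‖wderiv k (wderiv i (comp j u))‖ ^ 2 :=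
      Finset.sum_nonneg fun _ _ => Finset.sum_nonneg fun _ _ => sq_nonneg _
    linarith [sq_nonneg ‖comp j u‖]
  have h2 := Real.sqrt_le_sqrt hle
  rwa [Real.sqrt_sq (norm_nonneg _), Real.sqrt_mul (by norm_num), Real.sqrt_sq zero_le_two] at h2

/-- For `β = 0` constant horizontal fields are orthogonal to the range of the Stokes operator. -/
theorem horizontalMeanZero_stokesOp {u : L2V} (hu : u ∈ stokesDomain 0) :
    HorizontalMeanZero (stokesOp u) := by
  rw [horizontalMeanZero_iff]
  intro j hj
  have hn := isAdmissible_const hj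
  have hf : ∀ k, force (Pi.single j (1 : Smooth)) 0 k = 0 := by
    intro k
    rw [force, map_zero, add_zero, neg_eq_zero, lap_apply]
    refine Finset.sum_eq_zero fun i _ => ?_
    by_cases hk : k = j
    · subst hk; rw [Pi.single_eq_same, D_one_eq_zero, map_zero]
    · rw [Pi.single_eq_of_ne hk, map_zero, map_zero]
  have h1 := sum_inner_force hu.1 hu.2.1 hu.2.2.1 hn 0
  simp only [hf, map_zero, inner_zero_right, Finset.sum_const_zero] at h1
  rw [zero_eq_neg, ← inner_stokesOp u (toL2V_mem_HP hn.div hn.vanish), inner_toL2V,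
    Finset.sum_eq_single j (fun k _ hk => by
      rw [Pi.single_eq_of_ne hk, map_zero, inner_zero_right]) (by simp), Pi.single_eq_same] at h1
  exact h1

/-- The `H²` estimate for the Stokes operator: `u` is the strong solution with force
`-stokesOp u`. -/
theorem exists_normH2V_le {β : ℝ} (hβ : 0 ≤ β) : ∃ C : ℝ, 0 < C ∧
    ∀ u ∈ stokesDomain β, normH2V u ≤ C * ‖stokesOp u‖ := by
  obtain ⟨C, hC, h⟩ := exists_strong_solution hβ
  refine ⟨C, hC, fun u hu => ?_⟩
  obtain ⟨u', q', hs, hm, hg, hle⟩ := h (-stokesOp u) fun hb => by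
    subst hb
    rw [← neg_one_smul ℝ]
    exact (horizontalMeanZero_stokesOp hu).smul _
  have hu' : u' ∈ stokesDomain β := ⟨hs.memH2, hs.memVP.2, hs.navier_slip, hm⟩
  have e : stokesOp u' = stokesOp u := by
    have h1 : laplacian u' = stokesOp u + grad q' := by
      rw [← neg_neg (stokesOp u), ← hs.momentum]; abel
    have h2 : HP.starProjection (stokesOp u) = stokesOp u :=
      Submodule.starProjection_eq_self_iff.2 (Submodule.starProjection_apply_mem _ _)
    rw [stokesOp, h1, map_add, h2, (Submodule.starProjection_apply_eq_zero_iff HP).2 hg, add_zero]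
  have e0 : u + (-1 : ℝ) • u' = 0 := by
    refine eq_zero_of_stokesOp_eq_zero hβ (stokesDomain_add hu (stokesDomain_smul _ hu')) ?_
    rw [hu.1.stokesOp_add (hu'.1.smul _), hu'.1.stokesOp_smul, e, neg_one_smul, add_neg_cancel]
  have e1 : u = u' := by rwa [neg_one_smul, ← sub_eq_add_neg, sub_eq_zero] at e0
  rw [norm_neg] at hle
  rw [e1]
  rw [e1] at hle
  exact (le_add_of_nonneg_right (Real.sqrt_nonneg _)).trans hle

end

end NavierSlab

open NavierSlab
theorem proposition2p3 (β : ℝ) (hβ : 0 ≤ β) :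
    -- existence of a strong solution, with the estimate
    (∃ C : ℝ, 0 < C ∧ ∀ f : L2V, (β = 0 → HorizontalMeanZero f) →
      ∃ (u : L2V) (q : L2), IsStrongSolution β f u q ∧
        normH2V u + normH1 q ≤ C * ‖f‖) ∧
    -- uniqueness up to constants (of the velocity itself if `β > 0`)
    (∀ (f u₁ u₂ : L2V) (q₁ q₂ : L2),
      IsStrongSolution β f u₁ q₁ → IsStrongSolution β f u₂ q₂ →
        (∃ c : ℝ, ∀ᵐ p ∂volOmega, q₁ p - q₂ p = c) ∧
        (∃ a : R3, a 2 = 0 ∧ (0 < β → a = 0) ∧ ∀ᵐ p ∂volOmega, u₁ p - u₂ p = a)) ∧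
    -- the Stokes operator gives a norm equivalent to the norm of `H²(Ω)`
    IsNormOn (stokesDomain β) (fun u => ‖stokesOp u‖) ∧
    (∃ c C : ℝ, 0 < c ∧ 0 < C ∧ ∀ u ∈ stokesDomain β,
      c * normH2V u ≤ ‖stokesOp u‖ ∧ ‖stokesOp u‖ ≤ C * normH2V u) := by
  refine ⟨?_, fun f u₁ u₂ q₁ q₂ h₁ h₂ => strongSolution_unique hβ h₁ h₂, isNormOn_stokesOp hβ, ?_⟩
  · obtain ⟨C, hC, h⟩ := exists_strong_solution hβ
    refine ⟨C, hC, fun f hf => ?_⟩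
    obtain ⟨u, q, h1, -, -, h2⟩ := h f hf
    exact ⟨u, q, h1, h2⟩
  · obtain ⟨C, hC, h⟩ := exists_normH2V_le hβ
    refine ⟨C⁻¹, 2, inv_pos.2 hC, two_pos, fun u hu => ⟨?_, ?_⟩⟩
    · rw [inv_mul_le_iff₀ hC]; exact h u hu
    · exact (Submodule.norm_starProjection_apply_le _ _).trans (norm_laplacian_le u)
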